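/- Let $n,j\ge 0$ be integers. Write $\mathcal H_n$ for the Siegel upper half-space of genus $n$ and $\mathcal H^{(n,j)}=\mathcal H_n\times \mathrm{Mat}_{j\times n}(\mathbb C)$, with points $(\tau,z)$. Let $G^{(n,j)}(\mathbb R)\subset Sp(2n+2j,\mathbb R)$ be the Jacobi group, the group of all products $\gamma=g\cdot(v,u,\zeta)$ with $g=\begin{pmatrix}A&B\\C&D\end{pmatrix}\in Sp(2n,\mathbb R)$ embedded as $\begin{pmatrix}A&0&B&0\\0&I_j&0&0\\C&0&D&0\\0&0&0&I_j\end{pmatrix}$ and $$(v,u,\zeta)=\begin{pmatrix}I_n&0&0&{}^{t}u\\v&I_j&u&\zeta\\0&0&I_n&-{}^{t}v\\0&0&0&I_j\end{pmatrix},\qquad u,v\in\mathrm{Mat}_{j\times n}(\mathbb R),\ \zeta+u\,{}^{t}v \text{ symmetric}.$$ It acts on $\mathcal H^{(n,j)}$ by $\gamma(\tau,z)=\big((A\tau+B)(C\tau+D)^{-1},\,w\,(C\tau+D)^{-1}\big)$, where $w=z+u+v\tau$. For each $g\in Sp(2n,\mathbb R)$ choose a holomorphic branch on $\mathcal H_n$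 of $J_{1/2}(g,\tau)=\det(C\tau+D)^{-1/2}$. For $k\in\mathbb Z$ and a real symmetric $j\times j$ matrix $\mathcal M$ put $$j^0_{k/2,\mathcal M}(\gamma,(\tau,z))=J_{1/2}(g,\tau)^{k}\exp\Big(2\pi i\,\mathrm{Tr}\,\mathcal M\big(\zeta+(v\tau+2z+u)\,{}^{t}v-w(C\tau+D)^{-1}C\,{}^{t}w\big)\Big).$$ Let $\Gamma\subset G^{(n,j)}(\mathbb R)$ be a discrete subgroup and $\chi:\Gamma\to\mathbb C$ a function. A meromorphic Jacobi form of genus $n$, weight $k/2$, index $\mathcal M$ and multiplier $\chi$ for $\Gamma$ is a meromorphic function $f$ on $\mathcal H^{(n,j)}$ such that $\chi(\gamma)f(\gamma x)\,j^0_{k/2,\mathcal M}(\gamma,x)=f(x)$ for all $\gamma\in\Gamma$ (as meromorphic functions of $x$), where it is part of the definition that $\chi(\gamma)\,j^0_{k/2,\mathcal M}(\gamma,x)$ is a cocycle: its value at $(\gamma_1\gamma_2,x)$ is the product of its values at $(\gamma_1,\gamma_2x)$ and $(\gamma_2,x)$. Let $\mathcal M\in\mathrm{Mat}_{j\times j}(\mathbb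 R)$ be symmetric and positive definite, with determinant $|\mathcal M|$ and classical adjoint $\widetilde{\mathcal M}$. Let $\frac{\partial}{\partial\tau}$ be the $n\times n$ matrix with entries $(1+\delta_{rs})\frac{\partial}{\partial\tau_{rs}}$ (where $\tau_{rs}=\tau_{sr}$ is a single coordinate), let $\frac{\partial}{\partial z}$ be the $j\times n$ matrix with entries $\frac{\partial}{\partial z_{rs}}$, and put $$L_{\mathcal M}=\det\Big(4\pi i\,|\mathcal M|\,\frac{\partial}{\partial\tau}-{}^{t}\!\Big(\frac{\partial}{\partial z}\Big)\widetilde{\mathcal M}\,\frac{\partial}{\partial z}\Big).$$ **Theorem.** Let $r\ge 0$ be an integer, and let $f$ be a meromorphic Jacobi form of genus $n$, weight $-r+\frac{n+j+1}{2}$, index $\mathcal M$ and multiplier $\chi$ for $\Gamma$. Then $L_{\mathcal M}^{\,r}f$ is a meromorphic Jacobi form of genus $n$, weight $r+\frac{n+j+1}{2}$, index $\mathcal M$ and multiplier $\chi$ for $\Gamma$. -/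

import Mathlib

open Matrix Topology

attribute [local instance] Matrix.normedAddCommGroup Matrix.normedSpace

/-! ### The Jacobi group -/

/-- The inclusion of `2n × 2n` matrices `(A, B; C, D)` into `2(n+j) × 2(n+j)` matrices,
with rows and columns ordered in blocks of sizes `n, j, n, j`. -/
def spEmbed {n j : ℕ} (g : Matrix (Fin n ⊕ Fin n) (Fin n ⊕ Fin n) ℝ) :
    Matrix ((Fin n ⊕ Fin j) ⊕ (Fin n ⊕ Fin j)) ((Fin n ⊕ Fin j) ⊕ (Fin n ⊕ Fin j)) ℝ :=
  fromBlocks (fromBlocks g.toBlocks₁₁ 0 0 1) (fromBlocks g.toBlocks₁₂ 0 0 0)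
    (fromBlocks g.toBlocks₂₁ 0 0 0) (fromBlocks g.toBlocks₂₂ 0 0 1)

/-- The matrix of the Heisenberg element `(v, u, ζ)`. -/
def heisMatrix {n j : ℕ} (v u : Matrix (Fin j) (Fin n) ℝ) (ζ : Matrix (Fin j) (Fin j) ℝ) :
    Matrix ((Fin n ⊕ Fin j) ⊕ (Fin n ⊕ Fin j)) ((Fin n ⊕ Fin j) ⊕ (Fin n ⊕ Fin j)) ℝ :=
  fromBlocks (fromBlocks 1 0 v 1) (fromBlocks 0 uᵀ u ζ) 0 (fromBlocks 1 (-vᵀ) 0 1)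

/-- `x = g · (v, u, ζ)` with `g ∈ Sp(2n, ℝ)` and `(v, u, ζ)` in the Heisenberg group. -/
def IsJacobi {n j : ℕ}
    (x : Matrix ((Fin n ⊕ Fin j) ⊕ (Fin n ⊕ Fin j)) ((Fin n ⊕ Fin j) ⊕ (Fin n ⊕ Fin j)) ℝ) :
    Prop :=
  ∃ g ∈ symplecticGroup (Fin n) ℝ, ∃ (v u : Matrix (Fin j) (Fin n) ℝ)
    (ζ : Matrix (Fin j) (Fin j) ℝ), (ζ + u * vᵀ).IsSymm ∧ x = spEmbed g * heisMatrix v u ζ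

theorem spEmbed_mul_heisMatrix {n j : ℕ} (A B C D : Matrix (Fin n) (Fin n) ℝ)
    (v u : Matrix (Fin j) (Fin n) ℝ) (ζ : Matrix (Fin j) (Fin j) ℝ) :
    spEmbed (fromBlocks A B C D) * heisMatrix v u ζ =
      fromBlocks (fromBlocks A 0 v 1) (fromBlocks B (A * uᵀ - B * vᵀ) u ζ)
        (fromBlocks C 0 0 0) (fromBlocks D (C * uᵀ - D * vᵀ) 0 1) := by
  simp [spEmbed, heisMatrix, fromBlocks_multiply, fromBlocks_add, sub_eq_add_neg]

/-- Inside the symplectic group, the elements `g · (v, u, ζ)` are those whose second block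
column is `(0, 1, 0, 0)` and whose last block row is `(0, 0, 0, 1)`. -/
theorem isJacobi_iff {n j : ℕ}
    (x : Matrix ((Fin n ⊕ Fin j) ⊕ (Fin n ⊕ Fin j)) ((Fin n ⊕ Fin j) ⊕ (Fin n ⊕ Fin j)) ℝ)
    (hx : x ∈ symplecticGroup (Fin n ⊕ Fin j) ℝ) :
    IsJacobi x ↔
      x * (fromRows (fromRows 0 1) 0 : Matrix ((Fin n ⊕ Fin j) ⊕ (Fin n ⊕ Fin j)) (Fin j) ℝ)
          = fromRows (fromRows 0 1) 0 ∧
      (fromCols 0 (fromCols 0 1) : Matrix (Fin j) ((Fin n ⊕ Fin j) ⊕ (Fin n ⊕ Fin j)) ℝ) * x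
          = fromCols 0 (fromCols 0 1) := by
  constructor
  · rintro ⟨g, -, v, u, ζ, -, rfl⟩
    rw [← fromBlocks_toBlocks g, spEmbed_mul_heisMatrix]
    constructor
    · simp [fromBlocks_mul_fromRows]
    · simp [fromCols_mul_fromBlocks]
  · rintro ⟨h1, h2⟩
    obtain ⟨P, Q, R, S, rfl⟩ : ∃ P Q R S, x = fromBlocks P Q R S :=
      ⟨_, _, _, _, (fromBlocks_toBlocks x).symm⟩
    obtain ⟨A, P', v, P'', rfl⟩ : ∃ A B C D, P = fromBlocks A B C D :=
      ⟨_, _, _, _, (fromBlocks_toBlocks P).symm⟩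
    obtain ⟨B, p, u, ζ, rfl⟩ : ∃ A B C D, Q = fromBlocks A B C D :=
      ⟨_, _, _, _, (fromBlocks_toBlocks Q).symm⟩
    obtain ⟨C, R₁, R₂, R₃, rfl⟩ : ∃ A B C D, R = fromBlocks A B C D :=
      ⟨_, _, _, _, (fromBlocks_toBlocks R).symm⟩
    obtain ⟨D, q, S₁, S₂, rfl⟩ : ∃ A B C D, S = fromBlocks A B C D :=
      ⟨_, _, _, _, (fromBlocks_toBlocks S).symm⟩
    simp [fromBlocks_mul_fromRows, fromRows_inj.eq_iff] at h1
    simp [fromCols_mul_fromBlocks, fromCols_inj.eq_iff] at h2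
    rw [SymplecticGroup.mem_iff] at hx
    obtain ⟨⟨rfl, rfl⟩, h1⟩ := h1
    obtain ⟨h2, rfl, rfl⟩ := h2
    rw [← fromRows_zero, fromRows_ext_iff] at h1
    rw [← fromCols_zero, fromCols_ext_iff] at h2
    obtain ⟨rfl, rfl⟩ := h1
    obtain ⟨rfl, -⟩ := h2
    simp [J, fromBlocks_transpose, fromBlocks_multiply, fromBlocks_add, fromBlocks_neg,
      fromBlocks_inj, ← fromBlocks_one, ← fromBlocks_zero] at hx
    obtain ⟨⟨a1, a2, -, a4⟩, ⟨b1, -⟩, ⟨c1, c2⟩, d1⟩ := hx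
    refine ⟨fromBlocks A B C D, ?_, v, u, ζ, ?_, ?_⟩
    · rw [SymplecticGroup.mem_iff]
      simp [J, fromBlocks_transpose, fromBlocks_multiply, a1, b1, c1, d1]
    · rw [IsSymm, transpose_add, transpose_mul, transpose_transpose]
      have : ζ + u * vᵀ - (ζᵀ + v * uᵀ) = u * vᵀ + ζ + (-(v * uᵀ) + -ζᵀ) := by abel
      rw [a4] at this
      exact (sub_eq_zero.1 this).symm
    · rw [spEmbed_mul_heisMatrix]
      have e1 : p = A * uᵀ - B * vᵀ := by
        have : p - (A * uᵀ - B * vᵀ) = B * vᵀ + p + -(A * uᵀ) := by abel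
        rw [a2] at this
        exact sub_eq_zero.1 this
      have e2 : q = C * uᵀ - D * vᵀ := by
        have : q - (C * uᵀ - D * vᵀ) = D * vᵀ + q + -(C * uᵀ) := by abel
        rw [c2] at this
        exact sub_eq_zero.1 this
      rw [e1, e2]

/-- The Jacobi group `G^{(n,j)}(ℝ) ⊆ Sp(2n+2j, ℝ)`. -/
def jacobiGroup (n j : ℕ) : Subgroup (symplecticGroup (Fin n ⊕ Fin j) ℝ) where
  carrier := {x | IsJacobi x.1}
  one_mem' := by
    show IsJacobi (1 : symplecticGroup (Fin n ⊕ Fin j) ℝ).1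
    rw [isJacobi_iff _ (Subtype.prop _)]
    simp
  mul_mem' := by
    intro a b ha hb
    change IsJacobi a.1 at ha
    change IsJacobi b.1 at hb
    show IsJacobi (a * b).1
    rw [isJacobi_iff _ (Subtype.prop _)] at ha hb ⊢
    obtain ⟨ha1, ha2⟩ := ha
    obtain ⟨hb1, hb2⟩ := hb
    refine ⟨?_, ?_⟩
    · rw [Submonoid.coe_mul, Matrix.mul_assoc, hb1, ha1]
    · rw [Submonoid.coe_mul, ← Matrix.mul_assoc, ha2, hb2]
  inv_mem' := by
    intro a ha
    change IsJacobi a.1 at ha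
    show IsJacobi a⁻¹.1
    rw [isJacobi_iff _ (Subtype.prop _)] at ha ⊢
    obtain ⟨ha1, ha2⟩ := ha
    have e1 : (a⁻¹ : symplecticGroup (Fin n ⊕ Fin j) ℝ).1 * a.1 = 1 := by
      rw [← Submonoid.coe_mul, inv_mul_cancel, Submonoid.coe_one]
    have e2 : a.1 * (a⁻¹ : symplecticGroup (Fin n ⊕ Fin j) ℝ).1 = 1 := by
      rw [← Submonoid.coe_mul, mul_inv_cancel, Submonoid.coe_one]
    refine ⟨?_, ?_⟩
    · conv_lhs => rw [← ha1]
      rw [← Matrix.mul_assoc, e1, Matrix.one_mul]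
    · conv_lhs => rw [← ha2]
      rw [Matrix.mul_assoc, e2, Matrix.mul_one]

/-- The symplectic factor `g` of `γ = g · (v, u, ζ)`. -/
def spPart {n j : ℕ} (γ : jacobiGroup n j) : symplecticGroup (Fin n) ℝ :=
  ⟨fromBlocks γ.1.1.toBlocks₁₁.toBlocks₁₁ γ.1.1.toBlocks₁₂.toBlocks₁₁
    γ.1.1.toBlocks₂₁.toBlocks₁₁ γ.1.1.toBlocks₂₂.toBlocks₁₁, by
    obtain ⟨g, hg, v, u, ζ, -, h⟩ := γ.2
    rw [← fromBlocks_toBlocks g] at h hg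
    rw [h, spEmbed_mul_heisMatrix]
    simpa using hg⟩

/-- The component `v` of `γ = g · (v, u, ζ)`. -/
def vPart {n j : ℕ} (γ : jacobiGroup n j) : Matrix (Fin j) (Fin n) ℝ :=
  γ.1.1.toBlocks₁₁.toBlocks₂₁

/-- The component `u` of `γ = g · (v, u, ζ)`. -/
def uPart {n j : ℕ} (γ : jacobiGroup n j) : Matrix (Fin j) (Fin n) ℝ :=
  γ.1.1.toBlocks₁₂.toBlocks₂₁

/-- The component `ζ` of `γ = g · (v, u, ζ)`. -/
def zetaPart {n j : ℕ} (γ : jacobiGroup n j) : Matrix (Fin j) (Fin j) ℝ :=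
  γ.1.1.toBlocks₁₂.toBlocks₂₂

theorem jacobi_decomposition {n j : ℕ} (γ : jacobiGroup n j) :
    γ.1.1 = spEmbed (spPart γ).1 * heisMatrix (vPart γ) (uPart γ) (zetaPart γ) := by
  obtain ⟨g, hg, v, u, ζ, -, h⟩ := γ.2
  rw [← fromBlocks_toBlocks g] at h
  simp only [spPart, vPart, uPart, zetaPart, h, spEmbed_mul_heisMatrix,
    toBlocks_fromBlocks₁₁, toBlocks_fromBlocks₁₂, toBlocks_fromBlocks₂₁, toBlocks_fromBlocks₂₂]

/-! ### The symmetric space and the action -/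

/-- The space of symmetric complex `n × n` matrices. -/
def symMat (n : ℕ) : Submodule ℂ (Matrix (Fin n) (Fin n) ℂ) where
  carrier := {A | A.IsSymm}
  zero_mem' := isSymm_zero
  add_mem' := fun ha hb => ha.add hb
  smul_mem' := fun c _ ha => ha.smul c

/-- The Siegel upper half-space of genus `n`, as a subset of the symmetric matrices. -/
def siegelUpper (n : ℕ) : Set (symMat n) := {τ | (τ.1.map Complex.im).PosDef}

/-- The ambient vector space of pairs `(τ, z)`, `τ` symmetric `n × n`, `z` of size `j × n`. -/
abbrev JacSpace (n j : ℕ) := symMat n × Matrix (Fin j) (Fin n) ℂ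

/-- The domain `ℋ_n × Mat_{j×n}(ℂ)`. -/
def jacDomain (n j : ℕ) : Set (JacSpace n j) := {x | x.1 ∈ siegelUpper n}

/-- A real matrix, viewed as a complex matrix. -/
def toC {m n : Type*} (A : Matrix m n ℝ) : Matrix m n ℂ := A.map Complex.ofReal

/-- `A τ + B`. -/
def autNum {n : ℕ} (g : symplecticGroup (Fin n) ℝ) (τ : symMat n) : Matrix (Fin n) (Fin n) ℂ :=
  toC g.1.toBlocks₁₁ * τ.1 + toC g.1.toBlocks₁₂

/-- `C τ + D`. -/
def autDenom {n : ℕ} (g : symplecticGroup (Fin n) ℝ) (τ : symMat n) :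
    Matrix (Fin n) (Fin n) ℂ :=
  toC g.1.toBlocks₂₁ * τ.1 + toC g.1.toBlocks₂₂

/-- The block relations of a symplectic matrix, over `ℂ`. -/
theorem symplectic_relations {n : ℕ} (g : symplecticGroup (Fin n) ℝ) :
    (toC g.1.toBlocks₁₁)ᵀ * toC g.1.toBlocks₂₁ = (toC g.1.toBlocks₂₁)ᵀ * toC g.1.toBlocks₁₁ ∧
    (toC g.1.toBlocks₁₂)ᵀ * toC g.1.toBlocks₂₂ = (toC g.1.toBlocks₂₂)ᵀ * toC g.1.toBlocks₁₂ ∧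
    (toC g.1.toBlocks₁₁)ᵀ * toC g.1.toBlocks₂₂
      = 1 + (toC g.1.toBlocks₂₁)ᵀ * toC g.1.toBlocks₁₂ ∧
    (toC g.1.toBlocks₂₂)ᵀ * toC g.1.toBlocks₁₁
      = 1 + (toC g.1.toBlocks₁₂)ᵀ * toC g.1.toBlocks₂₁ := by
  obtain ⟨h1, h2, h3⟩ := SymplecticGroup.fromBlocks_mem_iff.1
    ((fromBlocks_toBlocks g.1).symm ▸ g.2 :
      fromBlocks g.1.toBlocks₁₁ g.1.toBlocks₁₂ g.1.toBlocks₂₁ g.1.toBlocks₂₂ ∈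
        symplecticGroup (Fin n) ℝ)
  have k : ∀ A B : Matrix (Fin n) (Fin n) ℝ, toC (Aᵀ * B) = (toC A)ᵀ * toC B := by
    intro A B
    exact (Matrix.map_mul (f := Complex.ofRealHom)).trans rfl
  have l : ∀ A B : Matrix (Fin n) (Fin n) ℝ, toC (1 + A) = 1 + toC A := by
    intro A B
    ext a b
    by_cases hab : a = b <;> simp [toC, hab]
  refine ⟨?_, ?_, ?_, ?_⟩
  · rw [← k, ← k, h1]
  · rw [← k, ← k, h2]
  · rw [← k, ← k, ← l _ 0, sub_eq_iff_eq_add.1 h3]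
  · have h4 := congrArg transpose (sub_eq_iff_eq_add.1 h3)
    simp only [transpose_mul, transpose_add, transpose_one, transpose_transpose] at h4
    rw [← k, ← k, ← l _ 0, h4]

theorem spAct_isSymm {n : ℕ} (g : symplecticGroup (Fin n) ℝ) (τ : symMat n) :
    (autNum g τ * (autDenom g τ)⁻¹).IsSymm := by
  obtain ⟨h1, h2, h3, h4⟩ := symplectic_relations g
  have hτ : τ.1ᵀ = τ.1 := τ.2
  have key : (autDenom g τ)ᵀ * autNum g τ = (autNum g τ)ᵀ * autDenom g τ := by
    simp only [autDenom, autNum, transpose_add, transpose_mul, hτ, Matrix.add_mul,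
      Matrix.mul_add, Matrix.mul_assoc]
    simp only [← Matrix.mul_assoc (toC _)ᵀ, h1, h2, h3, h4]
    simp only [Matrix.add_mul, Matrix.mul_add, Matrix.one_mul, Matrix.mul_one]
    abel
  by_cases hd : IsUnit (autDenom g τ).det
  · have hd' : IsUnit (autDenom g τ)ᵀ.det := by rwa [det_transpose]
    rw [IsSymm, transpose_mul, transpose_nonsing_inv]
    calc (autDenom g τ)ᵀ⁻¹ * (autNum g τ)ᵀ
        = (autDenom g τ)ᵀ⁻¹ * ((autNum g τ)ᵀ * autDenom g τ) * (autDenom g τ)⁻¹ := by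
          rw [Matrix.mul_assoc, Matrix.mul_assoc, mul_nonsing_inv _ hd, Matrix.mul_one]
      _ = autNum g τ * (autDenom g τ)⁻¹ := by
          rw [← key, ← Matrix.mul_assoc, nonsing_inv_mul _ hd', Matrix.one_mul]
  · rw [nonsing_inv_apply_not_isUnit _ hd, Matrix.mul_zero]
    exact isSymm_zero

/-- `C τ + D` is invertible on the Siegel upper half-space. -/
theorem det_autDenom_ne_zero {n : ℕ} (g : symplecticGroup (Fin n) ℝ) {τ : symMat n}
    (hτ : τ ∈ siegelUpper n) : (autDenom g τ).det ≠ 0 := by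
  intro h0
  obtain ⟨w, hw, hw0⟩ := exists_mulVec_eq_zero_iff.2 h0
  obtain ⟨h1, h2, h3, h4⟩ := symplectic_relations g
  have hτs : τ.1ᵀ = τ.1 := τ.2
  have hC : ∀ A : Matrix (Fin n) (Fin n) ℝ, (toC A)ᴴ = (toC A)ᵀ := by
    intro A
    ext a b
    simp [toC]
  have key : (autDenom g τ)ᴴ * autNum g τ - (autNum g τ)ᴴ * autDenom g τ = τ.1 - τ.1ᴴ := by
    simp only [autDenom, autNum, conjTranspose_add, conjTranspose_mul, hC, Matrix.add_mul,
      Matrix.mul_add, Matrix.mul_assoc]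
    simp only [← Matrix.mul_assoc (toC _)ᵀ, h1, h2, h3, h4]
    simp only [Matrix.add_mul, Matrix.mul_add, Matrix.one_mul, Matrix.mul_one]
    abel
  have hY : τ.1 - τ.1ᴴ = (2 * Complex.I) • toC (τ.1.map Complex.im) := by
    ext a b
    have hab : τ.1 b a = τ.1 a b := congrFun (congrFun hτs a) b
    simp only [Matrix.sub_apply, conjTranspose_apply, hab, Matrix.smul_apply, toC, map_apply,
      smul_eq_mul]
    apply Complex.ext <;> simp
    ring
  have hz : star w ⬝ᵥ ((τ.1 - τ.1ᴴ) *ᵥ w) = 0 := by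
    rw [← key, sub_mulVec, ← mulVec_mulVec, ← mulVec_mulVec, hw0, mulVec_zero, sub_zero,
      dotProduct_mulVec, ← star_mulVec, hw0, star_zero, zero_dotProduct]
  rw [hY, smul_mulVec, dotProduct_smul, smul_eq_zero] at hz
  have hz := hz.resolve_left (by simp)
  set Y := τ.1.map Complex.im
  have hYp : Y.PosDef := hτ
  have hre : (star w ⬝ᵥ (toC Y *ᵥ w)).re =
      (fun i => (w i).re) ⬝ᵥ (Y *ᵥ fun i => (w i).re)
        + (fun i => (w i).im) ⬝ᵥ (Y *ᵥ fun i => (w i).im) := by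
    simp only [dotProduct, mulVec, toC, map_apply, Pi.star_apply, Complex.re_sum,
      ← Finset.sum_add_distrib, Finset.mul_sum]
    refine Finset.sum_congr rfl fun a _ => Finset.sum_congr rfl fun b _ => ?_
    simp
  rw [hz, Complex.zero_re] at hre
  have p1 : ∀ v : Fin n → ℝ, 0 ≤ v ⬝ᵥ (Y *ᵥ v) := fun v => by
    simpa using hYp.posSemidef.dotProduct_mulVec_nonneg v
  have p2 : ∀ v : Fin n → ℝ, v ⬝ᵥ (Y *ᵥ v) = 0 → v = 0 := fun v hv => by
    by_contra hne
    have := hYp.dotProduct_mulVec_pos hne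
    simp [hv] at this
  have q1 := p2 _ (le_antisymm (by linarith [p1 fun i => (w i).im]) (p1 fun i => (w i).re))
  have q2 := p2 _ (le_antisymm (by linarith [p1 fun i => (w i).re]) (p1 fun i => (w i).im))
  exact hw (funext fun i => Complex.ext (congrFun q1 i) (congrFun q2 i))

/-- `τ ↦ (A τ + B) (C τ + D)⁻¹`. -/
noncomputable def spAct {n : ℕ} (g : symplecticGroup (Fin n) ℝ) (τ : symMat n) : symMat n :=
  ⟨autNum g τ * (autDenom g τ)⁻¹, spAct_isSymm g τ⟩

/-- The action of `γ = g · (v, u, ζ)` on pairs: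
`(v, u, ζ)` sends `(τ, z)` to `(τ, z + u + v τ)`, and `g = (A, B; C, D)` sends `(τ, z)` to
`((A τ + B) (C τ + D)⁻¹, z (C τ + D)⁻¹)`. -/
noncomputable def jacAct {n j : ℕ} (γ : jacobiGroup n j) (x : JacSpace n j) : JacSpace n j :=
  (spAct (spPart γ) x.1,
    (x.2 + toC (uPart γ) + toC (vPart γ) * x.1.1) * (autDenom (spPart γ) x.1)⁻¹)

/-! ### Automorphy factors -/

/-- A choice, for every `g ∈ Sp(2n, ℝ)`, of a branch of `det (C τ + D) ^ (-1/2)` on the Siegel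
upper half-space (a continuous, hence holomorphic, function of `τ`). -/
structure SqrtBranch (n : ℕ) where
  /-- the value of the chosen branch -/
  toFun : symplecticGroup (Fin n) ℝ → symMat n → ℂ
  continuousOn_toFun : ∀ g, ContinuousOn (toFun g) (siegelUpper n)
  sq_toFun : ∀ g, ∀ τ ∈ siegelUpper n, toFun g τ ^ 2 = ((autDenom g τ).det)⁻¹

theorem SqrtBranch.nonempty (n : ℕ) : Nonempty (SqrtBranch n) := by
  classical
  have hconv : Convex ℝ (siegelUpper n) := by
    intro a ha b hb s t hs ht hst
    have e : ((s • a + t • b : symMat n).1.map Complex.im)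
        = s • a.1.map Complex.im + t • b.1.map Complex.im := by
      ext i k
      simp
    show PosDef _
    rw [e]
    rcases hs.eq_or_lt with rfl | hs
    · have : t = 1 := by linarith
      subst this
      rw [zero_smul, one_smul, zero_add]
      exact hb
    · exact (PosDef.smul ha hs).add_posSemidef (PosSemidef.smul (PosDef.posSemidef hb) ht)
  have hi : (⟨Complex.I • 1, (isSymm_one).smul _⟩ : symMat n) ∈ siegelUpper n := by
    show PosDef _
    have : ((Complex.I • (1 : Matrix (Fin n) (Fin n) ℂ)).map Complex.im) = 1 := by
      ext a b
      by_cases hab : a = b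
      · subst hab
        simp
      · simp [hab]
    simpa [this] using PosDef.one
  have hcm : ContinuousSMul ℝ (symMat n) :=
    Topology.IsInducing.subtypeVal.continuousSMul continuous_id rfl
  have hlc0 : LocallyConvexSpace ℝ (Matrix (Fin n) (Fin n) ℂ) :=
    inferInstanceAs (LocallyConvexSpace ℝ (Fin n → Fin n → ℂ))
  have hlc : LocallyConvexSpace ℝ (symMat n) :=
    LocallyConvexSpace.induced (((symMat n).subtype).restrictScalars ℝ)
  have hcs : ContractibleSpace (siegelUpper n) := hconv.contractibleSpace ⟨_, hi⟩
  have hlp : LocallyPathConnectedSpace (siegelUpper n) := hconv.locallyPathConnectedSpace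
  have key : ∀ g : symplecticGroup (Fin n) ℝ, ∃ F : C(siegelUpper n, ℂ),
      ∀ τ, F τ ^ 2 = ((autDenom g τ.1).det)⁻¹ := by
    intro g
    have hc : Continuous fun τ : siegelUpper n => ((autDenom g τ.1).det)⁻¹ := by
      refine Continuous.inv₀ ?_ fun τ => det_autDenom_ne_zero g τ.2
      refine Continuous.matrix_det ?_
      refine (Continuous.matrix_mul continuous_const ?_).add continuous_const
      exact continuous_subtype_val.comp continuous_subtype_val
    obtain ⟨e₀, he₀⟩ := IsAlgClosed.exists_pow_nat_eq
      ((autDenom g (⟨Complex.I • 1, (isSymm_one).smul _⟩ : symMat n)).det)⁻¹ (n := 2) (by norm_num)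
    obtain ⟨F, ⟨-, hF⟩, -⟩ :=
      (isCoveringMapOn_npow (𝕜 := ℂ) 2 (by norm_num)).existsUnique_continuousMap_lifts
        (⟨_, hc⟩ : C(siegelUpper n, ℂ)) (a₀ := ⟨_, hi⟩) (e₀ := e₀) he₀
        (fun τ => inv_ne_zero (det_autDenom_ne_zero g τ.2))
    exact ⟨F, fun τ => congrFun hF τ⟩
  choose F hF using key
  refine ⟨⟨fun g τ => if h : τ ∈ siegelUpper n then F g ⟨τ, h⟩ else 0, fun g => ?_, ?_⟩⟩
  · rw [continuousOn_iff_continuous_domRestrict]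
    refine (F g).continuous.congr fun τ => ?_
    simp [Set.domRestrict]
  · intro g τ hτ
    simp only [hτ, dif_pos]
    exact hF g ⟨τ, hτ⟩

/-- `e^M(A) = exp(2 π i Tr(M A))`. -/
noncomputable def expIndex {j : ℕ} (M : Matrix (Fin j) (Fin j) ℝ)
    (A : Matrix (Fin j) (Fin j) ℂ) : ℂ :=
  Complex.exp (2 * Real.pi * Complex.I * (toC M * A).trace)

/-- The factor of automorphy `j⁰_{k/2, M}(γ, (τ, z))`, for `γ = g · (v, u, ζ)`:
`det (C τ + D) ^ (-k/2)` times
`e^M(ζ + (v τ + 2 z + u) vᵀ - w (C τ + D)⁻¹ C wᵀ)`, where `w = z + u + v τ`. -/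
noncomputable def jacFactor {n j : ℕ} (J : SqrtBranch n) (k : ℤ) (M : Matrix (Fin j) (Fin j) ℝ)
    (γ : jacobiGroup n j) (x : JacSpace n j) : ℂ :=
  J.toFun (spPart γ) x.1 ^ k *
    expIndex M
      (toC (zetaPart γ)
        + (toC (vPart γ) * x.1.1 + 2 • x.2 + toC (uPart γ)) * (toC (vPart γ))ᵀ
        - (x.2 + toC (uPart γ) + toC (vPart γ) * x.1.1)
            * (autDenom (spPart γ) x.1)⁻¹ * toC (spPart γ).1.toBlocks₂₁
            * (x.2 + toC (uPart γ) + toC (vPart γ) * x.1.1)ᵀ)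

/-! ### Meromorphic Jacobi forms -/

/-- `f` is a meromorphic function (of several variables) on `U`: near each point of `U` it is
a quotient of two holomorphic functions, the denominator not vanishing identically near that
point.  At zeros of the denominator the value of `f` carries no information. -/
def IsMeromorphicFunOn {E : Type*} [NormedAddCommGroup E] [NormedSpace ℂ E]
    (f : E → ℂ) (U : Set E) : Prop :=
  ∀ p ∈ U, ∃ a b : E → ℂ, AnalyticAt ℂ a p ∧ AnalyticAt ℂ b p ∧
    (¬ ∀ᶠ x in 𝓝 p, b x = 0) ∧ ∀ᶠ x in 𝓝 p, b x ≠ 0 → f x = a x / b x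

/-- `f` is a meromorphic Jacobi form of genus `n`, weight `k / 2`, index `M` and multiplier `χ`
for the discrete subgroup `Γ` of the Jacobi group.  The transformation law is required wherever
both sides are defined, that is, at the points `x` such that `f` is holomorphic at `x` and at
`γ x`. -/
structure IsMeromorphicJacobiForm {n j : ℕ} (J : SqrtBranch n) (k : ℤ)
    (M : Matrix (Fin j) (Fin j) ℝ) (Γ : Subgroup (jacobiGroup n j)) (χ : Γ → ℂ)
    (f : JacSpace n j → ℂ) : Prop where
  discrete : DiscreteTopology Γ
  cocycle : ∀ γ₁ γ₂ : Γ, ∀ x ∈ jacDomain n j,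
    χ (γ₁ * γ₂) * jacFactor J k M (γ₁ * γ₂ : Γ).1 x =
      (χ γ₁ * jacFactor J k M γ₁.1 (jacAct γ₂.1 x)) * (χ γ₂ * jacFactor J k M γ₂.1 x)
  meromorphic : IsMeromorphicFunOn f (jacDomain n j)
  modular : ∀ γ : Γ, ∀ x ∈ jacDomain n j, AnalyticAt ℂ f x → AnalyticAt ℂ f (jacAct γ.1 x) →
    jacFactor J k M γ.1 x * χ γ * f (jacAct γ.1 x) = f x

/-! ### The operator `L_M` -/

/-- The direction of the coordinate `τ_{rs} = τ_{sr}` on symmetric matrices. -/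
def tauDir {n : ℕ} (r s : Fin n) : symMat n :=
  ⟨Matrix.of fun a b => if (a = r ∧ b = s) ∨ (a = s ∧ b = r) then 1 else 0, by
    ext a b
    simp only [transpose_apply, of_apply]
    congr 1
    simp only [eq_iff_iff]
    tauto⟩

/-- The partial derivative `∂/∂τ_{rs}`. -/
noncomputable def dTau {n j : ℕ} (r s : Fin n) (f : JacSpace n j → ℂ) : JacSpace n j → ℂ :=
  fun x => lineDeriv ℂ f x (tauDir r s, 0)

/-- The partial derivative `∂/∂z_{as}`. -/
noncomputable def dZ {n j : ℕ} (a : Fin j) (s : Fin n) (f : JacSpace n j → ℂ) :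
    JacSpace n j → ℂ :=
  fun x => lineDeriv ℂ f x (0, Matrix.single a s 1)

/-- The `(r, s)` entry of the matrix of differential operators
`4 π i |M| ∂/∂τ - (∂/∂z)ᵀ M̃ (∂/∂z)`, where `∂/∂τ` has entries `(1 + δ_{rs}) ∂/∂τ_{rs}` and
`M̃` is the classical adjoint of `M`. -/
noncomputable def heatEntry {n j : ℕ} (M : Matrix (Fin j) (Fin j) ℝ) (r s : Fin n)
    (f : JacSpace n j → ℂ) : JacSpace n j → ℂ :=
  fun x => 4 * Real.pi * Complex.I * (M.det : ℂ) * ((1 + if r = s then 1 else 0) * dTau r s f x)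
    - ∑ a, ∑ b, ((M.adjugate a b : ℝ) : ℂ) * dZ a r (dZ b s f) x

/-- The operator `L_M`, the determinant of the `n × n` matrix of (commuting) differential
operators with entries `heatEntry M r s`, expanded by the Leibniz formula; the product of the
entries `(σ i, i)` is their composition. -/
noncomputable def heatOp {n j : ℕ} (M : Matrix (Fin j) (Fin j) ℝ) (f : JacSpace n j → ℂ) :
    JacSpace n j → ℂ :=
  fun x => ∑ σ : Equiv.Perm (Fin n), ((Equiv.Perm.sign σ : ℤ) : ℂ) *
    (List.finRange n).foldr (fun i h => heatEntry M (σ i) i h) f x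

/-!
# Powers of the heat operator map Jacobi forms to Jacobi forms

Let `H` be the matrix of constant coefficient operators with `L_M = det H`. The theorem is an
intertwining property of `(det H) ^ r` between the actions of the Jacobi group in the weights
`(n + j + 1) / 2 - r` and `(n + j + 1) / 2 + r`, and it suffices to prove it at a single point `x₀`
for a function that is analytic near `γ x₀` (`heatOp_iterate_jacFactor`).

Near `x₀ = (τ₀, z₀)` the element `γ` acts as an affine map that sends `x₀` to a point `(0, w)`,
followed by `(τ, z) ↦ (τ (1 + S τ)⁻¹, z (1 + S τ)⁻¹)` with `S = (C τ₀ + D)⁻¹ C`, which fixes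
`(0, w)`, followed by another affine map (`jacAct_eq`). The matrices in this decomposition are
complex, so it takes place outside of the real group, but all the maps are defined near the points
in question.

* An affine substitution `τ ↦ Uᵀ τ U + B`, `z ↦ (z + u + v τ) U`, combined with its exponential
  factor, acts on the symbols by an algebra automorphism that changes `H` to `U H Uᵀ`
  (`affSymbol_heatSymbol`). Hence `det H` is multiplied by `(det U) ^ 2`
  (`heatOp_iterate_affine`).
* For the transformation with parameter `S`, replace `S` by `s S` and differentiate with respect to
  `s`. The transformed functions move by a first order operator `infAct` of weight
  `(n + j + 1) / 2 - r`. An identity in the algebra of differential operators with polynomial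
  coefficients, `WeylRep.ρ_det_pow_mul_infAct`, moves `(det H) ^ r` past this operator and changes
  the weight to `(n + j + 1) / 2 + r`. At `(0, w)` the vector field vanishes and the operator is a
  scalar, so that the values at this point solve a linear differential equation, whose solution is
  the required exponential (`heatOp_iterate_flow`, `heatOp_iterate_siegelShift`).

The identity between differential operators rests on two facts. The entries of
`(∂/∂z) τ + 4 π i M z` commute with `H`, which allows one to complete the square and to replace the
terms in `z` by a quadratic form in these operators. What remains is `Tr (τ S τ H) / 2` and a
multiple of `Tr (S τ)`; their commutators with `(det H) ^ r` follow from Jacobi's formula for the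
derivative of a determinant, and the adjugates of `H` that they produce cancel for these
weights.

For a meromorphic form `f`, the function `(det H) ^ r f` is meromorphic because derivatives of
quotients are quotients (`diffRep_div`). The points at which both `f` and `f ∘ γ` are analytic are
dense (`frequently_analyticAt_and_jacAct`). At these points the local law applies, and by continuity
the transformation law holds wherever both of its sides are analytic. The factors of automorphy in
the two weights differ by `det (C τ + D) ^ (-2 r)`, which is a cocycle.
-/

/-! ### Derivations and determinants -/

theorem Derivation.map_finset_prod {R A ι : Type*} [CommRing R] [CommRing A] [Algebra R A]
    [DecidableEq ι] (D : Derivation R A A) (s : Finset ι) (f : ι → A) :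
    D (∏ i ∈ s, f i) = ∑ i ∈ s, (∏ j ∈ s.erase i, f j) * D (f i) := by
  induction s using Finset.induction_on with
  | empty => simp
  | insert a s ha ih =>
    rw [Finset.prod_insert ha, Derivation.leibniz, ih, Finset.sum_insert ha,
      Finset.erase_insert ha, smul_eq_mul, smul_eq_mul, add_comm, Finset.mul_sum]
    congr 1
    refine Finset.sum_congr rfl fun i hi => ?_
    have hia : i ≠ a := fun h => ha (h ▸ hi)
    rw [Finset.erase_insert_of_ne hia.symm, Finset.prod_insert (by simp [ha]), mul_assoc]

/-- Jacobi's formula for the derivative of a determinant. -/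
theorem Derivation.map_det {R A n : Type*} [CommRing R] [CommRing A] [Algebra R A]
    [Fintype n] [DecidableEq n] (D : Derivation R A A) (H : Matrix n n A) :
    D H.det = ∑ i, ∑ k, H.adjugate i k * D (H k i) := by
  have h : ∀ i, ∑ k, H.adjugate i k * D (H k i) = (H.updateCol i fun k => D (H k i)).det := by
    intro i
    rw [← cramer_apply, cramer_eq_adjugate_mulVec, mulVec, dotProduct]
  simp only [h, det_apply]
  rw [map_sum, Finset.sum_comm]
  refine Finset.sum_congr rfl fun σ _ => ?_
  rw [← Finset.smul_sum, Units.smul_def, Units.smul_def, map_zsmul, D.map_finset_prod]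
  congr 1
  refine Finset.sum_congr rfl fun i _ => ?_
  rw [← Finset.prod_erase_mul _ _ (Finset.mem_univ i), updateCol_self]
  congr 1
  refine Finset.prod_congr rfl fun k hk => ?_
  rw [updateCol_ne (Finset.ne_of_mem_erase hk)]

/-! ### Symbols of constant coefficient operators -/

/-- The algebra of symbols of differential operators with constant coefficients on `(τ, z)`:
polynomials in commuting variables, one for each pair `{r, s}` (the symbol of
`(1 + δ_{rs}) ∂/∂τ_{rs}`) and one for each `(a, s)` (the symbol of `∂/∂z_{as}`). -/
abbrev HeatSymbol (n j : ℕ) := MvPolynomial (Sym2 (Fin n) ⊕ Fin j × Fin n) ℂ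

open MvPolynomial in
/-- The matrix of symbols of `(1 + δ_{rs}) ∂/∂τ_{rs}`. -/
noncomputable def tauSymbol (n j : ℕ) : Matrix (Fin n) (Fin n) (HeatSymbol n j) :=
  of fun r s => X (Sum.inl s(r, s))

open MvPolynomial in
/-- The matrix of symbols of `∂/∂z_{as}`. -/
noncomputable def zSymbol (n j : ℕ) : Matrix (Fin j) (Fin n) (HeatSymbol n j) :=
  of fun a s => X (Sum.inr (a, s))

/-- The matrix of symbols of `4 π i |N| ∂/∂τ - (∂/∂z)ᵀ Ñ (∂/∂z)`. -/
noncomputable def heatSymbol {n j : ℕ} (N : Matrix (Fin j) (Fin j) ℂ) :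
    Matrix (Fin n) (Fin n) (HeatSymbol n j) :=
  (4 * Real.pi * Complex.I * N.det) • tauSymbol n j
    - (zSymbol n j)ᵀ * N.adjugate.map (algebraMap ℂ (HeatSymbol n j)) * zSymbol n j

/-- The entries of the symmetric matrix `E` whose direction is differentiated along by
`(1 + δ_{rs}) ∂/∂τ_{rs}`, for `q = {r, s}`. -/
def symCoord {n : ℕ} (q : Sym2 (Fin n)) (k l : Fin n) : ℂ :=
  if q = s(k, l) then (if k = l then 2 else 1) else 0

theorem symCoord_mk {n : ℕ} (r s k l : Fin n) : symCoord s(r, s) k l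
    = (if r = k then 1 else 0) * (if s = l then 1 else 0)
      + (if r = l then 1 else 0) * (if s = k then 1 else 0) := by
  unfold symCoord
  by_cases h1 : r = k <;> by_cases h2 : s = l <;> by_cases h3 : r = l <;>
    by_cases h4 : s = k <;> by_cases h5 : k = l <;> simp_all
  norm_num

theorem symCoord_comm {n : ℕ} (q : Sym2 (Fin n)) (k l : Fin n) :
    symCoord q k l = symCoord q l k := by
  simp [symCoord, Sym2.eq_swap (a := k), eq_comm (a := k)]

open MvPolynomial in
/-- The derivation of the symbols given by the commutator with the multiplication by `τ_{kl}`. -/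
noncomputable def tauDeriv {n j : ℕ} (k l : Fin n) :
    Derivation ℂ (HeatSymbol n j) (HeatSymbol n j) :=
  mkDerivation ℂ (Sum.elim (fun q => C (symCoord q k l)) fun _ => 0)

open MvPolynomial in
/-- The derivation of the symbols given by the commutator with the multiplication by `z_{al}`. -/
noncomputable def zDeriv {n j : ℕ} (a : Fin j) (l : Fin n) :
    Derivation ℂ (HeatSymbol n j) (HeatSymbol n j) :=
  mkDerivation ℂ (Sum.elim (fun _ => 0) fun p => if p = (a, l) then 1 else 0)

theorem tauSymbol_transpose (n j : ℕ) : (tauSymbol n j)ᵀ = tauSymbol n j := by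
  ext1 r s
  simp [tauSymbol, Sym2.eq_swap]

theorem heatSymbol_transpose {n j : ℕ} {N : Matrix (Fin j) (Fin j) ℂ} (hN : N.IsSymm) :
    (heatSymbol N : Matrix (Fin n) (Fin n) (HeatSymbol n j))ᵀ = heatSymbol N := by
  have : (N.adjugate.map (algebraMap ℂ (HeatSymbol n j)))ᵀ = N.adjugate.map (algebraMap ℂ _) := by
    rw [← transpose_map, adjugate_transpose, hN.eq]
  simp only [heatSymbol, transpose_sub, transpose_smul, tauSymbol_transpose, transpose_mul, this,
    transpose_transpose, Matrix.mul_assoc]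

theorem heatSymbol_apply {n j : ℕ} (N : Matrix (Fin j) (Fin j) ℂ) (r s : Fin n) :
    (heatSymbol N r s : HeatSymbol n j)
      = (4 * Real.pi * Complex.I * N.det) • tauSymbol n j r s
        - ∑ a, ∑ b, N.adjugate a b • (zSymbol n j a r * zSymbol n j b s) := by
  simp only [heatSymbol, Matrix.sub_apply, Matrix.smul_apply, Matrix.mul_apply, transpose_apply,
    map_apply, Finset.sum_mul]
  rw [Finset.sum_comm]
  congr 1
  refine Finset.sum_congr rfl fun a _ => Finset.sum_congr rfl fun b _ => ?_
  rw [Algebra.smul_def]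
  ring

/-- The commutator of an entry of the heat matrix with a coordinate of `τ` is a constant. -/
theorem tauDeriv_heatSymbol {n j : ℕ} (N : Matrix (Fin j) (Fin j) ℂ) (r s k l : Fin n) :
    tauDeriv k l (heatSymbol N r s : HeatSymbol n j)
      = algebraMap ℂ _ (4 * Real.pi * Complex.I * N.det * symCoord s(r, s) k l) := by
  rw [heatSymbol_apply, map_sub, map_sum, (tauDeriv k l).map_smul]
  have h1 : tauDeriv k l (tauSymbol n j r s) = MvPolynomial.C (symCoord s(r, s) k l) := by
    simp [tauDeriv, tauSymbol, MvPolynomial.mkDerivation_X]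
  have h2 : ∀ a b, tauDeriv k l (zSymbol n j a b) = 0 := by
    intro a b
    simp [tauDeriv, zSymbol, MvPolynomial.mkDerivation_X]
  simp [h1, h2, Derivation.leibniz, MvPolynomial.smul_eq_C_mul]

theorem zDeriv_zSymbol {n j : ℕ} (a b : Fin j) (k l : Fin n) :
    zDeriv a k (zSymbol n j b l) = if b = a ∧ l = k then 1 else 0 := by
  simp [zDeriv, zSymbol, MvPolynomial.mkDerivation_X]

theorem tauDeriv_zSymbol {n j : ℕ} (b : Fin j) (i k l : Fin n) :
    tauDeriv i k (zSymbol n j b l) = 0 := by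
  simp [tauDeriv, zSymbol, MvPolynomial.mkDerivation_X]

theorem zDeriv_heatSymbol {n j : ℕ} {N : Matrix (Fin j) (Fin j) ℂ} (hN : N.IsSymm)
    (a : Fin j) (r s k : Fin n) :
    zDeriv a k (heatSymbol N r s : HeatSymbol n j)
      = - ∑ b, N.adjugate a b • ((if s = k then zSymbol n j b r else 0)
          + if r = k then zSymbol n j b s else 0) := by
  have hs : ∀ b, N.adjugate b a = N.adjugate a b := fun b => by
    conv_lhs => rw [← hN.eq, ← adjugate_transpose, transpose_apply]
  rw [heatSymbol_apply, map_sub, map_sum, (zDeriv a k).map_smul]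
  have h1 : zDeriv a k (tauSymbol n j r s) = 0 := by
    simp [zDeriv, tauSymbol, MvPolynomial.mkDerivation_X]
  simp only [h1, map_sum, Derivation.map_smul, Derivation.leibniz, zDeriv_zSymbol, smul_zero,
    zero_sub, smul_add, Finset.sum_add_distrib, smul_eq_mul, mul_ite, mul_one, mul_zero,
    ite_and, smul_ite, Finset.sum_ite_eq', Finset.mem_univ, if_true]
  congr 2
  · simp only [hs]
  · rw [Finset.sum_comm]
    simp

/-! ### The commutation relation for the powers of the heat operator -/

/-- A representation of the algebra of differential operators in `(τ, z)` with polynomial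
coefficients: an action `ρ` of the symbols, and commuting elements `t k l` and `z a k` (the
multiplications by the coordinates `τ_{kl}` and `z_{ak}`) with the canonical commutation
relations. -/
structure WeylRep (n j : ℕ) (R : Type*) [Ring R] [Algebra ℂ R] where
  /-- the operators with constant coefficients -/
  ρ : HeatSymbol n j →ₐ[ℂ] R
  /-- multiplication by the coordinates of `τ` -/
  t : Fin n → Fin n → R
  /-- multiplication by the coordinates of `z` -/
  z : Fin j → Fin n → R
  t_symm : ∀ k l, t k l = t l k
  t_mul_t : ∀ k l k' l', t k l * t k' l' = t k' l' * t k l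
  z_mul_z : ∀ a l a' l', z a l * z a' l' = z a' l' * z a l
  t_mul_z : ∀ k l a l', t k l * z a l' = z a l' * t k l
  ρ_mul_t : ∀ p k l, ρ p * t k l = t k l * ρ p + ρ (tauDeriv k l p)
  ρ_mul_z : ∀ p a l, ρ p * z a l = z a l * ρ p + ρ (zDeriv a l p)

/-- The derivation of the symbols given by the commutator with the `(a, k)` entry of
`(∂/∂z) τ + 4 π i N z`. -/
noncomputable def mixedDeriv {n j : ℕ} (N : Matrix (Fin j) (Fin j) ℂ) (a : Fin j) (k : Fin n) :
    Derivation ℂ (HeatSymbol n j) (HeatSymbol n j) :=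
  ∑ s, zSymbol n j a s • tauDeriv s k + ∑ b, (4 * Real.pi * Complex.I * N a b) • zDeriv b k

theorem Derivation.finset_sum_apply {R A ι : Type*} [CommRing R] [CommRing A] [Algebra R A]
    (s : Finset ι) (D : ι → Derivation R A A) (x : A) : (∑ i ∈ s, D i) x = ∑ i ∈ s, D i x := by
  classical
  induction s using Finset.induction_on with
  | empty => simp
  | insert a s ha ih => rw [Finset.sum_insert ha, Finset.sum_insert ha, Derivation.add_apply, ih]

/-- The entries of the heat matrix commute with `(∂/∂z) τ + 4 π i N z`: the commutators of the two
terms of the heat matrix cancel because of `N * adjugate N = det N`. -/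
theorem mixedDeriv_heatSymbol {n j : ℕ} {N : Matrix (Fin j) (Fin j) ℂ} (hN : N.IsSymm)
    (a : Fin j) (k r s : Fin n) :
    mixedDeriv N a k (heatSymbol N r s : HeatSymbol n j) = 0 := by
  simp only [mixedDeriv, Derivation.add_apply, Derivation.finset_sum_apply, Derivation.smul_apply,
    tauDeriv_heatSymbol, zDeriv_heatSymbol hN, smul_neg, Finset.sum_neg_distrib]
  rw [← sub_eq_add_neg, sub_eq_zero]
  simp only [Finset.smul_sum, smul_smul]
  rw [Finset.sum_comm]
  simp only [mul_assoc, ← Finset.sum_smul, ← Finset.mul_sum]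
  have hM : ∀ e, ∑ b, N a b * N.adjugate b e = if a = e then N.det else 0 := by
    intro e
    rw [← Matrix.mul_apply, mul_adjugate, Matrix.smul_apply, one_apply]
    simp
  simp only [hM, symCoord_mk]
  simp only [mul_ite, mul_zero, ite_smul, zero_smul, Finset.sum_ite_eq, Finset.mem_univ, if_true,
    mul_one, smul_eq_mul, mul_add, map_add, Finset.sum_add_distrib]
  simp only [MvPolynomial.smul_eq_C_mul, MvPolynomial.algebraMap_eq, map_mul]
  by_cases h1 : s = k <;> by_cases h2 : r = k <;> simp [h1, h2, apply_ite MvPolynomial.C] <;> ring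

namespace WeylRep

variable {n j : ℕ} {R : Type*} [Ring R] [Algebra ℂ R] (w : WeylRep n j R)

theorem ρ_mul_ρ (p q : HeatSymbol n j) : w.ρ p * w.ρ q = w.ρ q * w.ρ p := by
  rw [← map_mul, mul_comm, map_mul]

/-- The entries of `(∂/∂z) τ + 4 π i N z`; these commute with the heat operators. -/
noncomputable def mixed (N : Matrix (Fin j) (Fin j) ℂ) (a : Fin j) (k : Fin n) : R :=
  ∑ s, w.t s k * w.ρ (zSymbol n j a s) + ∑ b, (4 * Real.pi * Complex.I * N a b) • w.z b k

theorem ρ_mul_mixed (N : Matrix (Fin j) (Fin j) ℂ) (a : Fin j) (k : Fin n)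
    (p : HeatSymbol n j) :
    w.ρ p * w.mixed N a k = w.mixed N a k * w.ρ p + w.ρ (mixedDeriv N a k p) := by
  simp only [mixed, mixedDeriv, Derivation.add_apply, Derivation.finset_sum_apply,
    Derivation.smul_apply, mul_add, add_mul, Finset.mul_sum, Finset.sum_mul, map_add, map_sum,
    map_smul, smul_eq_mul, map_mul, mul_smul_comm, smul_mul_assoc, w.ρ_mul_z, smul_add,
    Finset.sum_add_distrib, ← mul_assoc, w.ρ_mul_t]
  simp only [mul_assoc, w.ρ_mul_ρ p]
  have : ∀ s, w.ρ (tauDeriv s k p) * w.ρ (zSymbol n j a s)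
    = w.ρ (zSymbol n j a s) * w.ρ (tauDeriv s k p) := fun s => w.ρ_mul_ρ _ _
  simp only [this]
  abel

theorem ρ_det_pow_mul_mixed {N : Matrix (Fin j) (Fin j) ℂ} (hN : N.IsSymm) (r : ℕ) (a : Fin j)
    (k : Fin n) :
    w.ρ ((heatSymbol N).det ^ r) * w.mixed N a k
      = w.mixed N a k * w.ρ ((heatSymbol N).det ^ r) := by
  rw [ρ_mul_mixed, Derivation.leibniz_pow, Derivation.map_det]
  simp [mixedDeriv_heatSymbol hN]

theorem tauDeriv_det_pow {N : Matrix (Fin j) (Fin j) ℂ} (hN : N.IsSymm) (r : ℕ) (k l : Fin n) :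
    tauDeriv k l ((heatSymbol N).det ^ r : HeatSymbol n j)
      = (2 * r * (4 * Real.pi * Complex.I * N.det)) •
        ((heatSymbol N).det ^ (r - 1) * (heatSymbol N).adjugate k l) := by
  have hs : (heatSymbol N : Matrix (Fin n) (Fin n) (HeatSymbol n j)).adjugate l k
      = (heatSymbol N).adjugate k l := by
    conv_lhs => rw [← heatSymbol_transpose hN, ← adjugate_transpose, transpose_apply]
  rw [Derivation.leibniz_pow, Derivation.map_det]
  simp only [tauDeriv_heatSymbol, symCoord_mk, mul_add, map_add, Finset.sum_add_distrib, mul_ite,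
    mul_one, mul_zero, apply_ite (algebraMap ℂ (HeatSymbol n j)), map_zero]
  simp [hs, MvPolynomial.smul_eq_C_mul]
  rw [show (MvPolynomial.C 2 : HeatSymbol n j) = 2 from map_ofNat _ 2]
  ring

/-- The coefficient of `S b c` in the operator `Tr (τ S τ H)`, where `H` is the heat matrix and the
coordinates stand to the left of the derivatives. -/
noncomputable def quad (N : Matrix (Fin j) (Fin j) ℂ) (b c : Fin n) : R :=
  ∑ a, ∑ d, w.t a b * w.t c d * w.ρ (heatSymbol N d a)

theorem ρ_det_pow_mul_t {N : Matrix (Fin j) (Fin j) ℂ} (hN : N.IsSymm) (r : ℕ) (k l : Fin n) :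
    w.ρ ((heatSymbol N).det ^ r) * w.t k l = w.t k l * w.ρ ((heatSymbol N).det ^ r)
      + (2 * r * (4 * Real.pi * Complex.I * N.det)) •
        w.ρ ((heatSymbol N).det ^ (r - 1) * (heatSymbol N).adjugate k l) := by
  rw [ρ_mul_t, tauDeriv_det_pow hN, map_smul]

/-- Moving a power of the determinant past a quadratic expression in `τ`. The second order
commutator collapses to one multiple of the adjugate because `H` times its adjugate is `det H`; the
number `n + 1` counts the reorderings of coordinates and derivatives. -/
theorem ρ_det_pow_mul_quad {N : Matrix (Fin j) (Fin j) ℂ} (hN : N.IsSymm) (r : ℕ) (b c : Fin n) :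
    w.ρ ((heatSymbol N).det ^ r) * w.quad N b c = w.quad N b c * w.ρ ((heatSymbol N).det ^ r)
      + (4 * r * (4 * Real.pi * Complex.I * N.det)) • (w.t b c * w.ρ ((heatSymbol N).det ^ r))
      + (2 * r * (4 * Real.pi * Complex.I * N.det) ^ 2 * (2 * r - (n + 1))) •
        w.ρ ((heatSymbol N).det ^ (r - 1) * (heatSymbol N).adjugate b c) := by
  set c₀ : ℂ := 4 * Real.pi * Complex.I * N.det with hc₀
  set Δ := w.ρ ((heatSymbol N).det ^ r) with hΔ
  set G : Fin n → Fin n → R := fun k l =>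
    w.ρ ((heatSymbol N).det ^ (r - 1) * (heatSymbol N).adjugate k l) with hG
  set g : ℂ := 2 * r * c₀ with hg
  have hGs : ∀ k l, G k l = G l k := by
    intro k l
    simp only [hG]
    rw [← transpose_apply (adjugate _), adjugate_transpose, heatSymbol_transpose hN]
  have h1 : ∀ k l, Δ * w.t k l = w.t k l * Δ + g • G k l := w.ρ_det_pow_mul_t hN r
  -- at `r = 0` the truncated exponent `r - 1` is harmless, because of the factor `r`
  have hr : (r : ℂ) • w.ρ ((heatSymbol N).det ^ (r - 1) * (heatSymbol N).det) = (r : ℂ) • Δ := by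
    rcases r with _ | r
    · simp
    · rw [hΔ, pow_succ]
      simp
  have hgg : ∀ x : R, g • x = (2 * c₀) • (r : ℂ) • x := fun x => by
    rw [smul_smul]; congr 1; rw [hg]; ring
  have h2 : ∀ a, ∑ d, g • (G c d * w.ρ (heatSymbol N d a)) = if c = a then g • Δ else 0 := by
    intro a
    have : ∑ d, G c d * w.ρ (heatSymbol N d a)
        = if c = a then w.ρ ((heatSymbol N).det ^ (r - 1) * (heatSymbol N).det) else 0 := by
      simp only [hG, ← map_mul, ← map_sum, mul_assoc, ← Finset.mul_sum]
      rw [← Matrix.mul_apply, adjugate_mul, Matrix.smul_apply, one_apply]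
      by_cases h : c = a <;> simp [h]
    rw [← Finset.smul_sum, this]
    by_cases h : c = a
    · simp only [h, if_true]
      rw [hgg, hr, ← hgg]
    · simp [h]
  have h2' : ∀ d, ∑ a, g • (w.ρ (heatSymbol N d a) * G a b) = if d = b then g • Δ else 0 := by
    intro d
    have : ∑ a, w.ρ (heatSymbol N d a) * G a b
        = if d = b then w.ρ ((heatSymbol N).det ^ (r - 1) * (heatSymbol N).det) else 0 := by
      simp only [hG, ← map_mul, ← map_sum, mul_left_comm _ (det _ ^ _), ← Finset.mul_sum]
      rw [← Matrix.mul_apply, mul_adjugate, Matrix.smul_apply, one_apply]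
      by_cases h : d = b <;> simp [h]
    rw [← Finset.smul_sum, this]
    by_cases h : d = b
    · simp only [h, if_true]
      rw [hgg, hr, ← hgg]
    · simp [h]
  have h3 : ∀ d a, w.t c d * w.ρ (heatSymbol N d a) = w.ρ (heatSymbol N d a) * w.t c d
      - (c₀ * ((if d = c then 1 else 0) * (if a = d then 1 else 0) + (if a = c then 1 else 0)))
        • (1 : R) := by
    intro d a
    rw [ρ_mul_t, tauDeriv_heatSymbol, symCoord_mk, AlgHom.commutes, Algebra.algebraMap_eq_smul_one]
    simp [hc₀]
  -- move `Δ` to the right past both coordinates, then `τ_{cd}` past the entry of `H`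
  have hterm : ∀ a d, Δ * (w.t a b * w.t c d * w.ρ (heatSymbol N d a))
      = w.t a b * w.t c d * w.ρ (heatSymbol N d a) * Δ
        + w.t a b * (g • (G c d * w.ρ (heatSymbol N d a)))
        + g • (w.ρ (heatSymbol N d a) * G a b) * w.t c d
        - (g * (c₀ * ((if d = c then 1 else 0) * (if a = d then 1 else 0)
            + (if a = c then 1 else 0)))) • G a b := by
    intro a d
    have e1 : w.ρ (heatSymbol N d a) * Δ = Δ * w.ρ (heatSymbol N d a) := w.ρ_mul_ρ _ _
    have e2 : w.ρ (heatSymbol N d a) * G a b = G a b * w.ρ (heatSymbol N d a) := w.ρ_mul_ρ _ _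
    calc Δ * (w.t a b * w.t c d * w.ρ (heatSymbol N d a))
        = w.t a b * (Δ * w.t c d) * w.ρ (heatSymbol N d a)
          + g • (G a b * (w.t c d * w.ρ (heatSymbol N d a))) := by
          rw [← mul_assoc, ← mul_assoc, h1, add_mul, add_mul]
          simp only [mul_assoc, smul_mul_assoc]
      _ = _ := by
          rw [h1, h3]
          simp only [mul_add, add_mul, mul_sub, mul_assoc, e1, smul_mul_assoc, e2, smul_sub,
            mul_smul_comm, mul_one, smul_smul]
          abel
  have hsum : ∑ a, ∑ d, (g * (c₀ * ((if d = c then 1 else 0) * (if a = d then 1 else 0)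
            + (if a = c then 1 else 0)))) • G a b = (g * c₀ * (n + 1)) • G b c := by
    simp only [← Finset.sum_smul, ← Finset.mul_sum, Finset.sum_add_distrib]
    simp only [mul_ite, mul_one, mul_zero, Finset.sum_ite_eq, Finset.mem_univ,
      if_true, Finset.sum_const, Finset.card_univ, Fintype.card_fin]
    rw [Finset.sum_congr rfl (g := fun a => if a = c then (g * c₀ * (n + 1)) • G b c else 0)]
    · simp
    · intro a _
      by_cases h : a = c
      · subst h
        simp only [if_true, hGs b]
        congr 1
        simp
        ring
      · simp [h]
  simp only [quad, Finset.mul_sum, hterm, Finset.sum_sub_distrib, Finset.sum_add_distrib, hsum,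
    ← Finset.sum_mul]
  simp only [← Finset.mul_sum, h2]
  rw [Finset.sum_comm (f := fun a d => g • (w.ρ (heatSymbol N d a) * G a b) * w.t c d)]
  simp only [← Finset.sum_mul, h2']
  simp only [mul_ite, ite_mul, mul_zero, zero_mul, Finset.sum_ite_eq, Finset.sum_ite_eq',
    Finset.mem_univ, if_true, smul_mul_assoc, mul_smul_comm, h1, w.t_symm c b, hGs c b]
  module

end WeylRep

namespace WeylRep

variable {n j : ℕ} {R : Type*} [Ring R] [Algebra ℂ R] (w : WeylRep n j R)

/-- The infinitesimal action, in weight `κ / 2` and index `N`, of the one-parameter group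
`τ ↦ τ (1 - s S τ)⁻¹`. -/
noncomputable def infAct (N : Matrix (Fin j) (Fin j) ℂ) (S : Matrix (Fin n) (Fin n) ℂ) (κ : ℂ) :
    R :=
  ∑ b, ∑ c, S b c • ((2⁻¹ : ℂ) • (∑ a, ∑ d, w.t a b * w.t c d * w.ρ (tauSymbol n j d a))
    + ∑ a, ∑ s, w.z a b * w.t c s * w.ρ (zSymbol n j a s)
    + (κ / 2) • w.t b c
    + (2 * Real.pi * Complex.I) • ∑ e, ∑ f, N e f • (w.z e b * w.z f c))

/-- The quadratic form with matrix `adjugate N` in the operators `mixed`. It supplies, up to the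
second order terms that complete `∂/∂τ` to the heat matrix, the terms of the infinitesimal action
that involve `z`. -/
theorem sum_adjugate_mixed {N : Matrix (Fin j) (Fin j) ℂ} (hN : N.IsSymm) (b c : Fin n) :
    ∑ e, ∑ f, N.adjugate e f • (w.mixed N e b * w.mixed N f c)
      = ∑ a, ∑ d, w.t a b * w.t c d *
          (∑ e, ∑ f, N.adjugate e f • (w.ρ (zSymbol n j e d) * w.ρ (zSymbol n j f a)))
        + (4 * Real.pi * Complex.I * N.det) • (∑ a, ∑ s, w.z a b * w.t c s * w.ρ (zSymbol n j a s)
            + ∑ a, ∑ s, w.z a c * w.t b s * w.ρ (zSymbol n j a s) + (j : ℂ) • w.t b c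
            + (4 * Real.pi * Complex.I) • ∑ e, ∑ f, N e f • (w.z e b * w.z f c)) := by
  have hA : ∀ e f, N.adjugate e f = N.adjugate f e := fun e f => by
    conv_lhs => rw [← hN.eq, ← adjugate_transpose, transpose_apply]
  set β : ℂ := 4 * Real.pi * Complex.I with hβ
  set T : Fin j → Fin n → R := fun a k => ∑ s, w.t s k * w.ρ (zSymbol n j a s) with hT
  set W : Fin j → Fin n → R := fun a k => ∑ b, N a b • w.z b k with hW
  have hm : ∀ a k, w.mixed N a k = T a k + β • W a k := by
    intro a k
    simp only [mixed, hT, hW, Finset.smul_sum, smul_smul, hβ]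
  -- multiplication by the adjugate turns `N z` into `|N| z`
  have hAW : ∀ f k, ∑ e, N.adjugate f e • W e k = N.det • w.z f k := by
    intro f k
    simp only [hW, Finset.smul_sum, smul_smul]
    rw [Finset.sum_comm]
    simp only [← Finset.sum_smul, ← Matrix.mul_apply, adjugate_mul, Matrix.smul_apply, one_apply,
      smul_eq_mul, mul_ite, mul_one, mul_zero, ite_smul, zero_smul, Finset.sum_ite_eq,
      Finset.mem_univ, if_true]
  have hTT : ∑ e, ∑ f, N.adjugate e f • (T e b * T f c) = ∑ a, ∑ d, w.t a b * w.t c d *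
          (∑ e, ∑ f, N.adjugate e f • (w.ρ (zSymbol n j e d) * w.ρ (zSymbol n j f a))) := by
    have : ∀ e f, T e b * T f c = ∑ a, ∑ d, w.t a b * w.t c d *
        (w.ρ (zSymbol n j f d) * w.ρ (zSymbol n j e a)) := by
      intro e f
      simp only [hT, Finset.sum_mul, Finset.mul_sum]
      rw [Finset.sum_comm]
      refine Finset.sum_congr rfl fun a _ => Finset.sum_congr rfl fun d _ => ?_
      have : w.ρ (zSymbol n j e a) * w.t d c = w.t d c * w.ρ (zSymbol n j e a) := by
        rw [ρ_mul_t, tauDeriv_zSymbol, map_zero, add_zero]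
      rw [mul_assoc, ← mul_assoc (w.ρ _), this, w.t_symm d c, w.ρ_mul_ρ (zSymbol n j f d)]
      simp only [mul_assoc]
    simp only [this, Finset.smul_sum, Finset.mul_sum]
    rw [Finset.sum_congr rfl fun e _ => Finset.sum_comm, Finset.sum_comm]
    refine Finset.sum_congr rfl fun a _ => ?_
    rw [Finset.sum_congr rfl fun e _ => Finset.sum_comm, Finset.sum_comm]
    refine Finset.sum_congr rfl fun d _ => ?_
    rw [Finset.sum_comm]
    refine Finset.sum_congr rfl fun e _ => Finset.sum_congr rfl fun f _ => ?_
    rw [hA, mul_smul_comm]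
  have hTW : ∑ e, ∑ f, N.adjugate e f • (T e b * W f c)
      = N.det • (∑ a, ∑ s, w.z a c * w.t b s * w.ρ (zSymbol n j a s) + (j : ℂ) • w.t b c) := by
    have h1 : ∀ e, T e b * w.z e c = ∑ s, w.z e c * w.t b s * w.ρ (zSymbol n j e s) + w.t b c := by
      intro e
      have : ∀ s, w.t s b * w.ρ (zSymbol n j e s) * w.z e c
          = w.z e c * w.t b s * w.ρ (zSymbol n j e s) + if s = c then w.t b c else 0 := by
        intro s
        rw [mul_assoc, ρ_mul_z, zDeriv_zSymbol, mul_add, ← mul_assoc, w.t_mul_z, w.t_symm s b]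
        by_cases h : s = c <;> simp [h]
      simp only [hT, Finset.sum_mul, this, Finset.sum_add_distrib, Finset.sum_ite_eq',
        Finset.mem_univ, if_true]
    simp only [← mul_smul_comm, ← Finset.mul_sum, hAW]
    simp only [mul_smul_comm, ← Finset.smul_sum, h1, Finset.sum_add_distrib, Finset.sum_const,
      Finset.card_univ, Fintype.card_fin, Nat.cast_smul_eq_nsmul]
  have hWT : ∑ e, ∑ f, N.adjugate e f • (W e b * T f c)
      = N.det • ∑ a, ∑ s, w.z a b * w.t c s * w.ρ (zSymbol n j a s) := by
    rw [Finset.sum_comm]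
    simp only [hA _ _, ← smul_mul_assoc, ← Finset.sum_mul]
    rw [Finset.sum_congr rfl fun f _ => by rw [hAW]]
    simp only [smul_mul_assoc, ← Finset.smul_sum, hT, Finset.mul_sum, mul_assoc, w.t_symm _ c]
  have hWW : ∑ e, ∑ f, N.adjugate e f • (W e b * W f c)
      = N.det • ∑ e, ∑ f, N e f • (w.z e b * w.z f c) := by
    simp only [← mul_smul_comm, ← Finset.mul_sum, hAW]
    simp only [mul_smul_comm, ← Finset.smul_sum, hW, Finset.sum_mul, smul_mul_assoc]
    simp only [mul_smul_comm, Finset.mul_sum]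
    congr 1
    rw [Finset.sum_comm]
    refine Finset.sum_congr rfl fun e _ => Finset.sum_congr rfl fun f _ => ?_
    rw [← hN.eq, transpose_apply, hN.eq]
  have hterm : ∀ e f, N.adjugate e f • (w.mixed N e b * w.mixed N f c)
      = N.adjugate e f • (T e b * T f c) + β • (N.adjugate e f • (T e b * W f c))
        + β • (N.adjugate e f • (W e b * T f c)) + β ^ 2 • (N.adjugate e f • (W e b * W f c)) := by
    intro e f
    simp only [hm, add_mul, mul_add, smul_mul_assoc, mul_smul_comm]
    module
  simp only [hterm, Finset.sum_add_distrib, ← Finset.smul_sum, hTT, hTW, hWT, hWW]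
  module

/-- The powers of the determinant of the heat matrix intertwine the infinitesimal actions in weights
`(n + j + 1) / 2 - r` and `(n + j + 1) / 2 + r`. Up to a scalar, the infinitesimal action is a sum
of `quad`, of a quadratic form in `mixed` that commutes with the heat operators, and of a multiple of
`Tr (S τ)`. For these weights the adjugates in the commutators with the first and the last
summand cancel. -/
theorem ρ_det_pow_mul_infAct {N : Matrix (Fin j) (Fin j) ℂ} (hN : N.IsSymm) (hd : N.det ≠ 0)
    {S : Matrix (Fin n) (Fin n) ℂ} (hS : S.IsSymm) (r : ℕ) :
    w.ρ ((heatSymbol N).det ^ r) * w.infAct N S (n + j + 1 - 2 * r)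
      = w.infAct N S (n + j + 1 + 2 * r) * w.ρ ((heatSymbol N).det ^ r) := by
  set c₀ : ℂ := 4 * Real.pi * Complex.I * N.det with hc₀
  have hc : c₀ ≠ 0 := by simp [hc₀, hd]
  have hS' : ∀ b c, S b c = S c b := fun b c => by
    conv_lhs => rw [← hS.eq, transpose_apply]
  have hquad : ∀ b c, w.quad N b c = c₀ • (∑ a, ∑ d, w.t a b * w.t c d * w.ρ (tauSymbol n j d a))
      - ∑ a, ∑ d, w.t a b * w.t c d *
          (∑ e, ∑ f, N.adjugate e f • (w.ρ (zSymbol n j e d) * w.ρ (zSymbol n j f a))) := by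
    intro b c
    simp only [quad, heatSymbol_apply, map_sub, map_smul, map_sum, map_mul, mul_sub,
      Finset.sum_sub_distrib, mul_smul_comm, ← Finset.smul_sum, ← hc₀]
  -- completing the square in the variables `z`
  have key : ∀ κ : ℂ, c₀ • w.infAct N S κ = ∑ b, ∑ c, S b c • ((2⁻¹ : ℂ) • w.quad N b c
      + (2⁻¹ : ℂ) • ∑ e, ∑ f, N.adjugate e f • (w.mixed N e b * w.mixed N f c)
      + (c₀ * (κ - j) / 2) • w.t b c) := by
    intro κ
    have hswap : ∑ b, ∑ c, S b c • ∑ a, ∑ s, w.z a c * w.t b s * w.ρ (zSymbol n j a s)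
        = ∑ b, ∑ c, S b c • ∑ a, ∑ s, w.z a b * w.t c s * w.ρ (zSymbol n j a s) := by
      rw [Finset.sum_comm]
      refine Finset.sum_congr rfl fun b _ => Finset.sum_congr rfl fun c _ => ?_
      rw [hS']
    have e : ∀ b c, S b c • ((2⁻¹ : ℂ) • w.quad N b c
        + (2⁻¹ : ℂ) • ∑ e, ∑ f, N.adjugate e f • (w.mixed N e b * w.mixed N f c)
        + (c₀ * (κ - j) / 2) • w.t b c)
      = c₀ • (S b c • ((2⁻¹ : ℂ) • (∑ a, ∑ d, w.t a b * w.t c d * w.ρ (tauSymbol n j d a))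
          + ∑ a, ∑ s, w.z a b * w.t c s * w.ρ (zSymbol n j a s)
          + (κ / 2) • w.t b c
          + (2 * Real.pi * Complex.I) • ∑ e, ∑ f, N e f • (w.z e b * w.z f c)))
        + (c₀ / 2) • (S b c • ∑ a, ∑ s, w.z a c * w.t b s * w.ρ (zSymbol n j a s))
        - (c₀ / 2) • (S b c • ∑ a, ∑ s, w.z a b * w.t c s * w.ρ (zSymbol n j a s)) := by
      intro b c
      rw [hquad, w.sum_adjugate_mixed hN]
      module
    simp only [e, Finset.sum_add_distrib, Finset.sum_sub_distrib, ← Finset.smul_sum, hswap]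
    simp only [infAct]
    abel
  have hmix : ∀ b c, w.ρ ((heatSymbol N).det ^ r) *
      ∑ e, ∑ f, N.adjugate e f • (w.mixed N e b * w.mixed N f c)
      = (∑ e, ∑ f, N.adjugate e f • (w.mixed N e b * w.mixed N f c))
        * w.ρ ((heatSymbol N).det ^ r) := by
    intro b c
    simp only [Finset.mul_sum, Finset.sum_mul, mul_smul_comm, smul_mul_assoc]
    refine Finset.sum_congr rfl fun e _ => Finset.sum_congr rfl fun f _ => ?_
    rw [← mul_assoc, w.ρ_det_pow_mul_mixed hN, mul_assoc, w.ρ_det_pow_mul_mixed hN, mul_assoc]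
  refine smul_right_injective R hc ?_
  simp only
  rw [← mul_smul_comm, ← smul_mul_assoc, key, key]
  simp only [Finset.mul_sum, Finset.sum_mul]
  refine Finset.sum_congr rfl fun b _ => Finset.sum_congr rfl fun c _ => ?_
  rw [mul_smul_comm, smul_mul_assoc]
  congr 1
  simp only [mul_add, add_mul, mul_smul_comm, smul_mul_assoc, w.ρ_det_pow_mul_quad hN, hmix,
    w.ρ_det_pow_mul_t hN, ← hc₀]
  module

end WeylRep

/-! ### Differential operators on spaces of analytic functions -/

section Holo

open TopologicalSpace

variable {E : Type*} [NormedAddCommGroup E] [NormedSpace ℂ E]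

/-- The space of analytic functions on an open set `U`, encoded as functions on the whole space
that are analytic on `U` and vanish outside of `U`. -/
def holo (U : Opens E) : Submodule ℂ (E → ℂ) where
  carrier := {f | AnalyticOnNhd ℂ f U ∧ ∀ x ∉ U, f x = 0}
  zero_mem' := ⟨fun _ _ => analyticAt_const, fun _ _ => rfl⟩
  add_mem' := fun hf hg => ⟨hf.1.add hg.1, fun x hx => by simp [hf.2 x hx, hg.2 x hx]⟩
  smul_mem' := fun c _ hf => ⟨fun x hx => analyticAt_const.smul (hf.1 x hx),
    fun x hx => by simp [hf.2 x hx]⟩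

namespace holo

variable {U : Opens E}

open Classical in
/-- The element of `holo U` given by a function that is analytic on `U`. -/
noncomputable def mk (f : E → ℂ) (hf : AnalyticOnNhd ℂ f U) : holo U :=
  ⟨fun x => if x ∈ U then f x else 0, fun x hx => by
    refine (hf x hx).congr ?_
    filter_upwards [U.isOpen.mem_nhds hx] with y hy
    exact (if_pos hy).symm, fun x hx => if_neg hx⟩

theorem mk_apply {f : E → ℂ} (hf : AnalyticOnNhd ℂ f U) {x : E} (hx : x ∈ U) :
    (mk f hf).1 x = f x := if_pos hx

theorem analyticAt (f : holo U) {x : E} (hx : x ∈ U) : AnalyticAt ℂ f.1 x := f.2.1 x hx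

theorem ext' {f g : holo U} (h : ∀ x ∈ U, f.1 x = g.1 x) : f = g := by
  refine Subtype.ext (funext fun x => ?_)
  by_cases hx : x ∈ U
  · exact h x hx
  · rw [f.2.2 x hx, g.2.2 x hx]

/-- The derivative of an element of `holo U` in the direction `v`. -/
noncomputable def deriv (f : holo U) (v : E) : holo U :=
  mk (fun x => fderiv ℂ f.1 x v) fun x hx =>
    ((ContinuousLinearMap.apply ℂ ℂ v).analyticAt _).comp (analyticAt f (x := x) hx).fderiv

theorem deriv_apply (f : holo U) (v : E) {x : E} (hx : x ∈ U) :
    (deriv f v).1 x = fderiv ℂ f.1 x v := mk_apply _ hx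

/-- The derivative in the direction `v`, as an operator on `holo U`. -/
noncomputable def dirDeriv (U : Opens E) : E →ₗ[ℂ] Module.End ℂ (holo U) :=
  LinearMap.mk₂ ℂ (fun v f => deriv f v)
    (fun v w f => ext' fun x hx => by
      rw [Submodule.coe_add, Pi.add_apply]
      simp only [deriv_apply _ _ hx, map_add])
    (fun c v f => ext' fun x hx => by
      rw [Submodule.coe_smul, Pi.smul_apply]
      simp only [deriv_apply _ _ hx, map_smul])
    (fun v f g => ext' fun x hx => by
      have : fderiv ℂ (f + g).1 x = fderiv ℂ f.1 x + fderiv ℂ g.1 x :=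
        fderiv_add (analyticAt f hx).differentiableAt (analyticAt g hx).differentiableAt
      rw [Submodule.coe_add, Pi.add_apply]
      simp only [deriv_apply _ _ hx]
      rw [this, _root_.add_apply])
    (fun c v f => ext' fun x hx => by
      have : fderiv ℂ (c • f).1 x = c • fderiv ℂ f.1 x :=
        fderiv_const_smul (analyticAt f hx).differentiableAt c
      rw [Submodule.coe_smul, Pi.smul_apply]
      simp only [deriv_apply _ _ hx]
      rw [this, _root_.smul_apply])

theorem dirDeriv_apply (v : E) (f : holo U) {x : E} (hx : x ∈ U) :
    (dirDeriv U v f).1 x = fderiv ℂ f.1 x v := deriv_apply f v hx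

theorem dirDeriv_mul_comm (v w : E) :
    dirDeriv U v * dirDeriv U w = dirDeriv U w * dirDeriv U v := by
  refine LinearMap.ext fun f => ext' fun x hx => ?_
  have key : ∀ v w, (dirDeriv U v (dirDeriv U w f)).1 x = fderiv ℂ (fderiv ℂ f.1) x v w := by
    intro v w
    have he : (dirDeriv U w f).1 =ᶠ[𝓝 x] fun y => fderiv ℂ f.1 y w := by
      filter_upwards [U.isOpen.mem_nhds hx] with y hy
      exact dirDeriv_apply w f hy
    rw [dirDeriv_apply v _ hx, he.fderiv_eq,
      fderiv_clm_apply (analyticAt f hx).fderiv.differentiableAt (differentiableAt_const w)]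
    simp
  rw [Module.End.mul_apply, Module.End.mul_apply, key, key]
  exact (analyticAt f hx).contDiffAt.isSymmSndFDerivAt (n := ⊤) le_top v w

/-- The multiplication by a linear form, as an operator on `holo U`. -/
noncomputable def mulLin (U : Opens E) (l : E →L[ℂ] ℂ) : Module.End ℂ (holo U) where
  toFun f := ⟨fun x => l x * f.1 x, fun x hx => (l.analyticAt x).mul (analyticAt f hx),
    fun x hx => by simp only [f.2.2 x hx, mul_zero]⟩
  map_add' f g := Subtype.ext (funext fun x => mul_add _ _ _)
  map_smul' c f := Subtype.ext (funext fun x => by simp; ring)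

theorem mulLin_apply (l : E →L[ℂ] ℂ) (f : holo U) (x : E) :
    (mulLin U l f).1 x = l x * f.1 x := rfl

theorem mulLin_mul_comm (l m : E →L[ℂ] ℂ) :
    mulLin U l * mulLin U m = mulLin U m * mulLin U l :=
  LinearMap.ext fun f => ext' fun x _ => by
    simp only [Module.End.mul_apply, mulLin_apply]
    ring

theorem dirDeriv_mul_mulLin (l : E →L[ℂ] ℂ) (v : E) :
    dirDeriv U v * mulLin U l = mulLin U l * dirDeriv U v + algebraMap ℂ _ (l v) :=
  LinearMap.ext fun f => ext' fun x hx => by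
    rw [LinearMap.add_apply, Submodule.coe_add, Pi.add_apply]
    simp only [Module.End.mul_apply, mulLin_apply, dirDeriv_apply _ _ hx,
      Module.algebraMap_end_apply, Submodule.coe_smul, Pi.smul_apply, smul_eq_mul]
    have : fderiv ℂ (mulLin U l f).1 x = l x • fderiv ℂ f.1 x + f.1 x • fderiv ℂ l x :=
      fderiv_fun_mul l.differentiableAt (analyticAt f hx).differentiableAt
    rw [this]
    simp
    ring

theorem coe_sum {ι : Type*} (s : Finset ι) (g : ι → holo U) (y : E) :
    (∑ i ∈ s, g i : holo U).1 y = ∑ i ∈ s, (g i).1 y := by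
  rw [AddSubmonoidClass.coe_finsetSum, Finset.sum_apply]

end holo

end Holo

section AevalComm

variable {σ A : Type*} [Ring A] [Algebra ℂ A]

open scoped IsMulCommutative in
/-- The evaluation of polynomials at commuting elements of a ring that need not be commutative. -/
noncomputable def aevalComm (x : σ → A) (h : ∀ i k, x i * x k = x k * x i) :
    MvPolynomial σ ℂ →ₐ[ℂ] A :=
  have : IsMulCommutative (Algebra.adjoin ℂ (Set.range x)) :=
    Algebra.isMulCommutative_adjoin ℂ (by rintro _ ⟨i, rfl⟩ _ ⟨k, rfl⟩; exact h i k)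
  (Algebra.adjoin ℂ (Set.range x)).val.comp
    (MvPolynomial.aeval fun i => ⟨x i, Algebra.subset_adjoin ⟨i, rfl⟩⟩)

theorem aevalComm_X (x : σ → A) (h : ∀ i k, x i * x k = x k * x i) (i : σ) :
    aevalComm x h (MvPolynomial.X i) = x i := by
  simp [aevalComm]

/-- If the commutators of the variables with `y` are given by a derivation, then so are those of all
polynomials. -/
theorem commutator_eq_of_X (ρ : MvPolynomial σ ℂ →ₐ[ℂ] A)
    (D : Derivation ℂ (MvPolynomial σ ℂ) (MvPolynomial σ ℂ)) (y : A)
    (h : ∀ i, ρ (MvPolynomial.X i) * y = y * ρ (MvPolynomial.X i) + ρ (D (MvPolynomial.X i)))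
    (p : MvPolynomial σ ℂ) : ρ p * y = y * ρ p + ρ (D p) := by
  have hc : ∀ p q, ρ p * ρ q = ρ q * ρ p := fun p q => by rw [← map_mul, mul_comm, map_mul]
  induction p using MvPolynomial.induction_on with
  | C a =>
    rw [← MvPolynomial.algebraMap_eq, AlgHom.commutes, Derivation.map_algebraMap, map_zero,
      add_zero, Algebra.commutes]
  | add p q hp hq => rw [map_add, add_mul, hp, hq, map_add, map_add]; noncomm_ring
  | mul_X p i hp =>
    rw [map_mul, mul_assoc, h, mul_add, ← mul_assoc, hp, Derivation.leibniz, map_add, smul_eq_mul,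
      smul_eq_mul, map_mul, map_mul, hc _ (D p)]
    noncomm_ring

end AevalComm

/-! ### The heat operator as the determinant of its symbol -/

/-- The direction in `(τ, z)`-space belonging to a variable of the algebra of symbols. -/
noncomputable def heatDir {n j : ℕ} : Sym2 (Fin n) ⊕ Fin j × Fin n → JacSpace n j :=
  Sum.elim (fun q => (⟨of (symCoord q), by ext k l; simp [symCoord_comm q k l]⟩, 0))
    fun p => (0, Matrix.single p.1 p.2 1)

/-- The coordinate `τ_{kl}`. -/
noncomputable def tauCoord {n j : ℕ} (k l : Fin n) : JacSpace n j →L[ℂ] ℂ :=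
  LinearMap.toContinuousLinearMap
    { toFun := fun x => x.1.1 k l, map_add' := fun _ _ => rfl, map_smul' := fun _ _ => rfl }

/-- The coordinate `z_{al}`. -/
noncomputable def zCoord {n j : ℕ} (a : Fin j) (l : Fin n) : JacSpace n j →L[ℂ] ℂ :=
  LinearMap.toContinuousLinearMap
    { toFun := fun x => x.2 a l, map_add' := fun _ _ => rfl, map_smul' := fun _ _ => rfl }

@[simp] theorem tauCoord_apply {n j : ℕ} (k l : Fin n) (x : JacSpace n j) :
    tauCoord k l x = x.1.1 k l := rfl

@[simp] theorem zCoord_apply {n j : ℕ} (a : Fin j) (l : Fin n) (x : JacSpace n j) :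
    zCoord a l x = x.2 a l := rfl

section Rep

open TopologicalSpace

variable {n j : ℕ} {E : Type*} [NormedAddCommGroup E] [NormedSpace ℂ E]

/-- The differential operators with constant coefficients in the directions of `(τ, z)`-space,
acting on the analytic functions on an open subset of a space that contains `(τ, z)`-space by
means of `ι`. -/
noncomputable def diffRep (U : Opens E) (ι : JacSpace n j →L[ℂ] E) :
    HeatSymbol n j →ₐ[ℂ] Module.End ℂ (holo U) :=
  aevalComm (fun i => holo.dirDeriv U (ι (heatDir i))) fun _ _ => holo.dirDeriv_mul_comm _ _

theorem diffRep_X (U : Opens E) (ι : JacSpace n j →L[ℂ] E) (i : Sym2 (Fin n) ⊕ Fin j × Fin n) :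
    diffRep U ι (MvPolynomial.X i) = holo.dirDeriv U (ι (heatDir i)) :=
  aevalComm_X _ _ i

/-- The operators with polynomial coefficients in the directions of `(τ, z)`-space, acting on the
analytic functions on an open subset of a space that retracts linearly onto `(τ, z)`-space. -/
noncomputable def holoWeyl (U : Opens E) (ι : JacSpace n j →L[ℂ] E) (π : E →L[ℂ] JacSpace n j)
    (h : ∀ x, π (ι x) = x) : WeylRep n j (Module.End ℂ (holo U)) where
  ρ := diffRep U ι
  t k l := holo.mulLin U ((tauCoord k l).comp π)
  z a l := holo.mulLin U ((zCoord a l).comp π)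
  t_symm k l := LinearMap.ext fun f => holo.ext' fun x _ => by
    have : (π x).1.1 k l = (π x).1.1 l k := congrFun (congrFun (π x).1.2 l) k
    simp only [holo.mulLin_apply, ContinuousLinearMap.comp_apply, tauCoord_apply, this]
  t_mul_t _ _ _ _ := holo.mulLin_mul_comm _ _
  z_mul_z _ _ _ _ := holo.mulLin_mul_comm _ _
  t_mul_z _ _ _ _ := holo.mulLin_mul_comm _ _
  ρ_mul_t p k l := by
    refine commutator_eq_of_X (A := Module.End ℂ (holo U)) (diffRep U ι) (tauDeriv k l) _
      (fun i => ?_) p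
    rw [diffRep_X, holo.dirDeriv_mul_mulLin, ContinuousLinearMap.comp_apply, h, tauDeriv,
      MvPolynomial.mkDerivation_X]
    rcases i with q | q
    · simp [heatDir, ← MvPolynomial.algebraMap_eq]
    · simp [heatDir]
  ρ_mul_z p a l := by
    refine commutator_eq_of_X (A := Module.End ℂ (holo U)) (diffRep U ι) (zDeriv a l) _
      (fun i => ?_) p
    rw [diffRep_X, holo.dirDeriv_mul_mulLin, ContinuousLinearMap.comp_apply, h, zDeriv,
      MvPolynomial.mkDerivation_X]
    rcases i with q | ⟨b, s⟩
    · simp [heatDir]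
    · by_cases hb : b = a ∧ s = l <;> simp [heatDir, hb]

theorem lineDeriv_slice (f : E → ℂ) (ι : JacSpace n j →L[ℂ] E) (p : E) (x v : JacSpace n j) :
    lineDeriv ℂ (fun y => f (p + ι y)) x v = lineDeriv ℂ f (p + ι x) (ι v) := by
  simp only [lineDeriv, map_add, map_smul, add_assoc]

/-- If `h` is the restriction of `f ∈ holo U` to a slice through `p`, then the directional
derivatives of `h` are those of `f`. -/
theorem lineDeriv_eq_dirDeriv {U : Opens E} {ι : JacSpace n j →L[ℂ] E} {p : E}
    {h : JacSpace n j → ℂ} {f : holo U} (hf : ∀ x, p + ι x ∈ U → h x = f.1 (p + ι x))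
    (v : JacSpace n j) (x : JacSpace n j) (hx : p + ι x ∈ U) :
    lineDeriv ℂ h x v = (holo.dirDeriv U (ι v) f).1 (p + ι x) := by
  have hc : Continuous fun x => p + ι x := continuous_const.add ι.continuous
  have he : h =ᶠ[𝓝 x] fun y => f.1 (p + ι y) := by
    filter_upwards [(U.isOpen.preimage hc).mem_nhds hx] with y hy using hf y hy
  rw [he.lineDeriv_eq, lineDeriv_slice, holo.dirDeriv_apply _ _ hx,
    (holo.analyticAt f hx).differentiableAt.lineDeriv_eq_fderiv]

theorem heatEntry_eq_diffRep {U : Opens E} {ι : JacSpace n j →L[ℂ] E} {p : E}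
    (M : Matrix (Fin j) (Fin j) ℝ)
    {h : JacSpace n j → ℂ} {f : holo U} (hf : ∀ x, p + ι x ∈ U → h x = f.1 (p + ι x))
    (r s : Fin n) (x : JacSpace n j) (hx : p + ι x ∈ U) :
    heatEntry M r s h x = (diffRep U ι (heatSymbol (toC M) r s) f).1 (p + ι x) := by
  have hdet : (toC M).det = (M.det : ℂ) := (RingHom.map_det Complex.ofRealHom M).symm
  have hadj : ∀ a b, (toC M).adjugate a b = ((M.adjugate a b : ℝ) : ℂ) := fun a b =>
    congrFun (congrFun (RingHom.map_adjugate Complex.ofRealHom M).symm a) b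
  -- on the diagonal `tauDir` is a single entry, and `heatDir` is twice this entry
  have hdir : heatDir (n := n) (j := j) (Sum.inl s(r, s))
      = (1 + if r = s then 1 else 0 : ℂ) • (tauDir r s, (0 : Matrix (Fin j) (Fin n) ℂ)) := by
    refine Prod.ext (Subtype.ext ?_) (by simp [heatDir])
    ext a b
    simp only [heatDir, Sum.elim_inl, of_apply, symCoord_mk, Prod.smul_mk, Submodule.coe_smul,
      tauDir, Matrix.smul_apply, smul_eq_mul]
    by_cases h1 : r = a <;> by_cases h2 : s = b <;> by_cases h3 : r = b <;>
      by_cases h4 : s = a <;> by_cases h5 : r = s <;> simp_all [eq_comm]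
  have hz : ∀ a b, dZ a r (dZ b s h) x = (diffRep U ι (zSymbol n j a r * zSymbol n j b s) f).1
      (p + ι x) := by
    intro a b
    rw [map_mul, Module.End.mul_apply]
    simp only [zSymbol, of_apply, diffRep_X]
    exact lineDeriv_eq_dirDeriv (fun y hy => lineDeriv_eq_dirDeriv hf _ y hy) _ x hx
  have ht : (1 + if r = s then 1 else 0 : ℂ) * dTau r s h x
      = (diffRep U ι (tauSymbol n j r s) f).1 (p + ι x) := by
    rw [tauSymbol, of_apply, diffRep_X, hdir, map_smul, map_smul, LinearMap.smul_apply,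
      Submodule.coe_smul, Pi.smul_apply, smul_eq_mul]
    congr 1
    exact lineDeriv_eq_dirDeriv hf _ x hx
  rw [heatSymbol_apply, map_sub, map_smul, map_sum, LinearMap.sub_apply, LinearMap.smul_apply,
    LinearMap.sum_apply, Submodule.coe_sub, Pi.sub_apply, Submodule.coe_smul, Pi.smul_apply, ← ht,
    holo.coe_sum, heatEntry, hdet, smul_eq_mul]
  congr 1
  refine Finset.sum_congr rfl fun a _ => ?_
  rw [map_sum, LinearMap.sum_apply, holo.coe_sum]
  refine Finset.sum_congr rfl fun b _ => ?_
  rw [hz, hadj, map_smul, LinearMap.smul_apply, Submodule.coe_smul, Pi.smul_apply, smul_eq_mul]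

theorem heatOp_eq_diffRep {U : Opens E} {ι : JacSpace n j →L[ℂ] E} {p : E}
    (M : Matrix (Fin j) (Fin j) ℝ)
    {h : JacSpace n j → ℂ} {f : holo U} (hf : ∀ x, p + ι x ∈ U → h x = f.1 (p + ι x))
    (x : JacSpace n j) (hx : p + ι x ∈ U) :
    heatOp M h x = (diffRep U ι (heatSymbol (toC M)).det f).1 (p + ι x) := by
  have hfold : ∀ (σ : Equiv.Perm (Fin n)) (l : List (Fin n)) (x : JacSpace n j), p + ι x ∈ U →
      l.foldr (fun i h => heatEntry M (σ i) i h) h x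
        = (diffRep U ι (l.map fun i => heatSymbol (toC M) (σ i) i).prod f).1 (p + ι x) := by
    intro σ l
    induction l with
    | nil => intro x hx; simpa using hf x hx
    | cons i l ih =>
      intro x hx
      rw [List.foldr_cons, List.map_cons, List.prod_cons, map_mul, Module.End.mul_apply]
      exact heatEntry_eq_diffRep M ih _ _ x hx
  rw [heatOp, det_apply, map_sum, LinearMap.sum_apply, AddSubmonoidClass.coe_finsetSum,
    Finset.sum_apply]
  refine Finset.sum_congr rfl fun σ _ => ?_
  rw [hfold σ _ x hx, ← List.ofFn_eq_map, List.prod_ofFn, Units.smul_def, map_zsmul,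
    LinearMap.smul_apply, ← Int.cast_smul_eq_zsmul ℂ, Submodule.coe_smul, Pi.smul_apply,
    smul_eq_mul]

/-- On slices of analytic functions, the powers of the heat operator, defined by iterated line
derivatives, are the operators whose symbols are the powers of `det (heatSymbol M)`. The slices
make it possible to let the functions depend analytically on a parameter. -/
theorem heatOp_iterate_eq_diffRep {U : Opens E} {ι : JacSpace n j →L[ℂ] E} {p : E}
    (M : Matrix (Fin j) (Fin j) ℝ)
    {h : JacSpace n j → ℂ} {f : holo U} (hf : ∀ x, p + ι x ∈ U → h x = f.1 (p + ι x)) (r : ℕ)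
    (x : JacSpace n j) (hx : p + ι x ∈ U) :
    (heatOp M)^[r] h x = (diffRep U ι ((heatSymbol (toC M)).det ^ r) f).1 (p + ι x) := by
  induction r generalizing x with
  | zero => simpa using hf x hx
  | succ r ih =>
    rw [Function.iterate_succ_apply', pow_succ', map_mul, Module.End.mul_apply]
    exact heatOp_eq_diffRep M (fun y hy => ih y hy) x hx

end Rep

/-! ### Affine substitutions -/

section Affine

open TopologicalSpace

variable {n j : ℕ}

/-- The symbol of the derivative in the direction `x`. -/
noncomputable def dirSymbol (x : JacSpace n j) : HeatSymbol n j :=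
  ∑ k, ∑ l, (2⁻¹ * x.1.1 k l) • tauSymbol n j k l + ∑ a, ∑ s, x.2 a s • zSymbol n j a s

theorem heatDir_sum (x : JacSpace n j) :
    ∑ k, ∑ l, (2⁻¹ * x.1.1 k l) • heatDir (j := j) (Sum.inl s(k, l))
      + ∑ a, ∑ s, x.2 a s • heatDir (n := n) (Sum.inr (a, s)) = x := by
  have hs : ∀ k l, x.1.1 k l = x.1.1 l k := fun k l => congrFun (congrFun x.1.2 l) k
  refine Prod.ext (Subtype.ext ?_) ?_
  · ext p q
    simp only [heatDir, Sum.elim_inl, Sum.elim_inr, Prod.fst_add, Prod.fst_sum, Prod.smul_fst,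
      smul_zero, Finset.sum_const_zero, add_zero, AddSubmonoidClass.coe_finsetSum,
      Matrix.sum_apply, Submodule.coe_smul, Matrix.smul_apply, of_apply, symCoord_mk, smul_eq_mul,
      mul_add, Finset.sum_add_distrib]
    simp [hs q p]
    ring
  · simp only [heatDir, Sum.elim_inl, Sum.elim_inr, Prod.snd_add, Prod.snd_sum, Prod.smul_snd,
      smul_zero, Finset.sum_const_zero, zero_add]
    conv_rhs => rw [matrix_eq_sum_single x.2]
    simp

theorem diffRep_dirSymbol {E : Type*} [NormedAddCommGroup E] [NormedSpace ℂ E] (U : Opens E)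
    (ι : JacSpace n j →L[ℂ] E) (x : JacSpace n j) :
    diffRep U ι (dirSymbol x) = holo.dirDeriv U (ι x) := by
  conv_rhs => rw [← heatDir_sum x]
  simp only [dirSymbol, tauSymbol, zSymbol, of_apply, map_add, map_sum, map_smul, diffRep_X]

theorem analyticOnNhd_affineSubst {E F : Type*} [NormedAddCommGroup E] [NormedSpace ℂ E]
    [NormedAddCommGroup F] [NormedSpace ℂ F] {U : Opens F} {V : Opens E} (L : E →L[ℂ] F) (b : F)
    (l : E →L[ℂ] ℂ) (h : ∀ x ∈ V, L x + b ∈ U) (f : holo U) :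
    AnalyticOnNhd ℂ (fun x => Complex.exp (l x) * f.1 (L x + b)) V := fun x hx =>
  (l.analyticAt x).cexp.mul ((holo.analyticAt f (h x hx)).comp
    (f := fun x => L x + b) ((L.analyticAt x).add analyticAt_const))

/-- Substitution of an affine map and multiplication by the exponential of a linear form, between
spaces of analytic functions. -/
noncomputable def affineSubst {E F : Type*} [NormedAddCommGroup E] [NormedSpace ℂ E]
    [NormedAddCommGroup F] [NormedSpace ℂ F] {U : Opens F} {V : Opens E} (L : E →L[ℂ] F) (b : F)
    (l : E →L[ℂ] ℂ) (h : ∀ x ∈ V, L x + b ∈ U) : holo U →ₗ[ℂ] holo V where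
  toFun f := holo.mk _ (analyticOnNhd_affineSubst L b l h f)
  map_add' f g := holo.ext' fun x hx => by
    have e := fun f => holo.mk_apply (analyticOnNhd_affineSubst L b l h f) hx
    exact (e (f + g)).trans ((mul_add _ _ _).trans (congrArg₂ (· + ·) (e f).symm (e g).symm))
  map_smul' c f := holo.ext' fun x hx => by
    have e := fun f => holo.mk_apply (analyticOnNhd_affineSubst L b l h f) hx
    exact (e (c • f)).trans ((mul_left_comm _ _ _).trans (congrArg (c * ·) (e f).symm))

theorem affineSubst_apply {E F : Type*} [NormedAddCommGroup E] [NormedSpace ℂ E]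
    [NormedAddCommGroup F] [NormedSpace ℂ F] {U : Opens F} {V : Opens E} (L : E →L[ℂ] F) (b : F)
    (l : E →L[ℂ] ℂ) (h : ∀ x ∈ V, L x + b ∈ U) (f : holo U) {x : E} (hx : x ∈ V) :
    (affineSubst L b l h f).1 x = Complex.exp (l x) * f.1 (L x + b) :=
  holo.mk_apply (analyticOnNhd_affineSubst L b l h f) hx

theorem dirDeriv_affineSubst {E F : Type*} [NormedAddCommGroup E] [NormedSpace ℂ E]
    [NormedAddCommGroup F] [NormedSpace ℂ F] {U : Opens F} {V : Opens E} (L : E →L[ℂ] F) (b : F)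
    (l : E →L[ℂ] ℂ) (h : ∀ x ∈ V, L x + b ∈ U) (f : holo U) (v : E) :
    holo.dirDeriv V v (affineSubst L b l h f)
      = affineSubst L b l h (holo.dirDeriv U (L v) f + l v • f) := by
  refine holo.ext' fun x hx => ?_
  rw [holo.dirDeriv_apply _ _ hx, affineSubst_apply _ _ _ _ _ hx, Submodule.coe_add, Pi.add_apply,
    holo.dirDeriv_apply _ _ (h x hx), Submodule.coe_smul, Pi.smul_apply, smul_eq_mul]
  have he : (affineSubst L b l h f).1 =ᶠ[𝓝 x] fun x => Complex.exp (l x) * f.1 (L x + b) := by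
    filter_upwards [V.isOpen.mem_nhds hx] with y hy using affineSubst_apply _ _ _ _ _ hy
  have h1 : HasFDerivAt (fun x => Complex.exp (l x)) (Complex.exp (l x) • (l : E →L[ℂ] ℂ)) x :=
    l.hasFDerivAt.cexp
  have h2 : HasFDerivAt (fun x => f.1 (L x + b)) ((fderiv ℂ f.1 (L x + b)).comp L) x :=
    (holo.analyticAt f (h x hx)).differentiableAt.hasFDerivAt.comp x (L.hasFDerivAt.add_const b)
  rw [he.fderiv_eq, (h1.fun_mul h2).fderiv]
  simp
  ring

/-- The linear part of the substitution `(τ, z) ↦ (Uᵀ τ U + B, (z + u + v τ) U)`. -/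
noncomputable def affLin (U : Matrix (Fin n) (Fin n) ℂ) (v : Matrix (Fin j) (Fin n) ℂ) :
    JacSpace n j →L[ℂ] JacSpace n j :=
  LinearMap.toContinuousLinearMap
    { toFun := fun x => (⟨Uᵀ * x.1.1 * U, by
          have : x.1.1ᵀ = x.1.1 := x.1.2
          show _ = _
          simp [transpose_mul, this, Matrix.mul_assoc]⟩, (x.2 + v * x.1.1) * U)
      map_add' := fun x y => by
        refine Prod.ext (Subtype.ext ?_) ?_
        · simp [Matrix.mul_add, Matrix.add_mul]
        · simp [Matrix.mul_add, Matrix.add_mul]; abel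
      map_smul' := fun c x => by
        refine Prod.ext (Subtype.ext ?_) ?_ <;> simp [Matrix.add_mul] }

/-- The linear form `2 π i Tr(N (v τ + 2 z) vᵀ)`. -/
noncomputable def affForm (N : Matrix (Fin j) (Fin j) ℂ) (v : Matrix (Fin j) (Fin n) ℂ) :
    JacSpace n j →L[ℂ] ℂ :=
  LinearMap.toContinuousLinearMap
    { toFun := fun x => 2 * Real.pi * Complex.I * (N * ((v * x.1.1 + 2 • x.2) * vᵀ)).trace
      map_add' := fun x y => by
        simp [Matrix.mul_add, Matrix.add_mul]; ring
      map_smul' := fun c x => by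
        simp [Matrix.mul_add, Matrix.add_mul]; ring }

theorem affLin_apply (U : Matrix (Fin n) (Fin n) ℂ) (v : Matrix (Fin j) (Fin n) ℂ)
    (x : JacSpace n j) : affLin U v x = (⟨Uᵀ * x.1.1 * U, (affLin U v x).1.2⟩,
      (x.2 + v * x.1.1) * U) := rfl

theorem affForm_apply (N : Matrix (Fin j) (Fin j) ℂ) (v : Matrix (Fin j) (Fin n) ℂ)
    (x : JacSpace n j) : affForm N v x
      = 2 * Real.pi * Complex.I * (N * ((v * x.1.1 + 2 • x.2) * vᵀ)).trace := rfl

/-- The effect on the symbols of the substitution `affLin U v`, followed by the multiplication by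
`exp (affForm N v)`. -/
noncomputable def affSymbol (N : Matrix (Fin j) (Fin j) ℂ) (U : Matrix (Fin n) (Fin n) ℂ)
    (v : Matrix (Fin j) (Fin n) ℂ) : HeatSymbol n j →ₐ[ℂ] HeatSymbol n j :=
  MvPolynomial.aeval fun i =>
    dirSymbol (affLin U v (heatDir i)) + algebraMap ℂ _ (affForm N v (heatDir i))

/-- A matrix of constants, as a matrix of symbols. -/
noncomputable def toSymbol (n j : ℕ) {m p : Type*} (A : Matrix m p ℂ) :
    Matrix m p (HeatSymbol n j) :=
  A.map (algebraMap ℂ (HeatSymbol n j))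

theorem toSymbol_mul {n j : ℕ} {m p q : Type*} [Fintype p] (A : Matrix m p ℂ) (B : Matrix p q ℂ) :
    (toSymbol n j (A * B) : Matrix m q (HeatSymbol n j)) = toSymbol n j A * toSymbol n j B :=
  Matrix.map_mul (f := algebraMap ℂ (HeatSymbol n j))

theorem toSymbol_add {n j : ℕ} {m p : Type*} (A B : Matrix m p ℂ) :
    (toSymbol n j (A + B) : Matrix m p (HeatSymbol n j)) = toSymbol n j A + toSymbol n j B :=
  Matrix.map_add _ (map_add _) A B

theorem toSymbol_transpose {n j : ℕ} {m p : Type*} (A : Matrix m p ℂ) :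
    (toSymbol n j Aᵀ : Matrix p m (HeatSymbol n j)) = (toSymbol n j A)ᵀ := rfl

theorem toSymbol_zero {n j : ℕ} {m p : Type*} :
    toSymbol n j (0 : Matrix m p ℂ) = 0 := by
  ext1 c d
  simp [toSymbol]

theorem toSymbol_single {n j : ℕ} {m p : Type*} [DecidableEq m] [DecidableEq p] (a : m) (b : p) :
    (toSymbol n j (Matrix.single a b 1) : Matrix m p (HeatSymbol n j)) = Matrix.single a b 1 := by
  ext1 c d
  by_cases h : a = c ∧ b = d <;> simp [toSymbol, h]

theorem dirSymbol_eq_trace (x : JacSpace n j) :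
    dirSymbol x = (2⁻¹ : ℂ) • (toSymbol n j x.1.1 * tauSymbol n j).trace
      + ((toSymbol n j x.2)ᵀ * zSymbol n j).trace := by
  have hs : ∀ k l, tauSymbol n j k l = tauSymbol n j l k := fun k l =>
    congrFun (congrFun (tauSymbol_transpose n j) l) k
  have h1 : (2⁻¹ : ℂ) • (toSymbol n j x.1.1 * tauSymbol n j).trace
      = ∑ k, ∑ l, (2⁻¹ * x.1.1 k l) • tauSymbol n j k l := by
    simp only [trace, diag_apply, Matrix.mul_apply, toSymbol, map_apply, Finset.smul_sum]
    refine Finset.sum_congr rfl fun k _ => Finset.sum_congr rfl fun l _ => ?_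
    rw [hs l k, ← Algebra.smul_def, smul_smul]
  have h2 : ((toSymbol n j x.2)ᵀ * zSymbol n j).trace
      = ∑ a, ∑ s, x.2 a s • zSymbol n j a s := by
    rw [Finset.sum_comm]
    simp only [trace, diag_apply, Matrix.mul_apply, toSymbol, map_apply, transpose_apply]
    refine Finset.sum_congr rfl fun k _ => Finset.sum_congr rfl fun l _ => ?_
    rw [← Algebra.smul_def]
  rw [h1, h2, dirSymbol]

theorem of_symCoord (r s : Fin n) :
    of (symCoord s(r, s)) = Matrix.single r s (1 : ℂ) + Matrix.single s r 1 := by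
  ext k l
  simp only [of_apply, symCoord_mk, Matrix.add_apply, Matrix.single_apply, ite_and]
  by_cases h1 : r = k <;> by_cases h2 : s = l <;> by_cases h3 : r = l <;>
    by_cases h4 : s = k <;> simp_all

theorem affSymbol_zSymbol (N : Matrix (Fin j) (Fin j) ℂ) (hN : N.IsSymm)
    (U : Matrix (Fin n) (Fin n) ℂ) (v : Matrix (Fin j) (Fin n) ℂ) :
    (zSymbol n j).map (affSymbol N U v) = zSymbol n j * (toSymbol n j U)ᵀ
      + toSymbol n j ((4 * Real.pi * Complex.I : ℂ) • (N * v)) := by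
  ext1 a s
  have h1 : affForm N v (heatDir (Sum.inr (a, s)))
      = ((4 * Real.pi * Complex.I : ℂ) • (N * v)) a s := by
    have : (N * (single a s (1 : ℂ) * vᵀ)).trace = (N * v) a s := by
      rw [trace_mul_comm, Matrix.mul_assoc, trace_single_mul, smul_eq_mul, one_mul]
      conv_lhs => rw [← hN.eq]
      rw [← transpose_mul, transpose_apply]
    simp only [affForm_apply, heatDir, Sum.elim_inr, Submodule.coe_zero, Matrix.mul_zero, zero_add,
      Matrix.smul_mul, Matrix.mul_smul, trace_smul, this, Matrix.smul_apply, smul_eq_mul,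
      ← Nat.cast_smul_eq_nsmul ℂ]
    push_cast
    ring
  have h2 : dirSymbol (affLin U v (heatDir (Sum.inr (a, s))))
      = (zSymbol n j * (toSymbol n j U)ᵀ) a s := by
    rw [dirSymbol_eq_trace]
    simp only [affLin_apply, heatDir, Sum.elim_inr, Submodule.coe_zero, Matrix.mul_zero, add_zero,
      Matrix.zero_mul, toSymbol_mul, toSymbol_single, transpose_mul, transpose_single]
    rw [toSymbol_zero, Matrix.zero_mul, trace_zero, smul_zero, zero_add, Matrix.mul_assoc,
      trace_mul_comm, Matrix.mul_assoc, trace_single_mul]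
    simp
  rw [map_apply, zSymbol, of_apply, affSymbol, MvPolynomial.aeval_X, h1, h2]
  rfl

theorem affSymbol_tauSymbol (N : Matrix (Fin j) (Fin j) ℂ) (hN : N.IsSymm)
    (U : Matrix (Fin n) (Fin n) ℂ) (v : Matrix (Fin j) (Fin n) ℂ) :
    (tauSymbol n j).map (affSymbol N U v) = toSymbol n j U * tauSymbol n j * (toSymbol n j U)ᵀ
      + ((toSymbol n j v)ᵀ * zSymbol n j * (toSymbol n j U)ᵀ
        + toSymbol n j U * (zSymbol n j)ᵀ * toSymbol n j v)
      + toSymbol n j ((4 * Real.pi * Complex.I : ℂ) • (vᵀ * N * v)) := by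
  ext1 r s
  have h1 : affForm N v (heatDir (Sum.inl s(r, s)))
      = ((4 * Real.pi * Complex.I : ℂ) • (vᵀ * N * v)) r s := by
    have hsym : (vᵀ * N * v) s r = (vᵀ * N * v) r s := by
      rw [← transpose_apply (vᵀ * N * v)]
      simp only [transpose_mul, transpose_transpose, hN.eq, Matrix.mul_assoc]
    have : ∀ r s, (N * (v * single r s (1 : ℂ) * vᵀ)).trace = (vᵀ * N * v) s r := by
      intro r s
      rw [← Matrix.mul_assoc, trace_mul_comm, ← Matrix.mul_assoc, ← Matrix.mul_assoc,
        trace_mul_single]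
      simp
    simp only [affForm_apply, heatDir, Sum.elim_inl, of_symCoord, Matrix.mul_add, Matrix.add_mul,
      trace_add, this, hsym, Matrix.smul_apply, smul_eq_mul, smul_zero, add_zero]
    ring
  have h2 : dirSymbol (affLin U v (heatDir (Sum.inl s(r, s))))
      = (toSymbol n j U * tauSymbol n j * (toSymbol n j U)ᵀ
      + ((toSymbol n j v)ᵀ * zSymbol n j * (toSymbol n j U)ᵀ
        + toSymbol n j U * (zSymbol n j)ᵀ * toSymbol n j v)) r s := by
    have hsym : (toSymbol n j U * tauSymbol n j * (toSymbol n j U)ᵀ) s r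
        = (toSymbol n j U * tauSymbol n j * (toSymbol n j U)ᵀ) r s := by
      rw [← transpose_apply (_ * _)]
      simp only [transpose_mul, transpose_transpose, tauSymbol_transpose, Matrix.mul_assoc]
    have hsym' : ((toSymbol n j v)ᵀ * zSymbol n j * (toSymbol n j U)ᵀ) s r
        = (toSymbol n j U * (zSymbol n j)ᵀ * toSymbol n j v) r s := by
      rw [← transpose_apply (_ * _)]
      simp only [transpose_mul, transpose_transpose, Matrix.mul_assoc]
    have e1 : ∀ r s, ((toSymbol n j U)ᵀ * single r s 1 * toSymbol n j U * tauSymbol n j).trace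
        = (toSymbol n j U * tauSymbol n j * (toSymbol n j U)ᵀ) s r := by
      intro r s
      rw [Matrix.mul_assoc, trace_mul_comm, ← Matrix.mul_assoc, trace_mul_single]
      simp
    have e2 : ∀ r s, ((toSymbol n j U)ᵀ * (single s r (1 : HeatSymbol n j) * (toSymbol n j v)ᵀ)
          * zSymbol n j).trace
        = ((toSymbol n j v)ᵀ * zSymbol n j * (toSymbol n j U)ᵀ) r s := by
      intro r s
      rw [Matrix.mul_assoc, trace_mul_comm, Matrix.mul_assoc, Matrix.mul_assoc, trace_single_mul]
      simp [Matrix.mul_assoc]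
    rw [dirSymbol_eq_trace]
    simp only [affLin_apply, heatDir, Sum.elim_inl, of_symCoord, Matrix.mul_add, Matrix.add_mul,
      zero_add, toSymbol_mul, toSymbol_add, toSymbol_single, toSymbol_transpose, transpose_mul,
      transpose_add, transpose_single, trace_add, e1, e2, hsym, hsym', Matrix.add_apply]
    module
  rw [map_apply, tauSymbol, of_apply, affSymbol, MvPolynomial.aeval_X, h1, h2]
  rfl

/-- An affine substitution changes the heat matrix to `U H Uᵀ`; the terms that involve `v` in the
two parts of the heat matrix cancel. -/
theorem affSymbol_heatSymbol (N : Matrix (Fin j) (Fin j) ℂ) (hN : N.IsSymm)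
    (U : Matrix (Fin n) (Fin n) ℂ) (v : Matrix (Fin j) (Fin n) ℂ) :
    (heatSymbol N).map (affSymbol N U v)
      = toSymbol n j U * heatSymbol N * (toSymbol n j U)ᵀ := by
  have h1 : (heatSymbol N).map (affSymbol N U v)
      = (4 * Real.pi * Complex.I * N.det) • (tauSymbol n j).map (affSymbol N U v)
        - ((zSymbol n j).map (affSymbol N U v))ᵀ * toSymbol n j N.adjugate
          * (zSymbol n j).map (affSymbol N U v) := by
    ext1 r s
    simp only [map_apply, heatSymbol_apply, Matrix.sub_apply, Matrix.smul_apply, map_sub, map_smul,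
      map_sum, map_mul, Matrix.mul_apply, toSymbol, transpose_apply, Finset.sum_mul]
    congr 1
    rw [Finset.sum_comm]
    refine Finset.sum_congr rfl fun a _ => Finset.sum_congr rfl fun b _ => ?_
    rw [Algebra.smul_def]
    ring
  have hsmul : ∀ {m p : Type} (c : ℂ) (A : Matrix m p ℂ),
      toSymbol n j (c • A) = c • toSymbol n j A := by
    intro m p c A
    ext1 a b
    simp [toSymbol, Algebra.smul_def]
  have hone : toSymbol n j (1 : Matrix (Fin j) (Fin j) ℂ) = 1 :=
    Matrix.map_one (algebraMap ℂ (HeatSymbol n j)) (map_zero _) (map_one _)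
  have e1 : ∀ X : Matrix (Fin j) (Fin n) (HeatSymbol n j),
      toSymbol n j N.adjugate * (toSymbol n j N * X) = N.det • X := by
    intro X
    rw [← Matrix.mul_assoc, ← toSymbol_mul, adjugate_mul, hsmul, hone, Matrix.smul_mul,
      Matrix.one_mul]
  have e2 : ∀ X : Matrix (Fin j) (Fin n) (HeatSymbol n j),
      toSymbol n j N * (toSymbol n j N.adjugate * X) = N.det • X := by
    intro X
    rw [← Matrix.mul_assoc, ← toSymbol_mul, mul_adjugate, hsmul, hone, Matrix.smul_mul,
      Matrix.one_mul]
  have hT : (toSymbol n j N)ᵀ = toSymbol n j N := by rw [← toSymbol_transpose, hN.eq]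
  rw [h1, affSymbol_zSymbol N hN, affSymbol_tauSymbol N hN, heatSymbol]
  change _ = toSymbol n j U * ((4 * Real.pi * Complex.I * N.det) • tauSymbol n j
    - (zSymbol n j)ᵀ * toSymbol n j N.adjugate * zSymbol n j) * (toSymbol n j U)ᵀ
  simp only [hsmul, toSymbol_mul, toSymbol_transpose, transpose_add, transpose_smul, transpose_mul,
    transpose_transpose, hT, Matrix.mul_add, Matrix.add_mul, Matrix.mul_sub, Matrix.sub_mul,
    Matrix.smul_mul, Matrix.mul_smul, Matrix.mul_assoc, e1, e2]
  module

theorem affSymbol_det (N : Matrix (Fin j) (Fin j) ℂ) (hN : N.IsSymm)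
    (U : Matrix (Fin n) (Fin n) ℂ) (v : Matrix (Fin j) (Fin n) ℂ) :
    affSymbol N U v (heatSymbol N).det = (U.det ^ 2) • (heatSymbol N).det := by
  have h1 : affSymbol N U v (heatSymbol N).det = ((heatSymbol N).map (affSymbol N U v)).det :=
    AlgHom.map_det (affSymbol N U v) _
  have h2 : (toSymbol n j U : Matrix _ _ (HeatSymbol n j)).det = algebraMap ℂ _ U.det :=
    (RingHom.map_det (algebraMap ℂ (HeatSymbol n j)) U).symm
  rw [h1, affSymbol_heatSymbol N hN, det_mul, det_mul, det_transpose, h2, Algebra.smul_def,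
    map_pow]
  ring

theorem diffRep_affineSubst {E F : Type*} [NormedAddCommGroup E] [NormedSpace ℂ E]
    [NormedAddCommGroup F] [NormedSpace ℂ F] {U : Opens F} {V : Opens E} {L : E →L[ℂ] F} {b : F}
    {l : E →L[ℂ] ℂ} (h : ∀ x ∈ V, L x + b ∈ U) {ι : JacSpace n j →L[ℂ] E}
    {ι' : JacSpace n j →L[ℂ] F} {N : Matrix (Fin j) (Fin j) ℂ}
    {A : Matrix (Fin n) (Fin n) ℂ} {v : Matrix (Fin j) (Fin n) ℂ}
    (hL : ∀ x, L (ι x) = ι' (affLin A v x)) (hl : ∀ x, l (ι x) = affForm N v x)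
    (p : HeatSymbol n j) (f : holo U) :
    diffRep V ι p (affineSubst L b l h f)
      = affineSubst L b l h (diffRep U ι' (affSymbol N A v p) f) := by
  induction p using MvPolynomial.induction_on generalizing f with
  | C a =>
    rw [← MvPolynomial.algebraMap_eq, AlgHom.commutes, AlgHom.commutes, AlgHom.commutes,
      Module.algebraMap_end_apply, Module.algebraMap_end_apply, map_smul]
  | add p q hp hq => simp only [map_add, LinearMap.add_apply, hp, hq]
  | mul_X p i hp =>
    rw [map_mul, map_mul, map_mul, Module.End.mul_apply, Module.End.mul_apply, ← hp, diffRep_X,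
      dirDeriv_affineSubst, affSymbol, MvPolynomial.aeval_X, map_add (diffRep U ι'),
      diffRep_dirSymbol, AlgHom.commutes, LinearMap.add_apply, Module.algebraMap_end_apply, hL, hl]

theorem heatOp_iterate_affineSubst {E F : Type*} [NormedAddCommGroup E] [NormedSpace ℂ E]
    [NormedAddCommGroup F] [NormedSpace ℂ F] {L : E →L[ℂ] F} {b : F}
    {l : E →L[ℂ] ℂ} {ι : JacSpace n j →L[ℂ] E} {ι' : JacSpace n j →L[ℂ] F}
    {M : Matrix (Fin j) (Fin j) ℝ} (hM : M.IsSymm) (r : ℕ)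
    {A : Matrix (Fin n) (Fin n) ℂ} {v : Matrix (Fin j) (Fin n) ℂ}
    (hL : ∀ x, L (ι x) = ι' (affLin A v x)) (hl : ∀ x, l (ι x) = affForm (toC M) v x) (κ : ℂ)
    {f : F → ℂ} {x y : JacSpace n j} (hf : AnalyticAt ℂ f (0 + ι' y))
    (hxy : L (0 + ι x) + b = 0 + ι' y) :
    (heatOp M)^[r] (fun x => κ * (Complex.exp (l (0 + ι x)) * f (L (0 + ι x) + b))) x
      = κ * (Complex.exp (l (0 + ι x)) * (A.det ^ (2 * r)
        * (heatOp M)^[r] (fun y => f (0 + ι' y)) y)) := by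
  have hN : (toC M).IsSymm := (congrArg toC hM.eq :)
  set U : Opens F := ⟨{y | AnalyticAt ℂ f y}, isOpen_analyticAt ℂ f⟩ with hU
  have hc : Continuous fun y => L y + b := L.continuous.add continuous_const
  set V : Opens E := ⟨_, U.isOpen.preimage hc⟩ with hV
  have hf' : AnalyticOnNhd ℂ f U := fun y hy => hy
  have hVU : ∀ y ∈ V, L y + b ∈ U := fun y hy => hy
  have hx : 0 + ι x ∈ V := by
    show AnalyticAt ℂ f _
    exact (congrArg (AnalyticAt ℂ f) hxy).mpr hf
  rw [heatOp_iterate_eq_diffRep (U := V) (ι := ι) (p := 0)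
    (f := κ • affineSubst L b l hVU (holo.mk f hf')) M (fun y hy => ?_) r x hx,
    heatOp_iterate_eq_diffRep (U := U) (ι := ι') (p := 0) (f := holo.mk f hf') M
      (fun y hy => (holo.mk_apply hf' hy).symm) r y hf]
  · rw [map_smul, diffRep_affineSubst hVU hL hl, map_pow, affSymbol_det _ hN, smul_pow, map_smul,
      LinearMap.smul_apply, Submodule.coe_smul, Pi.smul_apply,
      affineSubst_apply _ _ _ _ _ hx, Submodule.coe_smul, Pi.smul_apply, smul_eq_mul, smul_eq_mul,
      pow_mul, hxy]
  · rw [Submodule.coe_smul, Pi.smul_apply, affineSubst_apply _ _ _ _ _ hy,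
      holo.mk_apply _ (hVU _ hy), smul_eq_mul]

/-- The powers of the heat operator are equivariant under affine substitutions. -/
theorem heatOp_iterate_affine {M : Matrix (Fin j) (Fin j) ℝ} (hM : M.IsSymm) (r : ℕ)
    (A : Matrix (Fin n) (Fin n) ℂ) (v : Matrix (Fin j) (Fin n) ℂ) (b : JacSpace n j) (κ : ℂ)
    {f : JacSpace n j → ℂ} {x : JacSpace n j} (hf : AnalyticAt ℂ f (affLin A v x + b)) :
    (heatOp M)^[r] (fun y => κ * (Complex.exp (affForm (toC M) v y) * f (affLin A v y + b))) x
      = κ * (Complex.exp (affForm (toC M) v x) * (A.det ^ (2 * r)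
        * (heatOp M)^[r] f (affLin A v x + b))) := by
  have := heatOp_iterate_affineSubst (L := affLin A v) (b := b) (l := affForm (toC M) v)
    (ι := ContinuousLinearMap.id ℂ (JacSpace n j)) (ι' := ContinuousLinearMap.id ℂ (JacSpace n j))
    hM r (fun _ => rfl) (fun _ => rfl) κ (f := f) (x := x) (y := affLin A v x + b)
    ((zero_add (affLin A v x + b)).symm ▸ hf) (by
      show affLin A v (0 + x) + b = 0 + (affLin A v x + b)
      rw [zero_add, zero_add])
  change (heatOp M)^[r] (fun y => κ * (Complex.exp (affForm (toC M) v (0 + y))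
    * f (affLin A v (0 + y) + b))) x = κ * (Complex.exp (affForm (toC M) v (0 + x))
    * (A.det ^ (2 * r) * (heatOp M)^[r] (fun y => f (0 + y)) (affLin A v x + b))) at this
  simpa only [zero_add] using this

end Affine

/-! ### Infinitesimal equivariance -/

section Flow

open TopologicalSpace

variable {n j : ℕ}

/-- The vector field `(τ S τ, z S τ)`, which generates the one-parameter group
`(τ, z) ↦ (τ (1 - s S τ)⁻¹, z (1 - s S τ)⁻¹)`. -/
def siegelField {S : Matrix (Fin n) (Fin n) ℂ} (hS : S.IsSymm) (x : JacSpace n j) :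
    JacSpace n j :=
  (⟨x.1.1 * S * x.1.1, by
    have : x.1.1ᵀ = x.1.1 := x.1.2
    show _ = _
    simp [transpose_mul, this, hS.eq, Matrix.mul_assoc]⟩, x.2 * S * x.1.1)

variable {E : Type*} [NormedAddCommGroup E] [NormedSpace ℂ E]

theorem sum_comm₄ {α β γ δ A : Type*} [Fintype α] [Fintype β] [Fintype γ] [Fintype δ]
    [AddCommMonoid A] (f : α → β → γ → δ → A) :
    ∑ a, ∑ b, ∑ c, ∑ d, f a b c d = ∑ c, ∑ d, ∑ a, ∑ b, f a b c d := by
  simp only [← Fintype.sum_prod_type']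
  exact Fintype.sum_equiv ⟨fun x => (x.2.2.1, x.2.2.2, x.1, x.2.1),
    fun x => (x.2.2.1, x.2.2.2, x.1, x.2.1), fun _ => rfl, fun _ => rfl⟩ _ _ fun _ => rfl

/-- The infinitesimal action of `WeylRep.infAct`, written as a vector field plus a potential. -/
theorem infAct_apply {U : Opens E} {ι : JacSpace n j →L[ℂ] E} {π : E →L[ℂ] JacSpace n j}
    (h : ∀ x, π (ι x) = x) (N : Matrix (Fin j) (Fin j) ℂ) {S : Matrix (Fin n) (Fin n) ℂ}
    (hS : S.IsSymm) (κ : ℂ) (F : holo U) {x : E} (hx : x ∈ U) :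
    ((holoWeyl U ι π h).infAct N S κ F).1 x
      = fderiv ℂ F.1 x (ι (siegelField hS (π x)))
        + (κ / 2 * (S * (π x).1.1).trace
          + 2 * Real.pi * Complex.I * (N * ((π x).2 * S * (π x).2ᵀ)).trace) * F.1 x := by
  have hs : ∀ k l, (π x).1.1 k l = (π x).1.1 l k := fun k l =>
    congrFun (congrFun (π x).1.2 l) k
  have hS' : ∀ k l, S k l = S l k := fun k l => congrFun (congrFun hS.eq l) k
  have hadd : ∀ (f g : holo U), (f + g).1 x = f.1 x + g.1 x := fun f g => rfl
  have hsmul : ∀ (c : ℂ) (f : holo U), (c • f).1 x = c * f.1 x := fun c f => rfl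
  rw [← holo.dirDeriv_apply _ _ hx, ← diffRep_dirSymbol, dirSymbol]
  have ht : ∀ k l f, ((holoWeyl U ι π h).t k l f).1 x = (π x).1.1 k l * f.1 x := fun _ _ _ => rfl
  have hz : ∀ a l f, ((holoWeyl U ι π h).z a l f).1 x = (π x).2 a l * f.1 x := fun _ _ _ => rfl
  have hρ : (holoWeyl U ι π h).ρ = diffRep U ι := rfl
  generalize holoWeyl U ι π h = R at ht hz hρ ⊢
  rw [WeylRep.infAct, hρ]
  generalize π x = y at hs ht hz ⊢
  simp only [map_add, map_sum, map_smul, LinearMap.add_apply, LinearMap.sum_apply,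
    LinearMap.smul_apply, hadd, hsmul, holo.coe_sum, Module.End.mul_apply, ht, hz]
  set P : Fin n → Fin n → ℂ := fun k l => (diffRep U ι (tauSymbol n j k l) F).1 x with hP
  set D : Fin j → Fin n → ℂ := fun a s => (diffRep U ι (zSymbol n j a s) F).1 x with hD
  have hPs : ∀ k l, P k l = P l k := fun k l => by
    simp only [hP, tauSymbol, of_apply, Sym2.eq_swap]
  have e1 : ∑ k, ∑ l, 2⁻¹ * (siegelField hS y).1.1 k l * P k l
      = ∑ b, ∑ c, S b c * (2⁻¹ * ∑ a, ∑ d, y.1.1 a b * (y.1.1 c d * P d a)) := by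
    have : ∀ k l, (siegelField hS y).1.1 k l = ∑ b, ∑ c, y.1.1 k b * S b c * y.1.1 c l := by
      intro k l
      simp only [siegelField, Matrix.mul_apply, Finset.sum_mul]
      exact Finset.sum_comm
    simp only [this, Finset.mul_sum, Finset.sum_mul]
    rw [sum_comm₄]
    refine Finset.sum_congr rfl fun b _ => Finset.sum_congr rfl fun c _ =>
      Finset.sum_congr rfl fun a _ => Finset.sum_congr rfl fun d _ => ?_
    rw [hPs d a]
    ring
  have e2 : ∑ a, ∑ s, (siegelField hS y).2 a s * D a s
      = ∑ b, ∑ c, S b c * ∑ a, ∑ s, y.2 a b * (y.1.1 c s * D a s) := by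
    have : ∀ a s, (siegelField hS y).2 a s = ∑ b, ∑ c, y.2 a b * S b c * y.1.1 c s := by
      intro k l
      simp only [siegelField, Matrix.mul_apply, Finset.sum_mul]
      exact Finset.sum_comm
    simp only [this, Finset.mul_sum, Finset.sum_mul]
    rw [sum_comm₄]
    refine Finset.sum_congr rfl fun b _ => Finset.sum_congr rfl fun c _ =>
      Finset.sum_congr rfl fun a _ => Finset.sum_congr rfl fun d _ => ?_
    ring
  have e3 : (S * y.1.1).trace = ∑ b, ∑ c, S b c * y.1.1 b c := by
    simp only [trace, diag_apply, Matrix.mul_apply]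
    exact Finset.sum_congr rfl fun b _ => Finset.sum_congr rfl fun c _ => by rw [hs]
  have e4 : (N * (y.2 * S * y.2ᵀ)).trace
      = ∑ b, ∑ c, S b c * ∑ e, ∑ f, N e f * (y.2 e b * y.2 f c) := by
    have : ∀ k l, (y.2 * S * y.2ᵀ) k l = ∑ b, ∑ c, y.2 k b * S b c * y.2 l c := by
      intro k l
      simp only [Matrix.mul_apply, Finset.sum_mul, transpose_apply]
      exact Finset.sum_comm
    simp only [trace, diag_apply, Matrix.mul_apply (M := N), this, Finset.mul_sum]
    rw [sum_comm₄, Finset.sum_comm]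
    refine Finset.sum_congr rfl fun b _ => Finset.sum_congr rfl fun c _ =>
      Finset.sum_congr rfl fun a _ => Finset.sum_congr rfl fun d _ => ?_
    rw [hS' c b]
    ring
  rw [e1, e2, e3, e4]
  simp only [mul_add, Finset.sum_add_distrib, add_mul, Finset.mul_sum, Finset.sum_mul]
  rw [add_assoc]
  congr 2 <;>
  · repeat refine Finset.sum_congr rfl fun _ _ => ?_
    ring

theorem dirDeriv_mul_diffRep {U : Opens E} (ι : JacSpace n j →L[ℂ] E) (e : E)
    (p : HeatSymbol n j) :
    diffRep U ι p * holo.dirDeriv U e = holo.dirDeriv U e * diffRep U ι p := by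
  have := commutator_eq_of_X (A := Module.End ℂ (holo U)) (diffRep U ι) 0 (holo.dirDeriv U e)
    (fun i => by rw [diffRep_X, holo.dirDeriv_mul_comm, Derivation.zero_apply, map_zero, add_zero])
    p
  rwa [Derivation.zero_apply, map_zero, add_zero] at this

/-- If a family of functions of `(τ, z)`, with the parameter in the direction `e`, moves by the
infinitesimal action in weight `(n + j + 1) / 2 - r`, then the `r`-th powers of the heat operator
applied to the family move by the infinitesimal action in weight `(n + j + 1) / 2 + r`. At `(0, w)`
the vector field `siegelField` vanishes, so that their values at this point satisfy a scalar linear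
differential equation. -/
theorem heatOp_iterate_flow {ι : JacSpace n j →L[ℂ] E} {π : E →L[ℂ] JacSpace n j}
    (h : ∀ x, π (ι x) = x) {e : E} (he : π e = 0) {M : Matrix (Fin j) (Fin j) ℝ} (hM : M.PosDef)
    {S : Matrix (Fin n) (Fin n) ℂ} (hS : S.IsSymm) (r : ℕ) (w : Matrix (Fin j) (Fin n) ℂ)
    {F : E → ℂ} (hF : ∀ s : ℂ, ∀ᶠ x in 𝓝 (s • e + ι (0, w)), AnalyticAt ℂ F x ∧
      fderiv ℂ F x (e + ι (siegelField hS (π x)))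
        = -((n + j + 1 - 2 * r) / 2 * (S * (π x).1.1).trace
          + 2 * Real.pi * Complex.I * (toC M * ((π x).2 * S * (π x).2ᵀ)).trace) * F x) :
    (heatOp M)^[r] (fun y => F ((1 : ℂ) • e + ι y)) (0, w)
      = Complex.exp (-(2 * Real.pi * Complex.I * (toC M * (w * S * wᵀ)).trace))
        * (heatOp M)^[r] (fun y => F ((0 : ℂ) • e + ι y)) (0, w) := by
  have hMs : M.IsSymm := by
    have := hM.isHermitian.eq
    rwa [conjTranspose_eq_transpose_of_trivial] at this
  have hN : (toC M).IsSymm := (congrArg toC hMs.eq :)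
  have hdet : (toC M).det ≠ 0 := by
    have : (toC M).det = (M.det : ℂ) := (RingHom.map_det Complex.ofRealHom M).symm
    rw [this]
    exact_mod_cast hM.det_pos.ne'
  set W : Opens E := ⟨_, isOpen_setOfPred_eventually_nhds (p := fun x => AnalyticAt ℂ F x ∧
      fderiv ℂ F x (e + ι (siegelField hS (π x)))
        = -((n + j + 1 - 2 * r) / 2 * (S * (π x).1.1).trace
          + 2 * Real.pi * Complex.I * (toC M * ((π x).2 * S * (π x).2ᵀ)).trace) * F x)⟩ with hW
  have hpt : ∀ s : ℂ, s • e + ι (0, w) ∈ W := hF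
  have hFW : AnalyticOnNhd ℂ F W := fun x hx => (hx : ∀ᶠ _ in _, _).self_of_nhds.1
  set G : holo W := holo.mk F hFW with hG
  set R := holoWeyl W ι π h with hR
  have hGF : ∀ x ∈ W, G.1 =ᶠ[𝓝 x] F := fun x hx => by
    filter_upwards [W.isOpen.mem_nhds hx] with y hy using holo.mk_apply hFW hy
  have hpde : holo.dirDeriv W e G = -(R.infAct (toC M) S (n + j + 1 - 2 * r) G) := by
    refine holo.ext' fun x hx => ?_
    have h1 := (hx : ∀ᶠ _ in _, _).self_of_nhds.2
    rw [map_add] at h1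
    have h2 : (-(R.infAct (toC M) S (n + j + 1 - 2 * r) G)).1 x
      = -((R.infAct (toC M) S (n + j + 1 - 2 * r) G).1 x) := rfl
    rw [h2, hR, infAct_apply h _ hS _ _ hx, holo.dirDeriv_apply _ _ hx, (hGF x hx).fderiv_eq,
      (hGF x hx).eq_of_nhds, eq_sub_of_add_eq h1]
    ring
  set g : holo W := diffRep W ι ((heatSymbol (toC M)).det ^ r) G with hg
  have hg' : holo.dirDeriv W e g = -(R.infAct (toC M) S (n + j + 1 + 2 * r) g) := by
    rw [hg, ← Module.End.mul_apply, ← dirDeriv_mul_diffRep, Module.End.mul_apply, hpde, map_neg]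
    congr 1
    have := congrArg (· G) (R.ρ_det_pow_mul_infAct hN hdet hS r)
    exact this
  set μ : ℂ := 2 * Real.pi * Complex.I * (toC M * (w * S * wᵀ)).trace with hμ
  have hder : ∀ s : ℂ, HasDerivAt (fun s : ℂ => g.1 (s • e + ι (0, w)))
      (-(μ * g.1 (s • e + ι (0, w)))) s := by
    intro s
    have hπ : π (s • e + ι (0, w)) = (0, w) := by rw [map_add, map_smul, he, h, smul_zero, zero_add]
    have hfield : siegelField hS ((0, w) : JacSpace n j) = 0 := by
      refine Prod.ext (Subtype.ext ?_) ?_ <;> simp [siegelField]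
    have h1 : (holo.dirDeriv W e g).1 (s • e + ι (0, w)) = -(μ * g.1 (s • e + ι (0, w))) := by
      rw [hg']
      show -((R.infAct (toC M) S (n + j + 1 + 2 * r) g).1 (s • e + ι (0, w))) = _
      rw [hR, infAct_apply h _ hS _ _ (hpt s), hπ, hfield, map_zero, map_zero]
      simp [hμ]
    rw [← h1, holo.dirDeriv_apply _ _ (hpt s)]
    have hline : HasDerivAt (fun s : ℂ => s • e + ι (0, w)) e s := by
      simpa using ((hasDerivAt_id s).smul_const e).add_const (ι (0, w))
    exact (holo.analyticAt g (hpt s)).differentiableAt.hasFDerivAt.comp_hasDerivAt s hline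
  have hconst : ∀ s : ℂ, HasDerivAt (fun s : ℂ => Complex.exp (μ * s) * g.1 (s • e + ι (0, w)))
      0 s := by
    intro s
    have h1 : HasDerivAt (fun s : ℂ => Complex.exp (μ * s)) (Complex.exp (μ * s) * μ) s := by
      simpa using ((hasDerivAt_id s).const_mul μ).cexp
    have h2 := h1.fun_mul (hder s)
    have h3 : Complex.exp (μ * s) * μ * g.1 (s • e + ι (0, w))
        + Complex.exp (μ * s) * -(μ * g.1 (s • e + ι (0, w))) = 0 := by ring
    rwa [h3] at h2
  have hfin := is_const_of_deriv_eq_zero (fun s => (hconst s).differentiableAt)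
    (fun s => (hconst s).deriv) 1 0
  have hslice : ∀ s : ℂ, (heatOp M)^[r] (fun y => F (s • e + ι y)) (0, w)
      = g.1 (s • e + ι (0, w)) := fun s =>
    heatOp_iterate_eq_diffRep (U := W) (ι := ι) (p := s • e) (f := G) M
      (fun y hy => (holo.mk_apply hFW hy).symm) r (0, w) (hpt s)
  rw [hslice, hslice, Complex.exp_neg, eq_inv_mul_iff_mul_eq₀ (Complex.exp_ne_zero _)]
  simpa using hfin

end Flow

/-! ### Analytic matrix-valued functions -/

section MatrixAnalytic

variable {E : Type*} [NormedAddCommGroup E] [NormedSpace ℂ E]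

/-- A matrix-valued function is analytic at a point if its entries are. -/
def MatAnalyticAt {m l : Type*} (A : E → Matrix m l ℂ) (p : E) : Prop :=
  ∀ i k, AnalyticAt ℂ (fun x => A x i k) p

namespace MatAnalyticAt

variable {m l o : Type*} {A B : E → Matrix m l ℂ} {p : E}

theorem const (A : Matrix m l ℂ) : MatAnalyticAt (fun _ => A) p := fun _ _ => analyticAt_const

theorem add (hA : MatAnalyticAt A p) (hB : MatAnalyticAt B p) :
    MatAnalyticAt (fun x => A x + B x) p := fun i k => (hA i k).add (hB i k)

theorem smul {c : E → ℂ} (hc : AnalyticAt ℂ c p) (hA : MatAnalyticAt A p) :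
    MatAnalyticAt (fun x => c x • A x) p := fun i k => hc.mul (hA i k)

theorem transpose (hA : MatAnalyticAt A p) : MatAnalyticAt (fun x => (A x)ᵀ) p :=
  fun i k => hA k i

variable [Fintype l]

theorem mul {C : E → Matrix l o ℂ} (hA : MatAnalyticAt A p) (hC : MatAnalyticAt C p) :
    MatAnalyticAt (fun x => A x * C x) p := fun i k => by
  simp only [Matrix.mul_apply]
  exact Finset.analyticAt_fun_sum _ fun c _ => (hA i c).mul (hC c k)

theorem trace {A : E → Matrix l l ℂ} (hA : MatAnalyticAt A p) :
    AnalyticAt ℂ (fun x => (A x).trace) p := by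
  simp only [Matrix.trace, diag_apply]
  exact Finset.analyticAt_fun_sum _ fun c _ => hA c c

variable [DecidableEq l]

theorem det {A : E → Matrix l l ℂ} (hA : MatAnalyticAt A p) :
    AnalyticAt ℂ (fun x => (A x).det) p := by
  simp only [det_apply, Units.smul_def, zsmul_eq_mul]
  exact Finset.analyticAt_fun_sum _ fun σ _ => analyticAt_const.mul
    (Finset.analyticAt_fun_prod _ fun c _ => hA _ c)

theorem inv {A : E → Matrix l l ℂ} (hA : MatAnalyticAt A p) (h : (A p).det ≠ 0) :
    MatAnalyticAt (fun x => (A x)⁻¹) p := fun i k => by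
  simp only [Matrix.inv_def, Ring.inverse_eq_inv', Matrix.smul_apply, smul_eq_mul, adjugate_apply]
  refine (hA.det.inv h).mul (MatAnalyticAt.det fun a b => ?_)
  by_cases ha : a = k
  · subst ha
    simpa using analyticAt_const
  · simpa [updateRow_ne ha] using hA a b

end MatAnalyticAt

theorem analyticAt_of_linear {F : Type*} [NormedAddCommGroup F] [NormedSpace ℂ F]
    [FiniteDimensional ℂ E] (L : E →ₗ[ℂ] F) (x : E) : AnalyticAt ℂ L x :=
  (LinearMap.toContinuousLinearMap L).analyticAt x

variable {n j : ℕ}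

/-- The symmetric part of a square matrix. -/
noncomputable def symProj (n : ℕ) : Matrix (Fin n) (Fin n) ℂ →ₗ[ℂ] symMat n where
  toFun A := ⟨(2⁻¹ : ℂ) • (A + Aᵀ), by
    show _ = _
    rw [transpose_smul, transpose_add, transpose_transpose, add_comm]⟩
  map_add' A B := Subtype.ext (by simp only [transpose_add, Submodule.coe_add]; module)
  map_smul' c A := Subtype.ext (by
    simp only [transpose_smul, Submodule.coe_smul, RingHom.id_apply]; module)

theorem symProj_apply {A : Matrix (Fin n) (Fin n) ℂ} (hA : A.IsSymm) :
    (symProj n A).1 = A := by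
  show (2⁻¹ : ℂ) • (A + Aᵀ) = A
  rw [hA.eq, ← two_smul ℂ A, smul_smul, inv_mul_cancel₀ two_ne_zero, one_smul]

theorem MatAnalyticAt.analyticAt {m l : Type*} [Fintype m] [Fintype l] {A : E → Matrix m l ℂ}
    {p : E} (hA : MatAnalyticAt A p) : AnalyticAt ℂ A p :=
  analyticAt_pi_iff.2 fun i => analyticAt_pi_iff.2 fun k => hA i k

theorem analyticAt_jacSpace {A : E → Matrix (Fin n) (Fin n) ℂ} {B : E → Matrix (Fin j) (Fin n) ℂ}
    {p : E} (hA : MatAnalyticAt A p) (hB : MatAnalyticAt B p) :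
    AnalyticAt ℂ (fun x => (symProj n (A x), B x)) p :=
  ((analyticAt_of_linear (symProj n) (A p)).comp hA.analyticAt).prod hB.analyticAt

theorem matAnalyticAt_tau {f : E → JacSpace n j} {p : E} (hf : AnalyticAt ℂ f p) :
    MatAnalyticAt (fun x => (f x).1.1) p := fun k l =>
  AnalyticAt.comp (g := fun x : JacSpace n j => x.1.1 k l)
    (analyticAt_of_linear (E := JacSpace n j) (tauCoord k l).toLinearMap (f p)) hf

theorem matAnalyticAt_z {f : E → JacSpace n j} {p : E} (hf : AnalyticAt ℂ f p) :
    MatAnalyticAt (fun x => (f x).2) p := fun k l =>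
  AnalyticAt.comp (g := fun x : JacSpace n j => x.2 k l)
    (analyticAt_of_linear (E := JacSpace n j) (zCoord k l).toLinearMap (f p)) hf

/-- A directional derivative of an analytic function can be computed along any curve
`θ ↦ p + θ d(θ)` with the right initial direction. -/
theorem fderiv_apply_of_curve {F : E → ℂ} {p : E} {d : ℂ → E} (hF : AnalyticAt ℂ F p)
    (hd : AnalyticAt ℂ d 0) {G : ℂ → ℂ} {g : ℂ} (hG : HasDerivAt G g 0)
    (h : ∀ᶠ θ in 𝓝 (0 : ℂ), F (p + θ • d θ) = G θ) : fderiv ℂ F p (d 0) = g := by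
  have h1 : HasDerivAt (fun θ => p + θ • d θ) ((0 : ℂ) • deriv d 0 + (1 : ℂ) • d 0) 0 :=
    ((hasDerivAt_id (0 : ℂ)).smul hd.differentiableAt.hasDerivAt).const_add p
  have h2 : HasFDerivAt F (fderiv ℂ F p) (p + (0 : ℂ) • d 0) := by
    simpa using hF.differentiableAt.hasFDerivAt
  have h3 := h2.comp_hasDerivAt (0 : ℂ) h1
  have h4 := (hG.congr_of_eventuallyEq h).unique h3
  simpa using h4.symm

end MatrixAnalytic

/-! ### The Siegel translations -/

section Shift

variable {n j : ℕ}

/-- The transformation `(τ, z) ↦ (τ (1 + S τ)⁻¹, z (1 + S τ)⁻¹)`. For symmetric `S` the first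
component is already symmetric where `1 + S τ` is invertible; elsewhere the value is irrelevant. -/
noncomputable def siegelShift (S : Matrix (Fin n) (Fin n) ℂ) (x : JacSpace n j) : JacSpace n j :=
  (symProj n (x.1.1 * (1 + S * x.1.1)⁻¹), x.2 * (1 + S * x.1.1)⁻¹)

/-- The quadratic form `z (1 + S τ)⁻¹ S zᵀ`. -/
noncomputable def shiftQuad (S : Matrix (Fin n) (Fin n) ℂ) (x : JacSpace n j) :
    Matrix (Fin j) (Fin j) ℂ :=
  x.2 * (1 + S * x.1.1)⁻¹ * S * x.2ᵀ

/-- The factor of automorphy in weight `κ / 2` and index `N` that belongs to `siegelShift S`, with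
the principal branch of the power; it is used near `det (1 + S τ) = 1` only. -/
noncomputable def shiftFactor (κ : ℂ) (N : Matrix (Fin j) (Fin j) ℂ)
    (S : Matrix (Fin n) (Fin n) ℂ) (x : JacSpace n j) : ℂ :=
  (1 + S * x.1.1).det ^ (-κ / 2)
    * Complex.exp (-(2 * Real.pi * Complex.I * (N * shiftQuad S x).trace))

theorem siegelShift_tau {S : Matrix (Fin n) (Fin n) ℂ} (hS : S.IsSymm) {x : JacSpace n j}
    (hx : (1 + S * x.1.1).det ≠ 0) : (siegelShift S x).1.1 = x.1.1 * (1 + S * x.1.1)⁻¹ := by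
  refine symProj_apply ?_
  have hτ : x.1.1ᵀ = x.1.1 := x.1.2
  have hu : IsUnit (1 + S * x.1.1).det := hx.isUnit
  have hu' : IsUnit (1 + x.1.1 * S).det := by
    rwa [det_one_add_mul_comm, isUnit_iff_ne_zero]
  rw [IsSymm, transpose_mul, transpose_nonsing_inv, transpose_add, transpose_mul, transpose_one, hτ,
    hS.eq]
  calc (1 + x.1.1 * S)⁻¹ * x.1.1
      = (1 + x.1.1 * S)⁻¹ * (x.1.1 * (1 + S * x.1.1)) * (1 + S * x.1.1)⁻¹ := by
        rw [Matrix.mul_assoc, Matrix.mul_assoc x.1.1, mul_nonsing_inv _ hu, Matrix.mul_one]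
    _ = (1 + x.1.1 * S)⁻¹ * ((1 + x.1.1 * S) * x.1.1) * (1 + S * x.1.1)⁻¹ := by
        congr 2
        simp only [Matrix.mul_add, Matrix.add_mul, Matrix.mul_assoc, Matrix.one_mul, Matrix.mul_one]
    _ = _ := by rw [← Matrix.mul_assoc, nonsing_inv_mul _ hu', Matrix.one_mul]

section GroupLaw

variable {S S' : Matrix (Fin n) (Fin n) ℂ} {x : JacSpace n j}

theorem one_add_mul_siegelShift (hS : S.IsSymm) (hx : (1 + S * x.1.1).det ≠ 0) :
    1 + S' * (siegelShift S x).1.1 = (1 + (S + S') * x.1.1) * (1 + S * x.1.1)⁻¹ := by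
  rw [siegelShift_tau hS hx, Matrix.add_mul S S', ← add_assoc, Matrix.add_mul _ (S' * x.1.1),
    mul_nonsing_inv _ hx.isUnit, Matrix.mul_assoc]

theorem siegelShift_siegelShift (hS : S.IsSymm) (hx : (1 + S * x.1.1).det ≠ 0) :
    siegelShift S' (siegelShift S x) = siegelShift (S + S') x := by
  have h : (1 + S' * (siegelShift S x).1.1)⁻¹ = (1 + S * x.1.1) * (1 + (S + S') * x.1.1)⁻¹ := by
    rw [one_add_mul_siegelShift hS hx, Matrix.mul_inv_rev, nonsing_inv_nonsing_inv _ hx.isUnit]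
  have h1 : ∀ {l : ℕ} (A : Matrix (Fin l) (Fin n) ℂ), A * (1 + S * x.1.1)⁻¹
      * ((1 + S * x.1.1) * (1 + (S + S') * x.1.1)⁻¹) = A * (1 + (S + S') * x.1.1)⁻¹ := by
    intro l A
    rw [← Matrix.mul_assoc, Matrix.mul_assoc A, nonsing_inv_mul _ hx.isUnit, Matrix.mul_one]
  conv_lhs => rw [siegelShift, h, siegelShift_tau hS hx]
  rw [h1, siegelShift, h1, ← siegelShift]

/-- The cocycle relation of the quadratic forms. -/
theorem shiftQuad_siegelShift (hS : S.IsSymm) (hx : (1 + S * x.1.1).det ≠ 0)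
    (hx' : (1 + (S + S') * x.1.1).det ≠ 0) :
    shiftQuad S' (siegelShift S x) = shiftQuad (S + S') x - shiftQuad S x := by
  have hτ : x.1.1ᵀ = x.1.1 := x.1.2
  have h : (1 + S' * (siegelShift S x).1.1)⁻¹ = (1 + S * x.1.1) * (1 + (S + S') * x.1.1)⁻¹ := by
    rw [one_add_mul_siegelShift hS hx, Matrix.mul_inv_rev, nonsing_inv_nonsing_inv _ hx.isUnit]
  have h2 : (siegelShift S x).2 = x.2 * (1 + S * x.1.1)⁻¹ := rfl
  have hu' : IsUnit (1 + x.1.1 * S).det := by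
    rwa [det_one_add_mul_comm, isUnit_iff_ne_zero]
  have e1 : ((1 + S * x.1.1)⁻¹)ᵀ = (1 + x.1.1 * S)⁻¹ := by
    rw [transpose_nonsing_inv, transpose_add, transpose_mul, transpose_one, hτ, hS.eq]
  have e2 : (1 + S * x.1.1)⁻¹ * S = S * (1 + x.1.1 * S)⁻¹ := by
    calc (1 + S * x.1.1)⁻¹ * S = (1 + S * x.1.1)⁻¹ * (S * (1 + x.1.1 * S)) * (1 + x.1.1 * S)⁻¹ := by
          rw [Matrix.mul_assoc, Matrix.mul_assoc S, mul_nonsing_inv _ hu', Matrix.mul_one]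
      _ = (1 + S * x.1.1)⁻¹ * ((1 + S * x.1.1) * S) * (1 + x.1.1 * S)⁻¹ := by
          congr 2
          simp only [Matrix.mul_add, Matrix.add_mul, Matrix.mul_assoc, Matrix.one_mul,
            Matrix.mul_one]
      _ = _ := by rw [← Matrix.mul_assoc, nonsing_inv_mul _ hx.isUnit, Matrix.one_mul]
  have e3 : (1 + (S + S') * x.1.1)⁻¹ * S' * (1 + x.1.1 * S)⁻¹
      = (1 + (S + S') * x.1.1)⁻¹ * (S + S') - (1 + S * x.1.1)⁻¹ * S := by
    calc _ = (1 + (S + S') * x.1.1)⁻¹ * ((S + S') * (1 + x.1.1 * S)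
            - (1 + (S + S') * x.1.1) * S) * (1 + x.1.1 * S)⁻¹ := by
          congr 2
          simp only [Matrix.mul_add, Matrix.add_mul, Matrix.mul_assoc, Matrix.one_mul,
            Matrix.mul_one]
          abel
      _ = _ := by
          rw [Matrix.mul_sub, Matrix.sub_mul, ← Matrix.mul_assoc _ _ S,
            nonsing_inv_mul _ hx'.isUnit, Matrix.one_mul, ← Matrix.mul_assoc,
            mul_nonsing_inv_cancel_right _ _ hu', e2]
  rw [shiftQuad, h, h2, transpose_mul, e1]
  calc _ = x.2 * ((1 + S * x.1.1)⁻¹ * (1 + S * x.1.1))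
        * ((1 + (S + S') * x.1.1)⁻¹ * S' * (1 + x.1.1 * S)⁻¹) * x.2ᵀ := by
        simp only [Matrix.mul_assoc]
    _ = _ := by
        rw [nonsing_inv_mul _ hx.isUnit, Matrix.mul_one, e3, Matrix.mul_sub, Matrix.sub_mul,
          shiftQuad, shiftQuad]
        simp only [Matrix.mul_assoc]

end GroupLaw

end Shift

section ShiftAnalytic

variable {n j : ℕ} {E : Type*} [NormedAddCommGroup E] [NormedSpace ℂ E]
  {S : E → Matrix (Fin n) (Fin n) ℂ} {f : E → JacSpace n j} {p : E}

theorem matAnalyticAt_one_add_mul (hS : MatAnalyticAt S p) (hf : AnalyticAt ℂ f p) :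
    MatAnalyticAt (fun x => 1 + S x * (f x).1.1) p :=
  (MatAnalyticAt.const 1).add (hS.mul (matAnalyticAt_tau hf))

theorem analyticAt_siegelShift (hS : MatAnalyticAt S p) (hf : AnalyticAt ℂ f p)
    (h : (1 + S p * (f p).1.1).det ≠ 0) : AnalyticAt ℂ (fun x => siegelShift (S x) (f x)) p :=
  analyticAt_jacSpace
    ((matAnalyticAt_tau hf).mul ((matAnalyticAt_one_add_mul hS hf).inv h))
    ((matAnalyticAt_z hf).mul ((matAnalyticAt_one_add_mul hS hf).inv h))

theorem matAnalyticAt_shiftQuad (hS : MatAnalyticAt S p) (hf : AnalyticAt ℂ f p)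
    (h : (1 + S p * (f p).1.1).det ≠ 0) : MatAnalyticAt (fun x => shiftQuad (S x) (f x)) p :=
  (((matAnalyticAt_z hf).mul ((matAnalyticAt_one_add_mul hS hf).inv h)).mul hS).mul
    (matAnalyticAt_z hf).transpose

theorem analyticAt_shiftFactor (κ : ℂ) (N : Matrix (Fin j) (Fin j) ℂ) (hS : MatAnalyticAt S p)
    (hf : AnalyticAt ℂ f p) (h : (1 + S p * (f p).1.1).det ∈ Complex.slitPlane) :
    AnalyticAt ℂ (fun x => shiftFactor κ N (S x) (f x)) p := by
  have h0 := Complex.slitPlane_ne_zero h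
  refine ((matAnalyticAt_one_add_mul hS hf).det.cpow analyticAt_const h).mul (AnalyticAt.cexp ?_)
  exact (analyticAt_const.mul
    ((MatAnalyticAt.const N).mul (matAnalyticAt_shiftQuad hS hf h0)).trace).neg

end ShiftAnalytic

section ShiftFlow

variable {n j : ℕ}

theorem hasDerivAt_det_one_sub_smul (A : Matrix (Fin n) (Fin n) ℂ) :
    HasDerivAt (fun θ : ℂ => (1 + (-θ) • A).det) (-A.trace) 0 := by
  obtain ⟨P, hP⟩ : ∃ P : Polynomial ℂ, ∀ θ : ℂ,
      (1 + (-θ) • A).det = 1 + A.trace * -θ + P.eval (-θ) * (-θ) ^ 2 :=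
    ⟨_, fun θ => det_one_add_smul (-θ) A⟩
  simp only [hP]
  have h1 : HasDerivAt (fun θ : ℂ => -θ) (-1) 0 := hasDerivAt_neg 0
  have h2 := (P.hasDerivAt (-0)).comp (0 : ℂ) h1
  refine (((h1.const_mul A.trace).const_add 1).add (h2.mul (h1.pow 2))).congr_deriv ?_
  simp

/-- The function `f`, transformed by `siegelShift (s S)` in weight `κ / 2` and index `N`, as a
function of the parameter `s` and of `(τ, z)`. -/
noncomputable def shiftFamily (κ : ℂ) (N : Matrix (Fin j) (Fin j) ℂ)
    (S : Matrix (Fin n) (Fin n) ℂ) (f : JacSpace n j → ℂ) (p : ℂ × JacSpace n j) : ℂ :=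
  shiftFactor κ N (p.1 • S) p.2 * f (siegelShift (p.1 • S) p.2)

/-- By the group law, the point `siegelShift ((s + θ) S) (siegelShift (-θ S) x)` does not depend on
`θ`; the factor of automorphy is the only part of `shiftFamily` that varies along this curve. -/
theorem shiftFamily_curve (κ : ℂ) (N : Matrix (Fin j) (Fin j) ℂ)
    {S : Matrix (Fin n) (Fin n) ℂ} (hS : S.IsSymm) (f : JacSpace n j → ℂ) (s θ : ℂ)
    (x : JacSpace n j) (hs : (1 + s • S * x.1.1).det ≠ 0) (hθ : (1 + -θ • S * x.1.1).det ≠ 0) :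
    shiftFamily κ N S f (s + θ, siegelShift (-θ • S) x)
      = ((1 + s • S * x.1.1).det / (1 + -θ • S * x.1.1).det) ^ (-κ / 2)
        * Complex.exp (-(2 * Real.pi * Complex.I * (N * shiftQuad (s • S) x).trace)
          - 2 * Real.pi * Complex.I * (N * (x.2 * (1 + -θ • S * x.1.1)⁻¹ * S * x.2ᵀ)).trace * θ)
        * f (siegelShift (s • S) x) := by
  have hS' : (-θ • S).IsSymm := hS.smul _
  have e : -θ • S + (s + θ) • S = s • S := by module
  rw [shiftFamily]
  dsimp only
  rw [shiftFactor, siegelShift_siegelShift hS' hθ, e, one_add_mul_siegelShift hS' hθ,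
    shiftQuad_siegelShift hS' hθ (by rwa [e]), e, det_mul, det_nonsing_inv, Ring.inverse_eq_inv',
    ← div_eq_mul_inv]
  congr 3
  simp only [shiftQuad, Matrix.mul_sub, trace_sub, Matrix.mul_smul, Matrix.smul_mul, trace_smul,
    smul_eq_mul]
  ring

theorem hasDerivAt_shiftFamily_curve (κ : ℂ) (N : Matrix (Fin j) (Fin j) ℂ)
    (S : Matrix (Fin n) (Fin n) ℂ) (c d : ℂ) (D : ℂ) (x : JacSpace n j)
    (hD : D ∈ Complex.slitPlane) :
    HasDerivAt (fun θ : ℂ => (D / (1 + -θ • S * x.1.1).det) ^ (-κ / 2)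
        * Complex.exp (c
          - 2 * Real.pi * Complex.I * (N * (x.2 * (1 + -θ • S * x.1.1)⁻¹ * S * x.2ᵀ)).trace * θ)
        * d) 
      (-(κ / 2 * (S * x.1.1).trace + 2 * Real.pi * Complex.I * (N * (x.2 * S * x.2ᵀ)).trace)
        * (D ^ (-κ / 2) * Complex.exp c * d)) 0 := by
  have h1 : HasDerivAt (fun θ : ℂ => (1 + -θ • S * x.1.1).det) (-(S * x.1.1).trace) 0 := by
    simpa only [Matrix.smul_mul] using hasDerivAt_det_one_sub_smul (S * x.1.1)
  have h0 : (1 + -(0:ℂ) • S * x.1.1).det = 1 := by simp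
  have hm : MatAnalyticAt (fun θ : ℂ => 1 + -θ • S * x.1.1) 0 :=
    (MatAnalyticAt.const 1).add ((MatAnalyticAt.smul analyticAt_id.neg (.const S)).mul (.const _))
  have h2 : AnalyticAt ℂ (fun θ : ℂ =>
      (N * (x.2 * (1 + -θ • S * x.1.1)⁻¹ * S * x.2ᵀ)).trace) 0 :=
    ((MatAnalyticAt.const N).mul ((((MatAnalyticAt.const x.2).mul
      (hm.inv (by rw [h0]; exact one_ne_zero))).mul (.const S)).mul (.const _))).trace
  have h3 := ((h2.differentiableAt.hasDerivAt.const_mul (2 * Real.pi * Complex.I)).mul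
    (hasDerivAt_id (0 : ℂ))).const_sub c
  have h4 := (((hasDerivAt_const (0:ℂ) D).fun_div h1 (by rw [h0]; exact one_ne_zero)).cpow_const
    (c := -κ / 2) (by simpa only [h0, div_one] using hD)).mul h3.cexp
  have hD0 := Complex.slitPlane_ne_zero hD
  refine (h4.mul_const d).congr_deriv ?_
  simp only [Pi.mul_apply, id, mul_zero, mul_one, zero_sub, zero_add, sub_zero, neg_zero, zero_smul,
    add_zero, inv_one, Matrix.mul_one, zero_mul, det_one, div_one, one_pow]
  rw [Complex.cpow_sub _ _ hD0, Complex.cpow_one]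
  field_simp
  ring

theorem analyticAt_shiftFamily (κ : ℂ) (N : Matrix (Fin j) (Fin j) ℂ)
    (S : Matrix (Fin n) (Fin n) ℂ) {f : JacSpace n j → ℂ} {p : ℂ × JacSpace n j}
    (hp : (1 + p.1 • S * p.2.1.1).det ∈ Complex.slitPlane)
    (hf : AnalyticAt ℂ f (siegelShift (p.1 • S) p.2)) :
    AnalyticAt ℂ (shiftFamily κ N S f) p := by
  have hS : MatAnalyticAt (fun p : ℂ × JacSpace n j => p.1 • S) p :=
    .smul analyticAt_fst (.const S)
  refine (analyticAt_shiftFactor κ N hS analyticAt_snd hp).mul ?_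
  exact AnalyticAt.comp (f := fun p : ℂ × JacSpace n j => siegelShift (p.1 • S) p.2) hf
    (analyticAt_siegelShift hS analyticAt_snd (Complex.slitPlane_ne_zero hp))

theorem siegelShift_eq_add_smul {S : Matrix (Fin n) (Fin n) ℂ} (θ : ℂ) {x : JacSpace n j}
    (hθ : (1 + -θ • S * x.1.1).det ≠ 0) :
    siegelShift (-θ • S) x = x + θ • (symProj n (x.1.1 * S * x.1.1 * (1 + -θ • S * x.1.1)⁻¹),
      x.2 * S * x.1.1 * (1 + -θ • S * x.1.1)⁻¹) := by
  have h : (1 + -θ • S * x.1.1)⁻¹ = 1 + θ • (S * x.1.1 * (1 + -θ • S * x.1.1)⁻¹) := by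
    have h1 := mul_nonsing_inv _ hθ.isUnit
    rw [Matrix.add_mul, Matrix.one_mul] at h1
    refine (eq_sub_of_add_eq h1).trans ?_
    simp only [Matrix.smul_mul, neg_smul, sub_neg_eq_add, Matrix.neg_mul]
  refine Prod.ext ?_ ?_
  · show symProj n _ = x.1 + θ • symProj n _
    conv_lhs => rw [h, Matrix.mul_add, Matrix.mul_one, Matrix.mul_smul, map_add, map_smul]
    simp only [Matrix.mul_assoc]
    congr 1
    exact Subtype.ext (symProj_apply x.1.2)
  · show x.2 * _ = x.2 + θ • _
    conv_lhs => rw [h, Matrix.mul_add, Matrix.mul_one, Matrix.mul_smul]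
    simp only [Matrix.mul_assoc]

/-- The family `shiftFamily` moves by the infinitesimal action of `siegelField`. -/
theorem fderiv_shiftFamily (κ : ℂ) (N : Matrix (Fin j) (Fin j) ℂ)
    {S : Matrix (Fin n) (Fin n) ℂ} (hS : S.IsSymm) {f : JacSpace n j → ℂ} {p : ℂ × JacSpace n j}
    (hp : (1 + p.1 • S * p.2.1.1).det ∈ Complex.slitPlane)
    (hf : AnalyticAt ℂ f (siegelShift (p.1 • S) p.2)) :
    fderiv ℂ (shiftFamily κ N S f) p (1, siegelField hS p.2)
      = -(κ / 2 * (S * p.2.1.1).trace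
          + 2 * Real.pi * Complex.I * (N * (p.2.2 * S * p.2.2ᵀ)).trace)
        * shiftFamily κ N S f p := by
  obtain ⟨s, x⟩ := p
  have hm : MatAnalyticAt (fun θ : ℂ => 1 + -θ • S * x.1.1) 0 :=
    (MatAnalyticAt.const 1).add ((MatAnalyticAt.smul analyticAt_id.neg (.const S)).mul (.const _))
  have h0 : (1 + -(0 : ℂ) • S * x.1.1).det ≠ 0 := by simp
  have hd : AnalyticAt ℂ (fun θ : ℂ => ((1 : ℂ),
      (symProj n (x.1.1 * S * x.1.1 * (1 + -θ • S * x.1.1)⁻¹),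
        x.2 * S * x.1.1 * (1 + -θ • S * x.1.1)⁻¹))) 0 :=
    analyticAt_const.prod (analyticAt_jacSpace ((MatAnalyticAt.const _).mul (hm.inv h0))
      ((MatAnalyticAt.const _).mul (hm.inv h0)))
  have hv : ((1 : ℂ), siegelField hS x) = ((1 : ℂ),
      (symProj n (x.1.1 * S * x.1.1 * (1 + -(0 : ℂ) • S * x.1.1)⁻¹),
        x.2 * S * x.1.1 * (1 + -(0 : ℂ) • S * x.1.1)⁻¹)) := by
    simp only [neg_zero, zero_smul, Matrix.zero_mul, add_zero, inv_one, Matrix.mul_one]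
    refine Prod.ext rfl (Prod.ext ?_ rfl)
    exact Subtype.ext (symProj_apply (siegelField hS x).1.2).symm
  rw [hv]
  refine fderiv_apply_of_curve (analyticAt_shiftFamily κ N S hp hf) hd
    (hasDerivAt_shiftFamily_curve κ N S _ (f (siegelShift (s • S) x)) _ x hp) ?_
  filter_upwards [hm.det.continuousAt.eventually_ne h0] with θ hθ
  rw [← shiftFamily_curve κ N hS f s θ x (Complex.slitPlane_ne_zero hp) hθ,
    siegelShift_eq_add_smul θ hθ]
  congr 1
  refine Prod.ext ?_ rfl
  simp

/-- The transformation law of the powers of the heat operator under `siegelShift S`, at the fixed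
point `(0, w)`. -/
theorem heatOp_iterate_siegelShift {M : Matrix (Fin j) (Fin j) ℝ} (hM : M.PosDef)
    {S : Matrix (Fin n) (Fin n) ℂ} (hS : S.IsSymm) (r : ℕ) (w : Matrix (Fin j) (Fin n) ℂ)
    {f : JacSpace n j → ℂ} (hf : AnalyticAt ℂ f (0, w)) :
    (heatOp M)^[r] (fun x => shiftFactor (n + j + 1 - 2 * r) (toC M) S x * f (siegelShift S x))
        (0, w)
      = Complex.exp (-(2 * Real.pi * Complex.I * (toC M * (w * S * wᵀ)).trace))
        * (heatOp M)^[r] f (0, w) := by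
  have hp : ∀ (s : ℂ) (y : JacSpace n j),
      s • ((1 : ℂ), (0 : JacSpace n j)) + ((0 : ℂ), y) = (s, y) :=
    fun s y => by
      refine Prod.ext ?_ ?_ <;> simp
  have h := heatOp_iterate_flow (E := ℂ × JacSpace n j)
    (ι := ContinuousLinearMap.inr ℂ ℂ (JacSpace n j))
    (π := ContinuousLinearMap.snd ℂ ℂ (JacSpace n j))
    (fun _ => rfl) (e := (1, 0)) rfl hM hS r w (F := shiftFamily (n + j + 1 - 2 * r) (toC M) S f)
    (fun s => ?_)
  · replace h : (heatOp M)^[r] (fun y => shiftFamily (n + j + 1 - 2 * r) (toC M) S f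
          ((1 : ℂ) • ((1 : ℂ), (0 : JacSpace n j)) + ((0 : ℂ), y))) (0, w)
        = Complex.exp (-(2 * Real.pi * Complex.I * (toC M * (w * S * wᵀ)).trace))
          * (heatOp M)^[r] (fun y => shiftFamily (n + j + 1 - 2 * r) (toC M) S f
          ((0 : ℂ) • ((1 : ℂ), (0 : JacSpace n j)) + ((0 : ℂ), y))) (0, w) := h
    simp only [hp] at h
    have h1 : (fun y => shiftFamily (n + j + 1 - 2 * r) (toC M) S f (1, y)) = fun x =>
        shiftFactor (n + j + 1 - 2 * r) (toC M) S x * f (siegelShift S x) :=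
      funext fun y => by simp only [shiftFamily, one_smul]
    have h2 : (fun y => shiftFamily (n + j + 1 - 2 * r) (toC M) S f (0, y)) = f := by
      funext y
      have : siegelShift (0 : Matrix (Fin n) (Fin n) ℂ) y = y := by
        refine Prod.ext (Subtype.ext ?_) ?_
        · rw [siegelShift_tau isSymm_zero (by simp)]
          simp
        · simp [siegelShift]
      simp [shiftFamily, this, shiftFactor, shiftQuad]
    rw [← h1, h, h2]
  · change ∀ᶠ p : ℂ × JacSpace n j in 𝓝 (s • ((1 : ℂ), (0 : JacSpace n j)) + ((0 : ℂ), (0, w))),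
      AnalyticAt ℂ (shiftFamily (n + j + 1 - 2 * r) (toC M) S f) p ∧
      fderiv ℂ (shiftFamily (n + j + 1 - 2 * r) (toC M) S f) p
          (((1 : ℂ), (0 : JacSpace n j)) + ((0 : ℂ), siegelField hS p.2))
        = -((n + j + 1 - 2 * r) / 2 * (S * p.2.1.1).trace
          + 2 * Real.pi * Complex.I * (toC M * (p.2.2 * S * p.2.2ᵀ)).trace)
          * shiftFamily (n + j + 1 - 2 * r) (toC M) S f p
    rw [hp]
    have hS' : MatAnalyticAt (fun p : ℂ × JacSpace n j => p.1 • S) (s, (0, w)) :=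
      .smul analyticAt_fst (.const S)
    have h0 : (1 + s • S * ((0, w) : JacSpace n j).1.1).det = 1 := by simp
    have h1 : siegelShift (s • S) (0, w) = (0, w) := by
      refine Prod.ext (Subtype.ext ?_) ?_
      · rw [siegelShift_tau (hS.smul s) (by rw [h0]; exact one_ne_zero)]
        simp
      · simp [siegelShift]
    have h2 : ∀ᶠ p : ℂ × JacSpace n j in 𝓝 (s, (0, w)),
        (1 + p.1 • S * p.2.1.1).det ∈ Complex.slitPlane :=
      (matAnalyticAt_one_add_mul hS' analyticAt_snd).det.continuousAt.eventually
        (Complex.isOpen_slitPlane.mem_nhds (by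
          dsimp only
          rw [h0]
          exact Complex.one_mem_slitPlane))
    have h3 : ∀ᶠ p : ℂ × JacSpace n j in 𝓝 (s, (0, w)),
        AnalyticAt ℂ f (siegelShift (p.1 • S) p.2) := by
      refine (analyticAt_siegelShift hS' analyticAt_snd
        (by rw [h0]; exact one_ne_zero)).continuousAt.eventually (p := fun y => AnalyticAt ℂ f y) ?_
      dsimp only
      rw [h1]
      exact hf.eventually_analyticAt
    filter_upwards [h2, h3] with p hp1 hp2
    refine ⟨analyticAt_shiftFamily _ _ S hp1 hp2, ?_⟩
    rw [← fderiv_shiftFamily _ _ hS hp1 hp2]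
    congr 1
    refine Prod.ext ?_ ?_ <;> simp

end ShiftFlow

/-! ### The local transformation law -/

section Local

variable {n j : ℕ}

theorem siegelUpper_isOpen (n : ℕ) : IsOpen (siegelUpper n) := by
  rw [isOpen_iff_mem_nhds]
  intro τ hτ
  have hK : IsCompact (Metric.sphere (0 : Fin n → ℝ) 1) := isCompact_sphere 0 1
  have hc : Continuous fun p : symMat n × (Fin n → ℝ) =>
      p.2 ⬝ᵥ (p.1.1.map Complex.im *ᵥ p.2) := by
    refine Continuous.dotProduct continuous_snd (Continuous.matrix_mulVec ?_ continuous_snd)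
    exact (continuous_subtype_val.comp continuous_fst).matrix_map Complex.continuous_im
  have h := hK.eventually_forall_of_forall_eventually (x₀ := τ)
    (P := fun σ v => 0 < v ⬝ᵥ (σ.1.map Complex.im *ᵥ v)) fun v hv => by
      refine hc.continuousAt.eventually (lt_mem_nhds ?_)
      have : v ≠ 0 := by
        rintro rfl
        simp at hv
      simpa using (hτ : PosDef _).dotProduct_mulVec_pos this
  filter_upwards [h] with σ hσ
  refine PosDef.of_dotProduct_mulVec_pos ?_ fun v hv => ?_
  · ext a b
    have : σ.1 b a = σ.1 a b := congrFun (congrFun σ.2 a) b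
    simp [this]
  · have hv' : ‖v‖ ≠ 0 := norm_ne_zero_iff.2 hv
    have h1 := hσ (‖v‖⁻¹ • v) (by simp [norm_smul, hv'])
    rw [mulVec_smul, smul_dotProduct, dotProduct_smul, smul_eq_mul, smul_eq_mul, ← mul_assoc] at h1
    have h2 : 0 < ‖v‖⁻¹ * ‖v‖⁻¹ := by positivity
    simpa using (mul_pos_iff_of_pos_left h2).1 h1

theorem jacDomain_isOpen (n j : ℕ) : IsOpen (jacDomain n j) :=
  (siegelUpper_isOpen n).preimage continuous_fst

/-- The matrix `(C τ + D)⁻¹ C`; it is symmetric for `τ` in the Siegel upper half-space. -/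
noncomputable def autS (g : symplecticGroup (Fin n) ℝ) (τ : symMat n) :
    Matrix (Fin n) (Fin n) ℂ :=
  (autDenom g τ)⁻¹ * toC g.1.toBlocks₂₁

theorem autS_isSymm (g : symplecticGroup (Fin n) ℝ) {τ : symMat n} (hτ : τ ∈ siegelUpper n) :
    (autS g τ).IsSymm := by
  have h := (symplectic_relations ⟨g.1ᵀ, SymplecticGroup.transpose_mem g.2⟩).2.1
  replace h : toC g.1.toBlocks₂₁ * (toC g.1.toBlocks₂₂)ᵀ
    = toC g.1.toBlocks₂₂ * (toC g.1.toBlocks₂₁)ᵀ := h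
  have hs : τ.1ᵀ = τ.1 := τ.2
  have hd : IsUnit (autDenom g τ).det := (det_autDenom_ne_zero g hτ).isUnit
  have hd' : IsUnit (autDenom g τ)ᵀ.det := by rwa [det_transpose]
  have key : toC g.1.toBlocks₂₁ * (autDenom g τ)ᵀ = autDenom g τ * (toC g.1.toBlocks₂₁)ᵀ := by
    simp only [autDenom, transpose_add, transpose_mul, hs, Matrix.mul_add, Matrix.add_mul, h,
      Matrix.mul_assoc]
  rw [autS, IsSymm, transpose_mul, transpose_nonsing_inv]
  calc (toC g.1.toBlocks₂₁)ᵀ * (autDenom g τ)ᵀ⁻¹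
      = (autDenom g τ)⁻¹ * (autDenom g τ * (toC g.1.toBlocks₂₁)ᵀ) * (autDenom g τ)ᵀ⁻¹ := by
        rw [← Matrix.mul_assoc, nonsing_inv_mul _ hd, Matrix.one_mul]
    _ = _ := by
        rw [← key, Matrix.mul_assoc, Matrix.mul_assoc, mul_nonsing_inv _ hd', Matrix.mul_one]

theorem one_add_autS_mul (g : symplecticGroup (Fin n) ℝ) {τ₀ : symMat n}
    (hτ₀ : τ₀ ∈ siegelUpper n) (τ : symMat n) :
    1 + autS g τ₀ * (τ - τ₀).1 = (autDenom g τ₀)⁻¹ * autDenom g τ := by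
  have hd : IsUnit (autDenom g τ₀).det := (det_autDenom_ne_zero g hτ₀).isUnit
  have : autDenom g τ = autDenom g τ₀ + toC g.1.toBlocks₂₁ * (τ - τ₀).1 := by
    simp only [autDenom, Submodule.coe_sub, Matrix.mul_sub]
    abel
  rw [this, Matrix.mul_add, nonsing_inv_mul _ hd, autS, Matrix.mul_assoc]

theorem spAct_eq (g : symplecticGroup (Fin n) ℝ) {τ₀ τ : symMat n} (hτ₀ : τ₀ ∈ siegelUpper n)
    (hτ : τ ∈ siegelUpper n) :
    (spAct g τ).1 = (autDenom g τ₀)⁻¹ᵀ * (τ - τ₀).1 * ((autDenom g τ)⁻¹ * autDenom g τ₀)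
      * (autDenom g τ₀)⁻¹ + (spAct g τ₀).1 := by
  obtain ⟨h1, h2, h3, h4⟩ := symplectic_relations g
  have hs : τ₀.1ᵀ = τ₀.1 := τ₀.2
  have hd₀ : IsUnit (autDenom g τ₀).det := (det_autDenom_ne_zero g hτ₀).isUnit
  have hd₀' : IsUnit (autDenom g τ₀)ᵀ.det := by rwa [det_transpose]
  have hd : IsUnit (autDenom g τ).det := (det_autDenom_ne_zero g hτ).isUnit
  have key : 1 + (autNum g τ₀)ᵀ * toC g.1.toBlocks₂₁ = (autDenom g τ₀)ᵀ * toC g.1.toBlocks₁₁ := by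
    simp only [autDenom, autNum, transpose_add, transpose_mul, hs, Matrix.add_mul, h4,
      Matrix.mul_assoc, h1]
    abel
  -- the decomposition of the block `A` that belongs to the big Bruhat cell
  have hA : (autDenom g τ₀)⁻¹ᵀ + (spAct g τ₀).1 * toC g.1.toBlocks₂₁ = toC g.1.toBlocks₁₁ := by
    have : (spAct g τ₀).1 = (autDenom g τ₀)ᵀ⁻¹ * (autNum g τ₀)ᵀ := by
      have h : (spAct g τ₀).1ᵀ = (spAct g τ₀).1 := (spAct g τ₀).2
      rw [← h, ← transpose_nonsing_inv, ← transpose_mul]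
      rfl
    rw [this, transpose_nonsing_inv, Matrix.mul_assoc]
    calc _ = (autDenom g τ₀)ᵀ⁻¹ * (1 + (autNum g τ₀)ᵀ * toC g.1.toBlocks₂₁) := by
          rw [Matrix.mul_add, Matrix.mul_one]
      _ = _ := by rw [key, ← Matrix.mul_assoc, nonsing_inv_mul _ hd₀', Matrix.one_mul]
  have hQ : autDenom g τ = autDenom g τ₀ + toC g.1.toBlocks₂₁ * (τ - τ₀).1 := by
    simp only [autDenom, Submodule.coe_sub, Matrix.mul_sub]
    abel
  have hN : autNum g τ = autNum g τ₀ + toC g.1.toBlocks₁₁ * (τ - τ₀).1 := by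
    simp only [autNum, Submodule.coe_sub, Matrix.mul_sub]
    abel
  have hP : (spAct g τ₀).1 * autDenom g τ₀ = autNum g τ₀ := by
    show autNum g τ₀ * (autDenom g τ₀)⁻¹ * autDenom g τ₀ = _
    rw [Matrix.mul_assoc, nonsing_inv_mul _ hd₀, Matrix.mul_one]
  have e : autNum g τ = (autDenom g τ₀)⁻¹ᵀ * (τ - τ₀).1 + (spAct g τ₀).1 * autDenom g τ := by
    rw [hN, ← hA, hQ, Matrix.mul_add, hP, Matrix.add_mul, Matrix.mul_assoc (spAct g τ₀).1]
    abel
  show autNum g τ * (autDenom g τ)⁻¹ = _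
  rw [e, Matrix.add_mul, Matrix.mul_assoc (spAct g τ₀).1, mul_nonsing_inv _ hd, Matrix.mul_one,
    Matrix.mul_assoc _ _ (autDenom g τ₀)⁻¹, Matrix.mul_assoc _ (autDenom g τ₀),
    mul_nonsing_inv _ hd₀, Matrix.mul_one]

/-- The vector by which the Heisenberg part of `γ`, followed by the translation by `-τ₀`, moves
the origin. -/
noncomputable def heisVec (γ : jacobiGroup n j) (τ₀ : symMat n) : JacSpace n j :=
  (-τ₀, toC (uPart γ))

theorem affLin_one_add (γ : jacobiGroup n j) (τ₀ : symMat n) (x : JacSpace n j) :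
    affLin 1 (toC (vPart γ)) x + heisVec γ τ₀
      = (x.1 - τ₀, x.2 + toC (uPart γ) + toC (vPart γ) * x.1.1) := by
  rw [affLin_apply]
  refine Prod.ext (Subtype.ext ?_) ?_
  · simp [heisVec, sub_eq_add_neg]
  · simp [heisVec]
    abel

theorem inv_one_add_autS_mul (g : symplecticGroup (Fin n) ℝ) {τ₀ : symMat n}
    (hτ₀ : τ₀ ∈ siegelUpper n) (τ : symMat n) :
    (1 + autS g τ₀ * (τ - τ₀).1)⁻¹ = (autDenom g τ)⁻¹ * autDenom g τ₀ := by
  rw [one_add_autS_mul g hτ₀, Matrix.mul_inv_rev,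
    nonsing_inv_nonsing_inv _ (det_autDenom_ne_zero g hτ₀).isUnit]

theorem det_one_add_autS_mul (g : symplecticGroup (Fin n) ℝ) {τ₀ : symMat n}
    (hτ₀ : τ₀ ∈ siegelUpper n) (τ : symMat n) :
    (1 + autS g τ₀ * (τ - τ₀).1).det = (autDenom g τ).det / (autDenom g τ₀).det := by
  rw [one_add_autS_mul g hτ₀, det_mul, det_nonsing_inv, Ring.inverse_eq_inv', div_eq_inv_mul]

/-- Near a point with first component `τ₀`, the action of `γ` is a composition of an affine map,
a Siegel translation that fixes the image of the point, and another affine map. -/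
theorem jacAct_eq (γ : jacobiGroup n j) {τ₀ : symMat n} (hτ₀ : τ₀ ∈ siegelUpper n)
    {x : JacSpace n j} (hx : x ∈ jacDomain n j) :
    jacAct γ x = affLin (autDenom (spPart γ) τ₀)⁻¹ 0 (siegelShift (autS (spPart γ) τ₀)
        (affLin 1 (toC (vPart γ)) x + heisVec γ τ₀)) + (spAct (spPart γ) τ₀, 0) := by
  rw [affLin_one_add, affLin_apply]
  have hd : (1 + autS (spPart γ) τ₀ * (x.1 - τ₀).1).det ≠ 0 := by
    rw [det_one_add_autS_mul _ hτ₀]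
    exact div_ne_zero (det_autDenom_ne_zero _ hx) (det_autDenom_ne_zero _ hτ₀)
  refine Prod.ext (Subtype.ext ?_) ?_
  · refine (spAct_eq (spPart γ) hτ₀ hx).trans ?_
    rw [Prod.fst_add, Submodule.coe_add]
    dsimp only
    rw [siegelShift_tau (x := (x.1 - τ₀, x.2 + toC (uPart γ) + toC (vPart γ) * x.1.1))
      (autS_isSymm _ hτ₀) hd, inv_one_add_autS_mul _ hτ₀]
    simp only [Matrix.mul_assoc]
  · have e : ∀ W : Matrix (Fin j) (Fin n) ℂ, W * ((autDenom (spPart γ) x.1)⁻¹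
        * autDenom (spPart γ) τ₀) * (autDenom (spPart γ) τ₀)⁻¹
        = W * (autDenom (spPart γ) x.1)⁻¹ := fun W => by
      rw [← Matrix.mul_assoc, mul_nonsing_inv_cancel_right _ _ (det_autDenom_ne_zero _ hτ₀).isUnit]
    rw [Prod.snd_add]
    simp only [siegelShift, inv_one_add_autS_mul _ hτ₀, Matrix.zero_mul, add_zero]
    exact (e _).symm

theorem continuous_autDenom (g : symplecticGroup (Fin n) ℝ) : Continuous (autDenom g) :=
  (Continuous.matrix_mul continuous_const continuous_subtype_val).add continuous_const

theorem SqrtBranch.ne_zero (J : SqrtBranch n) (g : symplecticGroup (Fin n) ℝ) {τ : symMat n}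
    (hτ : τ ∈ siegelUpper n) : J.toFun g τ ≠ 0 := fun h => by
  have := J.sq_toFun g τ hτ
  rw [h, zero_pow two_ne_zero] at this
  exact inv_ne_zero (det_autDenom_ne_zero g hτ) this.symm

/-- A chosen branch of the square root agrees locally, up to a constant, with the principal
branch of `det (1 + S (τ - τ₀)) ^ (-1/2)`. -/
theorem SqrtBranch.eventually_eq (J : SqrtBranch n) (g : symplecticGroup (Fin n) ℝ)
    {τ₀ : symMat n} (hτ₀ : τ₀ ∈ siegelUpper n) :
    ∀ᶠ τ in 𝓝 τ₀, J.toFun g τ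
      = J.toFun g τ₀ * (1 + autS g τ₀ * (τ - τ₀).1).det ^ (-1 / 2 : ℂ) := by
  set D : symMat n → ℂ := fun τ => (1 + autS g τ₀ * (τ - τ₀).1).det with hD
  have hD' : ∀ τ, D τ = (autDenom g τ).det / (autDenom g τ₀).det :=
    fun τ => det_one_add_autS_mul g hτ₀ τ
  have hD0 : D τ₀ = 1 := by rw [hD', div_self (det_autDenom_ne_zero g hτ₀)]
  have hDc : Continuous D := by
    simp only [funext hD']
    exact (continuous_autDenom g).matrix_det.div_const _
  have hU := (siegelUpper_isOpen n).mem_nhds hτ₀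
  have hslit : D τ₀ ∈ Complex.slitPlane := by rw [hD0]; exact Complex.one_mem_slitPlane
  have hc : ContinuousAt (fun τ => J.toFun g τ / (J.toFun g τ₀ * D τ ^ (-1 / 2 : ℂ))) τ₀ := by
    refine ((J.continuousOn_toFun g).continuousAt hU).div
      (continuousAt_const.mul (hDc.continuousAt.cpow continuousAt_const hslit)) ?_
    rw [hD0, Complex.one_cpow, mul_one]
    exact J.ne_zero g hτ₀
  have h1 : J.toFun g τ₀ / (J.toFun g τ₀ * D τ₀ ^ (-1 / 2 : ℂ)) ≠ -1 := by
    rw [hD0, Complex.one_cpow, mul_one, div_self (J.ne_zero g hτ₀)]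
    norm_num
  filter_upwards [hU, hc.eventually_ne h1] with τ hτ h2
  have hDτ : D τ ≠ 0 := by
    rw [hD']
    exact div_ne_zero (det_autDenom_ne_zero _ hτ) (det_autDenom_ne_zero _ hτ₀)
  have h3 : D τ ^ (-1 / 2 : ℂ) ≠ 0 := by simp [Complex.cpow_eq_zero_iff, hDτ]
  have h4 : (D τ ^ (-1 / 2 : ℂ)) ^ 2 = (D τ)⁻¹ := by
    rw [← Complex.cpow_nat_mul, ← Complex.cpow_neg_one]
    norm_num
  have h5 : (J.toFun g τ / (J.toFun g τ₀ * D τ ^ (-1 / 2 : ℂ))) ^ 2 = 1 := by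
    rw [div_pow, mul_pow, h4, J.sq_toFun g τ hτ, J.sq_toFun g τ₀ hτ₀, hD']
    have := det_autDenom_ne_zero g hτ
    have := det_autDenom_ne_zero g hτ₀
    field_simp
  have h6 := (sq_eq_one_iff.1 h5).resolve_right h2
  rwa [div_eq_one_iff_eq (mul_ne_zero (J.ne_zero g hτ₀) h3)] at h6

end Local

section Law

open TopologicalSpace

variable {n j : ℕ}

theorem heatOp_iterate_congr_of_analyticAt {E : Type*} [NormedAddCommGroup E] [NormedSpace ℂ E]
    {ι : JacSpace n j →L[ℂ] E} (M : Matrix (Fin j) (Fin j) ℝ) (r : ℕ) {f g : E → ℂ}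
    {x : JacSpace n j} (hf : AnalyticAt ℂ f (0 + ι x)) (h : f =ᶠ[𝓝 (0 + ι x)] g) :
    (heatOp M)^[r] (fun y => f (0 + ι y)) x = (heatOp M)^[r] (fun y => g (0 + ι y)) x := by
  have he : ∀ᶠ y in 𝓝 (0 + ι x), AnalyticAt ℂ f y ∧ f y = g y := hf.eventually_analyticAt.and h
  obtain ⟨U, hU, hUo, hxU⟩ := eventually_nhds_iff.1 he
  have hfU : AnalyticOnNhd ℂ f ((⟨U, hUo⟩ : Opens E) : Set E) := fun y hy => (hU y hy).1
  rw [heatOp_iterate_eq_diffRep (f := holo.mk f hfU) M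
      (fun y hy => (holo.mk_apply hfU hy).symm) r x hxU,
    heatOp_iterate_eq_diffRep (f := holo.mk f hfU) M
      (fun y hy => ((hU _ hy).2.symm.trans (holo.mk_apply hfU hy).symm)) r x hxU]

theorem heatOp_iterate_congr (M : Matrix (Fin j) (Fin j) ℝ) (r : ℕ) {f g : JacSpace n j → ℂ}
    {x : JacSpace n j} (hf : AnalyticAt ℂ f x) (h : ∀ᶠ y in 𝓝 x, f y = g y) :
    (heatOp M)^[r] f x = (heatOp M)^[r] g x := by
  have := heatOp_iterate_congr_of_analyticAt (ι := ContinuousLinearMap.id ℂ (JacSpace n j)) M r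
    (f := f) (g := g) (x := x) ((zero_add x).symm ▸ hf) ((zero_add x).symm ▸ h)
  change (heatOp M)^[r] (fun y => f (0 + y)) x = (heatOp M)^[r] (fun y => g (0 + y)) x at this
  simpa only [zero_add] using this

/-- The exponential part of the factor of automorphy, split along the decomposition of the action in
`jacAct_eq`. -/
theorem expIndex_eq (M : Matrix (Fin j) (Fin j) ℝ) (γ : jacobiGroup n j) {τ₀ : symMat n}
    (hτ₀ : τ₀ ∈ siegelUpper n) (x : JacSpace n j) :
    expIndex M (toC (zetaPart γ)
        + (toC (vPart γ) * x.1.1 + 2 • x.2 + toC (uPart γ)) * (toC (vPart γ))ᵀ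
        - (x.2 + toC (uPart γ) + toC (vPart γ) * x.1.1)
            * (autDenom (spPart γ) x.1)⁻¹ * toC (spPart γ).1.toBlocks₂₁
            * (x.2 + toC (uPart γ) + toC (vPart γ) * x.1.1)ᵀ)
      = expIndex M (toC (zetaPart γ) + toC (uPart γ) * (toC (vPart γ))ᵀ)
        * (Complex.exp (affForm (toC M) (toC (vPart γ)) x)
          * Complex.exp (-(2 * Real.pi * Complex.I * (toC M * shiftQuad (autS (spPart γ) τ₀)
            (affLin 1 (toC (vPart γ)) x + heisVec γ τ₀)).trace))) := by
  have e : shiftQuad (autS (spPart γ) τ₀) (affLin 1 (toC (vPart γ)) x + heisVec γ τ₀)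
      = (x.2 + toC (uPart γ) + toC (vPart γ) * x.1.1)
            * (autDenom (spPart γ) x.1)⁻¹ * toC (spPart γ).1.toBlocks₂₁
            * (x.2 + toC (uPart γ) + toC (vPart γ) * x.1.1)ᵀ := by
    have h : ∀ W : Matrix (Fin j) (Fin n) ℂ, W * ((autDenom (spPart γ) x.1)⁻¹
        * autDenom (spPart γ) τ₀) * autS (spPart γ) τ₀ = W * (autDenom (spPart γ) x.1)⁻¹
          * toC (spPart γ).1.toBlocks₂₁ := fun W => by
      rw [autS, ← Matrix.mul_assoc _ _ (toC _), ← Matrix.mul_assoc W,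
        mul_nonsing_inv_cancel_right _ _ (det_autDenom_ne_zero _ hτ₀).isUnit]
    rw [affLin_one_add, shiftQuad]
    dsimp only
    rw [inv_one_add_autS_mul _ hτ₀, h]
  rw [e, affForm_apply, expIndex, expIndex, ← Complex.exp_add, ← Complex.exp_add]
  congr 1
  simp only [Matrix.mul_add, Matrix.add_mul, Matrix.mul_sub, trace_add, trace_sub]
  ring

theorem jacFactor_eventually_eq (J : SqrtBranch n) (k : ℤ) (M : Matrix (Fin j) (Fin j) ℝ)
    (γ : jacobiGroup n j) {x₀ : JacSpace n j} (hx₀ : x₀ ∈ jacDomain n j) :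
    ∀ᶠ x in 𝓝 x₀, jacFactor J k M γ x
      = J.toFun (spPart γ) x₀.1 ^ k
        * expIndex M (toC (zetaPart γ) + toC (uPart γ) * (toC (vPart γ))ᵀ)
        * (Complex.exp (affForm (toC M) (toC (vPart γ)) x)
          * shiftFactor k (toC M) (autS (spPart γ) x₀.1)
            (affLin 1 (toC (vPart γ)) x + heisVec γ x₀.1)) := by
  have h := continuous_fst.continuousAt.eventually (J.eventually_eq (spPart γ) hx₀)
  filter_upwards [h] with x hx
  rw [jacFactor, hx, expIndex_eq M γ hx₀, shiftFactor, mul_zpow]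
  have h1 : (affLin 1 (toC (vPart γ)) x + heisVec γ x₀.1).1 = x.1 - x₀.1 := by
    rw [affLin_one_add]
  rw [h1, ← Complex.cpow_mul_int, show (-1 / 2 : ℂ) * k = -(k : ℂ) / 2 by ring]
  ring

theorem affForm_zero (N : Matrix (Fin j) (Fin j) ℂ) (x : JacSpace n j) :
    affForm N 0 x = 0 := by
  rw [affForm_apply]
  simp

/-- The transformation law of the powers of the heat operator under an element `γ` of the Jacobi
group, at a single point `x₀`. Since `γ` is decomposed with respect to `x₀`, the matrix `S` of the
Siegel translation need not be real. -/
theorem heatOp_iterate_jacFactor (J : SqrtBranch n) {M : Matrix (Fin j) (Fin j) ℝ}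
    (hM : M.PosDef) (r : ℕ) {k k' : ℤ} (hk : (k : ℂ) = n + j + 1 - 2 * r) (hk' : k' = k + 4 * r)
    (γ : jacobiGroup n j) {x₀ : JacSpace n j} (hx₀ : x₀ ∈ jacDomain n j) {f : JacSpace n j → ℂ}
    (hf : AnalyticAt ℂ f (jacAct γ x₀)) (c : ℂ) :
    (heatOp M)^[r] (fun x => c * (jacFactor J k M γ x * f (jacAct γ x))) x₀
      = c * (jacFactor J k' M γ x₀ * (heatOp M)^[r] f (jacAct γ x₀)) := by
  have hMs : M.IsSymm := by
    have := hM.isHermitian.eq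
    rwa [conjTranspose_eq_transpose_of_trivial] at this
  set g := spPart γ with hg
  set S := autS g x₀.1 with hSd
  have hS : S.IsSymm := autS_isSymm g hx₀
  set Q := autDenom g x₀.1 with hQ
  have hQ0 : Q.det ≠ 0 := det_autDenom_ne_zero g hx₀
  -- near `x₀`, the element `γ` acts as `B (siegelShift S (A x + b)) + d`
  set A := affLin (n := n) (j := j) 1 (toC (vPart γ)) with hA
  set b := heisVec γ x₀.1 with hb
  set B := affLin (n := n) (j := j) Q⁻¹ 0 with hB
  set d : JacSpace n j := (spAct g x₀.1, 0) with hd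
  set w := x₀.2 + toC (uPart γ) + toC (vPart γ) * x₀.1.1 with hw
  set h : JacSpace n j → ℂ := fun y => 1 * (Complex.exp (affForm (toC M) 0 y) * f (B y + d)) with hh
  set G : JacSpace n j → ℂ := fun y => shiftFactor (n + j + 1 - 2 * r) (toC M) S y
    * h (siegelShift S y) with hG
  set K : ℂ := c * (J.toFun g x₀.1 ^ k
    * expIndex M (toC (zetaPart γ) + toC (uPart γ) * (toC (vPart γ))ᵀ)) with hK
  have hAx : A x₀ + b = (0, w) := by rw [hA, hb, affLin_one_add, sub_self]
  have hdet : (1 + S * ((0, w) : JacSpace n j).1.1).det = 1 := by simp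
  have hfix : siegelShift S (0, w) = (0, w) := by
    refine Prod.ext (Subtype.ext ?_) ?_
    · rw [siegelShift_tau hS (by rw [hdet]; exact one_ne_zero)]
      simp
    · simp [siegelShift]
  have hact : ∀ x ∈ jacDomain n j, jacAct γ x = B (siegelShift S (A x + b)) + d :=
    fun x hx => jacAct_eq γ hx₀ hx
  have hBw : B (0, w) + d = jacAct γ x₀ := by rw [hact x₀ hx₀, hAx, hfix]
  have hhan : AnalyticAt ℂ h (0, w) := by
    have h1 : AnalyticAt ℂ (fun y => B y + d) (0, w) :=
      (analyticAt_of_linear (E := JacSpace n j) B.toLinearMap (0, w)).add analyticAt_const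
    have h2 : AnalyticAt ℂ (fun y => f (B y + d)) (0, w) :=
      AnalyticAt.comp (f := fun y => B y + d) (by rwa [hBw]) h1
    have h3 : AnalyticAt ℂ (fun y => affForm (toC M) 0 y) (0, w) :=
      analyticAt_of_linear (E := JacSpace n j) (affForm (toC M) 0).toLinearMap (0, w)
    exact analyticAt_const.mul (h3.cexp.mul h2)
  have hGan : AnalyticAt ℂ G (A x₀ + b) := by
    rw [hAx]
    have hSan : MatAnalyticAt (fun _ : JacSpace n j => S) (0, w) := .const S
    refine (analyticAt_shiftFactor _ _ hSan analyticAt_id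
      (by dsimp only [id]; rw [hdet]; exact Complex.one_mem_slitPlane)).mul ?_
    refine AnalyticAt.comp (f := fun y => siegelShift S y) (by rw [hfix]; exact hhan) ?_
    exact analyticAt_siegelShift hSan analyticAt_id
      (by dsimp only [id]; rw [hdet]; exact one_ne_zero)
  have hfun : AnalyticAt ℂ
      (fun x => K * (Complex.exp (affForm (toC M) (toC (vPart γ)) x) * G (A x + b))) x₀ := by
    have h1 : AnalyticAt ℂ (fun y => A y + b) x₀ :=
      (analyticAt_of_linear (E := JacSpace n j) A.toLinearMap x₀).add analyticAt_const
    have h3 : AnalyticAt ℂ (fun y => affForm (toC M) (toC (vPart γ)) y) x₀ :=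
      analyticAt_of_linear (E := JacSpace n j) (affForm (toC M) (toC (vPart γ))).toLinearMap x₀
    exact analyticAt_const.mul (h3.cexp.mul (AnalyticAt.comp (f := fun y => A y + b) hGan h1))
  have heq : ∀ᶠ x in 𝓝 x₀,
      K * (Complex.exp (affForm (toC M) (toC (vPart γ)) x) * G (A x + b))
        = c * (jacFactor J k M γ x * f (jacAct γ x)) := by
    filter_upwards [jacFactor_eventually_eq J k M γ hx₀, (jacDomain_isOpen n j).mem_nhds hx₀]
      with x h1 h2
    rw [h1, hact x h2, hG, hh, hK]
    dsimp only
    rw [affForm_zero, Complex.exp_zero, hk]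
    ring
  rw [← heatOp_iterate_congr M r hfun heq, heatOp_iterate_affine hMs r 1 _ b K hGan, hAx,
    heatOp_iterate_siegelShift hM hS r w hhan,
    heatOp_iterate_affine hMs r Q⁻¹ 0 d 1 (by rw [hBw]; exact hf), hBw]
  have hJ : J.toFun g x₀.1 ^ k' = J.toFun g x₀.1 ^ k * Q⁻¹.det ^ (2 * r) := by
    rw [hk', zpow_add₀ (J.ne_zero g hx₀), det_nonsing_inv, Ring.inverse_eq_inv',
      ← J.sq_toFun g _ hx₀, ← pow_mul, ← zpow_natCast _ (2 * (2 * r))]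
    congr 2
    push_cast
    ring
  rw [jacFactor, hJ, expIndex_eq M γ hx₀, affForm_zero, hAx]
  have hq : shiftQuad S (0, w) = w * S * wᵀ := by simp [shiftQuad]
  rw [hq, hK]
  simp only [det_one, one_pow, Complex.exp_zero]
  ring

end Law

/-! ### The action of the Jacobi group -/

section Action

variable {n j : ℕ}

theorem toC_mul {l m o : Type*} [Fintype m] (A : Matrix l m ℝ) (B : Matrix m o ℝ) :
    toC (A * B) = toC A * toC B :=
  Matrix.map_mul (f := Complex.ofRealHom)

theorem toC_add {l m : Type*} (A B : Matrix l m ℝ) : toC (A + B) = toC A + toC B :=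
  Matrix.map_add _ Complex.ofReal_add A B

theorem jacobiGroup_mul_eq (γ₁ γ₂ : jacobiGroup n j) :
    fromBlocks ((γ₁ * γ₂).1.1.toBlocks₁₁) ((γ₁ * γ₂).1.1.toBlocks₁₂) ((γ₁ * γ₂).1.1.toBlocks₂₁)
      ((γ₁ * γ₂).1.1.toBlocks₂₂)
      = spEmbed (spPart γ₁).1 * heisMatrix (vPart γ₁) (uPart γ₁) (zetaPart γ₁)
        * (spEmbed (spPart γ₂).1 * heisMatrix (vPart γ₂) (uPart γ₂) (zetaPart γ₂)) := by
  rw [← jacobi_decomposition, ← jacobi_decomposition, fromBlocks_toBlocks]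
  rfl

/-- The components of a product in the Jacobi group. -/
theorem mul_blocks (γ₁ γ₂ : jacobiGroup n j) :
    (spPart (γ₁ * γ₂)).1.toBlocks₁₁ = (spPart γ₁).1.toBlocks₁₁ * (spPart γ₂).1.toBlocks₁₁
        + (spPart γ₁).1.toBlocks₁₂ * (spPart γ₂).1.toBlocks₂₁ ∧
    (spPart (γ₁ * γ₂)).1.toBlocks₁₂ = (spPart γ₁).1.toBlocks₁₁ * (spPart γ₂).1.toBlocks₁₂
        + (spPart γ₁).1.toBlocks₁₂ * (spPart γ₂).1.toBlocks₂₂ ∧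
    (spPart (γ₁ * γ₂)).1.toBlocks₂₁ = (spPart γ₁).1.toBlocks₂₁ * (spPart γ₂).1.toBlocks₁₁
        + (spPart γ₁).1.toBlocks₂₂ * (spPart γ₂).1.toBlocks₂₁ ∧
    (spPart (γ₁ * γ₂)).1.toBlocks₂₂ = (spPart γ₁).1.toBlocks₂₁ * (spPart γ₂).1.toBlocks₁₂
        + (spPart γ₁).1.toBlocks₂₂ * (spPart γ₂).1.toBlocks₂₂ ∧
    vPart (γ₁ * γ₂) = vPart γ₁ * (spPart γ₂).1.toBlocks₁₁ + vPart γ₂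
        + uPart γ₁ * (spPart γ₂).1.toBlocks₂₁ ∧
    uPart (γ₁ * γ₂) = vPart γ₁ * (spPart γ₂).1.toBlocks₁₂ + uPart γ₂
        + uPart γ₁ * (spPart γ₂).1.toBlocks₂₂ := by
  have h := jacobiGroup_mul_eq γ₁ γ₂
  have h1 : (spPart (γ₁ * γ₂)).1 = fromBlocks (γ₁ * γ₂).1.1.toBlocks₁₁.toBlocks₁₁
    (γ₁ * γ₂).1.1.toBlocks₁₂.toBlocks₁₁ (γ₁ * γ₂).1.1.toBlocks₂₁.toBlocks₁₁
    (γ₁ * γ₂).1.1.toBlocks₂₂.toBlocks₁₁ := rfl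
  have h2 : vPart (γ₁ * γ₂) = (γ₁ * γ₂).1.1.toBlocks₁₁.toBlocks₂₁ := rfl
  have h3 : uPart (γ₁ * γ₂) = (γ₁ * γ₂).1.1.toBlocks₁₂.toBlocks₂₁ := rfl
  rw [h1, h2, h3]
  generalize (γ₁ * γ₂).1.1 = X at h
  rw [← fromBlocks_toBlocks (spPart γ₁).1, ← fromBlocks_toBlocks (spPart γ₂).1,
    spEmbed_mul_heisMatrix, spEmbed_mul_heisMatrix, fromBlocks_multiply] at h
  obtain ⟨e1, e2, e3, e4⟩ := fromBlocks_inj.1 h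
  rw [e1, e2, e3, e4]
  simp [fromBlocks_multiply, fromBlocks_add, add_assoc]

theorem autNum_eq (g : symplecticGroup (Fin n) ℝ) {τ : symMat n} (hτ : τ ∈ siegelUpper n) :
    autNum g τ = (spAct g τ).1 * autDenom g τ := by
  show _ = autNum g τ * (autDenom g τ)⁻¹ * autDenom g τ
  rw [nonsing_inv_mul_cancel_right _ _ (det_autDenom_ne_zero g hτ).isUnit]

theorem autDenom_mul (γ₁ γ₂ : jacobiGroup n j) {τ : symMat n} (hτ : τ ∈ siegelUpper n) :
    autDenom (spPart (γ₁ * γ₂)) τ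
      = autDenom (spPart γ₁) (spAct (spPart γ₂) τ) * autDenom (spPart γ₂) τ := by
  obtain ⟨-, -, h3, h4, -, -⟩ := mul_blocks γ₁ γ₂
  conv_rhs => rw [autDenom, Matrix.add_mul, Matrix.mul_assoc, ← autNum_eq _ hτ]
  simp only [autDenom, autNum, h3, h4, toC_add, toC_mul, Matrix.mul_add, Matrix.add_mul,
    Matrix.mul_assoc]
  abel

theorem autNum_mul (γ₁ γ₂ : jacobiGroup n j) {τ : symMat n} (hτ : τ ∈ siegelUpper n) :
    autNum (spPart (γ₁ * γ₂)) τ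
      = autNum (spPart γ₁) (spAct (spPart γ₂) τ) * autDenom (spPart γ₂) τ := by
  obtain ⟨h1, h2, -, -, -, -⟩ := mul_blocks γ₁ γ₂
  conv_rhs => rw [autNum, Matrix.add_mul, Matrix.mul_assoc, ← autNum_eq _ hτ]
  simp only [autDenom, autNum, h1, h2, toC_add, toC_mul, Matrix.mul_add, Matrix.add_mul,
    Matrix.mul_assoc]
  abel

theorem jacAct_mul (γ₁ γ₂ : jacobiGroup n j) {x : JacSpace n j} (hx : x ∈ jacDomain n j) :
    jacAct (γ₁ * γ₂) x = jacAct γ₁ (jacAct γ₂ x) := by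
  have hd : IsUnit (autDenom (spPart γ₂) x.1).det := (det_autDenom_ne_zero _ hx).isUnit
  refine Prod.ext (Subtype.ext ?_) ?_
  · show autNum _ _ * (autDenom _ _)⁻¹ = autNum _ (spAct _ _) * (autDenom _ (spAct _ _))⁻¹
    rw [autNum_mul _ _ hx, autDenom_mul _ _ hx, Matrix.mul_inv_rev, ← Matrix.mul_assoc,
      mul_nonsing_inv_cancel_right _ _ hd]
  · obtain ⟨-, -, -, -, h5, h6⟩ := mul_blocks γ₁ γ₂
    show (x.2 + toC (uPart (γ₁ * γ₂)) + toC (vPart (γ₁ * γ₂)) * x.1.1)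
        * (autDenom (spPart (γ₁ * γ₂)) x.1)⁻¹
      = ((x.2 + toC (uPart γ₂) + toC (vPart γ₂) * x.1.1) * (autDenom (spPart γ₂) x.1)⁻¹
        + toC (uPart γ₁) + toC (vPart γ₁) * (spAct (spPart γ₂) x.1).1)
        * (autDenom (spPart γ₁) (spAct (spPart γ₂) x.1))⁻¹
    rw [autDenom_mul _ _ hx, Matrix.mul_inv_rev, ← Matrix.mul_assoc]
    congr 1
    have e : x.2 + toC (uPart (γ₁ * γ₂)) + toC (vPart (γ₁ * γ₂)) * x.1.1
        = x.2 + toC (uPart γ₂) + toC (vPart γ₂) * x.1.1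
          + toC (uPart γ₁) * autDenom (spPart γ₂) x.1
          + toC (vPart γ₁) * (spAct (spPart γ₂) x.1).1 * autDenom (spPart γ₂) x.1 := by
      rw [Matrix.mul_assoc, ← autNum_eq _ hx]
      simp only [h5, h6, autDenom, autNum, toC_add, toC_mul, Matrix.mul_add, Matrix.add_mul,
        Matrix.mul_assoc]
      abel
    rw [e, Matrix.add_mul, Matrix.add_mul, mul_nonsing_inv_cancel_right _ _ hd,
      mul_nonsing_inv_cancel_right _ _ hd]

theorem jacAct_one (x : JacSpace n j) : jacAct (1 : jacobiGroup n j) x = x := by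
  have h : (1 : jacobiGroup n j).1.1 = fromBlocks (fromBlocks 1 0 0 1) (fromBlocks 0 0 0 0)
      (fromBlocks 0 0 0 0) (fromBlocks 1 0 0 1) := by
    simp only [fromBlocks_one, fromBlocks_zero]
    rfl
  have h1 : toC (1 : Matrix (Fin n) (Fin n) ℝ) = 1 :=
    Matrix.map_one _ Complex.ofReal_zero Complex.ofReal_one
  have h0 : ∀ {l m : ℕ}, toC (0 : Matrix (Fin l) (Fin m) ℝ) = 0 :=
    Matrix.map_zero _ Complex.ofReal_zero
  have hQ : autDenom (spPart (1 : jacobiGroup n j)) x.1 = 1 := by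
    simp only [autDenom, spPart, h, toBlocks_fromBlocks₁₁, toBlocks_fromBlocks₁₂,
      toBlocks_fromBlocks₂₁, toBlocks_fromBlocks₂₂, h1, h0, Matrix.zero_mul, zero_add]
  have hN : autNum (spPart (1 : jacobiGroup n j)) x.1 = x.1.1 := by
    simp only [autNum, spPart, h, toBlocks_fromBlocks₁₁, toBlocks_fromBlocks₁₂,
      toBlocks_fromBlocks₂₁, toBlocks_fromBlocks₂₂, h1, h0, Matrix.one_mul, add_zero]
  refine Prod.ext (Subtype.ext ?_) ?_
  · show autNum _ _ * (autDenom _ _)⁻¹ = _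
    rw [hQ, hN, inv_one, Matrix.mul_one]
  · show (x.2 + toC (uPart (1 : jacobiGroup n j)) + toC (vPart (1 : jacobiGroup n j)) * x.1.1)
      * (autDenom _ _)⁻¹ = _
    rw [hQ]
    simp only [uPart, vPart, h, toBlocks_fromBlocks₁₁, toBlocks_fromBlocks₁₂, toBlocks_fromBlocks₂₁,
      h0, Matrix.zero_mul, add_zero,
      inv_one, Matrix.mul_one]

theorem symMat_sub_conjTranspose (τ : symMat n) :
    τ.1 - τ.1ᴴ = (2 * Complex.I) • toC (τ.1.map Complex.im) := by
  ext a b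
  have hab : τ.1 b a = τ.1 a b := congrFun (congrFun τ.2 a) b
  simp only [Matrix.sub_apply, conjTranspose_apply, hab, Matrix.smul_apply, toC, map_apply,
    smul_eq_mul]
  apply Complex.ext <;> simp
  ring

theorem re_dotProduct_toC (Y : Matrix (Fin n) (Fin n) ℝ) (w : Fin n → ℂ) :
    (star w ⬝ᵥ (toC Y *ᵥ w)).re =
      (fun i => (w i).re) ⬝ᵥ (Y *ᵥ fun i => (w i).re)
        + (fun i => (w i).im) ⬝ᵥ (Y *ᵥ fun i => (w i).im) := by
  simp only [dotProduct, mulVec, toC, map_apply, Pi.star_apply, Complex.re_sum,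
    ← Finset.sum_add_distrib, Finset.mul_sum]
  refine Finset.sum_congr rfl fun a _ => Finset.sum_congr rfl fun b _ => ?_
  simp

theorem re_dotProduct_toC_pos {Y : Matrix (Fin n) (Fin n) ℝ} (hY : Y.PosDef) {w : Fin n → ℂ}
    (hw : w ≠ 0) : 0 < (star w ⬝ᵥ (toC Y *ᵥ w)).re := by
  have h0 : ∀ v : Fin n → ℝ, 0 ≤ v ⬝ᵥ (Y *ᵥ v) := fun v => by
    simpa using hY.posSemidef.dotProduct_mulVec_nonneg v
  have h1 : ∀ v : Fin n → ℝ, v ≠ 0 → 0 < v ⬝ᵥ (Y *ᵥ v) := fun v hv => by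
    simpa using hY.dotProduct_mulVec_pos hv
  rw [re_dotProduct_toC]
  by_cases hr : (fun i => (w i).re) = 0
  · refine add_pos_of_nonneg_of_pos (h0 _) (h1 _ fun hi => hw ?_)
    exact funext fun i => Complex.ext (congrFun hr i) (congrFun hi i)
  · exact add_pos_of_pos_of_nonneg (h1 _ hr) (h0 _)

theorem spAct_mem (g : symplecticGroup (Fin n) ℝ) {τ : symMat n} (hτ : τ ∈ siegelUpper n) :
    spAct g τ ∈ siegelUpper n := by
  obtain ⟨h1, h2, h3, h4⟩ := symplectic_relations g
  have hτs : τ.1ᵀ = τ.1 := τ.2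
  have hC : ∀ A : Matrix (Fin n) (Fin n) ℝ, (toC A)ᴴ = (toC A)ᵀ := by
    intro A
    ext a b
    simp [toC]
  have key : (autDenom g τ)ᴴ * autNum g τ - (autNum g τ)ᴴ * autDenom g τ = τ.1 - τ.1ᴴ := by
    simp only [autDenom, autNum, conjTranspose_add, conjTranspose_mul, hC, Matrix.add_mul,
      Matrix.mul_add, Matrix.mul_assoc]
    simp only [← Matrix.mul_assoc (toC _)ᵀ, h1, h2, h3, h4]
    simp only [Matrix.add_mul, Matrix.mul_add, Matrix.one_mul, Matrix.mul_one]
    abel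
  have hd := det_autDenom_ne_zero g hτ
  set Q := autDenom g τ
  have hQ : Qᴴ * toC ((spAct g τ).1.map Complex.im) * Q = toC (τ.1.map Complex.im) := by
    have h := symMat_sub_conjTranspose (spAct g τ)
    have h' : (2 * Complex.I) • (Qᴴ * toC ((spAct g τ).1.map Complex.im) * Q)
        = (2 * Complex.I) • toC (τ.1.map Complex.im) := by
      rw [← symMat_sub_conjTranspose τ, ← key, autNum_eq g hτ, ← Matrix.smul_mul,
        ← Matrix.mul_smul, ← h, conjTranspose_mul, Matrix.mul_sub, Matrix.sub_mul]
      simp only [Matrix.mul_assoc]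
      rfl
    exact smul_right_injective _ (by simp) h'
  refine PosDef.of_dotProduct_mulVec_pos ?_ fun v hv => ?_
  · ext a b
    have : (spAct g τ).1 b a = (spAct g τ).1 a b := congrFun (congrFun (spAct g τ).2 a) b
    simp [this]
  · set u : Fin n → ℂ := fun i => (v i : ℂ) with hu
    have hQu : Q *ᵥ (Q⁻¹ *ᵥ u) = u := by
      rw [mulVec_mulVec, mul_nonsing_inv _ hd.isUnit, one_mulVec]
    have hne : Q⁻¹ *ᵥ u ≠ 0 := fun h => by
      rw [h, mulVec_zero] at hQu
      exact hv (funext fun i => by simpa [hu] using (congrFun hQu i).symm)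
    have h := re_dotProduct_toC_pos hτ hne
    rw [← hQ, ← mulVec_mulVec, ← mulVec_mulVec, dotProduct_mulVec, ← star_mulVec, hQu,
      re_dotProduct_toC] at h
    simpa [hu] using h

theorem jacAct_mem (γ : jacobiGroup n j) {x : JacSpace n j} (hx : x ∈ jacDomain n j) :
    jacAct γ x ∈ jacDomain n j := spAct_mem _ hx

theorem matAnalyticAt_autDenom (g : symplecticGroup (Fin n) ℝ) (x : JacSpace n j) :
    MatAnalyticAt (fun y : JacSpace n j => autDenom g y.1) x :=
  ((MatAnalyticAt.const _).mul (matAnalyticAt_tau analyticAt_id)).add (.const _)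

theorem analyticAt_jacAct (γ : jacobiGroup n j) {x : JacSpace n j} (hx : x ∈ jacDomain n j) :
    AnalyticAt ℂ (jacAct γ) x := by
  have hi := (matAnalyticAt_autDenom (spPart γ) x).inv (det_autDenom_ne_zero _ hx)
  have e : jacAct γ = fun y : JacSpace n j => (symProj n (autNum (spPart γ) y.1
      * (autDenom (spPart γ) y.1)⁻¹), (y.2 + toC (uPart γ) + toC (vPart γ) * y.1.1)
        * (autDenom (spPart γ) y.1)⁻¹) :=
    funext fun y => Prod.ext (Subtype.ext (symProj_apply (spAct (spPart γ) y.1).2).symm) rfl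
  rw [e]
  exact analyticAt_jacSpace
    ((((MatAnalyticAt.const _).mul (matAnalyticAt_tau analyticAt_id)).add (.const _)).mul hi)
    ((((matAnalyticAt_z analyticAt_id).add (.const _)).add
      ((MatAnalyticAt.const _).mul (matAnalyticAt_tau analyticAt_id))).mul hi)

theorem continuousAt_jacAct (γ : jacobiGroup n j) {x : JacSpace n j} (hx : x ∈ jacDomain n j) :
    ContinuousAt (jacAct γ) x := (analyticAt_jacAct γ hx).continuousAt

theorem continuousAt_jacFactor (J : SqrtBranch n) (k : ℤ) (M : Matrix (Fin j) (Fin j) ℝ)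
    (γ : jacobiGroup n j) {x : JacSpace n j} (hx : x ∈ jacDomain n j) :
    ContinuousAt (jacFactor J k M γ) x := by
  have hJ : ContinuousAt (fun y : JacSpace n j => J.toFun (spPart γ) y.1 ^ k) x := by
    have h1 : ContinuousAt (J.toFun (spPart γ)) x.1 :=
      (J.continuousOn_toFun _).continuousAt ((siegelUpper_isOpen n).mem_nhds hx)
    exact ContinuousAt.zpow₀ (h1.comp (f := Prod.fst) continuous_fst.continuousAt) k
      (Or.inl (J.ne_zero _ hx))
  have hi := (matAnalyticAt_autDenom (spPart γ) x).inv (det_autDenom_ne_zero _ hx)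
  have hτ : MatAnalyticAt (fun y : JacSpace n j => y.1.1) x := matAnalyticAt_tau analyticAt_id
  have hz : MatAnalyticAt (fun y : JacSpace n j => y.2) x := matAnalyticAt_z analyticAt_id
  have hw := (hz.add (.const (toC (uPart γ)))).add ((MatAnalyticAt.const (toC (vPart γ))).mul hτ)
  have h2z : MatAnalyticAt (fun y : JacSpace n j => 2 • y.2) x := by
    simpa only [two_smul] using hz.add hz
  have he : MatAnalyticAt (fun x : JacSpace n j => toC (zetaPart γ)
        + (toC (vPart γ) * x.1.1 + 2 • x.2 + toC (uPart γ)) * (toC (vPart γ))ᵀ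
        + (-1 : ℂ) • ((x.2 + toC (uPart γ) + toC (vPart γ) * x.1.1)
            * (autDenom (spPart γ) x.1)⁻¹ * toC (spPart γ).1.toBlocks₂₁
            * (x.2 + toC (uPart γ) + toC (vPart γ) * x.1.1)ᵀ)) x :=
    ((MatAnalyticAt.const _).add (((((MatAnalyticAt.const _).mul hτ).add h2z).add (.const _)).mul
      (.const _))).add (.smul analyticAt_const (((hw.mul hi).mul (.const _)).mul hw.transpose))
  simp only [neg_one_smul, ← sub_eq_add_neg] at he
  exact hJ.mul (analyticAt_const.mul ((MatAnalyticAt.const (toC M)).mul he).trace).cexp.continuousAt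

/-- Raising the weight by `2 r` multiplies the factor of automorphy by `det (C τ + D) ^ (-2 r)`. -/
theorem jacFactor_add (J : SqrtBranch n) (k : ℤ) (r : ℕ) (M : Matrix (Fin j) (Fin j) ℝ)
    (γ : jacobiGroup n j) {x : JacSpace n j} (hx : x ∈ jacDomain n j) :
    jacFactor J (k + 4 * r) M γ x
      = ((autDenom (spPart γ) x.1).det⁻¹) ^ (2 * r) * jacFactor J k M γ x := by
  have hJ : J.toFun (spPart γ) x.1 ^ (k + 4 * (r : ℤ)) = ((autDenom (spPart γ) x.1).det⁻¹) ^ (2 * r)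
      * J.toFun (spPart γ) x.1 ^ k := by
    rw [zpow_add₀ (J.ne_zero _ hx), ← J.sq_toFun _ _ hx, ← pow_mul, ← zpow_natCast _ (2 * (2 * r)),
      mul_comm]
    congr 2
    push_cast
    ring
  rw [jacFactor, jacFactor, hJ, mul_assoc]

end Action

/-! ### Meromorphic functions -/

section Meromorphic

open TopologicalSpace

variable {n j : ℕ} {E : Type*} [NormedAddCommGroup E] [NormedSpace ℂ E]

/-- A constant coefficient operator turns a quotient of analytic functions into such a quotient,
the denominator being a power of the given one. -/
theorem diffRep_div {ι : JacSpace n j →L[ℂ] E} {U V : Opens E} (hUV : U ≤ V) {a b : E → ℂ}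
    (ha : AnalyticOnNhd ℂ a V) (hb : AnalyticOnNhd ℂ b V) (hb0 : ∀ x ∈ U, b x ≠ 0) (F : holo U)
    (hF : ∀ x ∈ U, F.1 x = a x / b x) (q : HeatSymbol n j) :
    ∃ (a' : E → ℂ) (N : ℕ), AnalyticOnNhd ℂ a' V ∧
      ∀ x ∈ U, (diffRep U ι q F).1 x = a' x / b x ^ (N + 1) := by
  induction q using MvPolynomial.induction_on with
  | C c =>
    refine ⟨fun x => c * a x, 0, fun x hx => analyticAt_const.mul (ha x hx), fun x hx => ?_⟩
    rw [← MvPolynomial.algebraMap_eq, AlgHom.commutes]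
    show c * F.1 x = _
    rw [hF x hx, zero_add, pow_one, mul_div_assoc]
  | add p q hp hq =>
    obtain ⟨a₁, N₁, h₁, e₁⟩ := hp
    obtain ⟨a₂, N₂, h₂, e₂⟩ := hq
    refine ⟨fun x => a₁ x * b x ^ (N₂ + 1) + a₂ x * b x ^ (N₁ + 1), N₁ + N₂ + 1, fun x hx =>
      ((h₁ x hx).mul ((hb x hx).pow _)).add ((h₂ x hx).mul ((hb x hx).pow _)), fun x hx => ?_⟩
    rw [map_add]
    show (diffRep U ι p F).1 x + (diffRep U ι q F).1 x = _
    rw [e₁ x hx, e₂ x hx, show N₁ + N₂ + 1 + 1 = (N₁ + 1) + (N₂ + 1) by ring, pow_add _ (N₁ + 1),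
      div_add_div _ _ (pow_ne_zero _ (hb0 x hx)) (pow_ne_zero _ (hb0 x hx)),
      mul_comm _ (a₂ x)]
  | mul_X p i hp =>
    obtain ⟨a', N, h', e'⟩ := hp
    set v := ι (heatDir i)
    refine ⟨fun x => fderiv ℂ a' x v * b x - (N + 1) * (a' x * fderiv ℂ b x v), N + 1,
      fun x hx => ?_, fun x hx => ?_⟩
    · have h1 : ∀ {g : E → ℂ}, AnalyticOnNhd ℂ g V → AnalyticAt ℂ (fun y => fderiv ℂ g y v) x :=
        fun hg => (ContinuousLinearMap.apply ℂ ℂ v).analyticAt _ |>.comp (hg.fderiv x hx)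
      exact ((h1 h').mul (hb x hx)).sub (analyticAt_const.mul ((h' x hx).mul (h1 hb)))
    · rw [mul_comm, map_mul, diffRep_X, Module.End.mul_apply, holo.dirDeriv_apply _ _ hx]
      have he : (diffRep U ι p F).1 =ᶠ[𝓝 x] fun y => a' y * (b y ^ (N + 1))⁻¹ := by
        filter_upwards [U.isOpen.mem_nhds hx] with y hy
        rw [e' y hy, div_eq_mul_inv]
      have hp : HasFDerivAt (fun y => b y ^ (N + 1)) _ x :=
        (hb x (hUV hx)).differentiableAt.hasFDerivAt.pow (N + 1)
      have hi : HasFDerivAt (fun y => (b y ^ (N + 1))⁻¹) _ x :=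
        HasDerivAt.comp_hasFDerivAt (h₂ := fun c : ℂ => c⁻¹) x
          (hasDerivAt_inv (pow_ne_zero (N + 1) (hb0 x hx))) hp
      have hd := (h' x (hUV hx)).differentiableAt.hasFDerivAt.fun_mul hi
      rw [he.fderiv_eq, HasFDerivAt.fderiv hd]
      have := hb0 x hx
      simp
      field_simp
      ring

theorem heatOp_iterate_meromorphicAt {ι : JacSpace n j →L[ℂ] E} (M : Matrix (Fin j) (Fin j) ℝ)
    (r : ℕ) {h : JacSpace n j → ℂ} {f a b : E → ℂ} {p : E} (hf : ∀ x, h x = f (0 + ι x))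
    (ha : AnalyticAt ℂ a p)
    (hb : AnalyticAt ℂ b p) (hb0 : ¬ ∀ᶠ x in 𝓝 p, b x = 0)
    (hab : ∀ᶠ x in 𝓝 p, b x ≠ 0 → f x = a x / b x) :
    ∃ a' b' : E → ℂ, AnalyticAt ℂ a' p ∧ AnalyticAt ℂ b' p ∧ (¬ ∀ᶠ x in 𝓝 p, b' x = 0) ∧
      ∀ᶠ x in 𝓝 p, b' x ≠ 0 → ∀ y, 0 + ι y = x → (heatOp M)^[r] h y = a' x / b' x := by
  obtain ⟨W, hW, hWo, hpW⟩ := eventually_nhds_iff.1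
    ((ha.eventually_analyticAt.and hb.eventually_analyticAt).and hab)
  set V : Opens E := ⟨W, hWo⟩ with hV
  have haV : AnalyticOnNhd ℂ a V := fun x hx => (hW x hx).1.1
  have hbV : AnalyticOnNhd ℂ b V := fun x hx => (hW x hx).1.2
  set U : Opens E := ⟨W ∩ b ⁻¹' {0}ᶜ,
    hbV.continuousOn.isOpen_inter_preimage hWo isOpen_compl_singleton⟩ with hU
  have hFan : AnalyticOnNhd ℂ (fun x => a x / b x) U :=
    fun x hx => (haV x hx.1).div (hbV x hx.1) hx.2
  obtain ⟨a', N, ha', e⟩ := diffRep_div (ι := ι) (U := U) (V := V) (fun x hx => hx.1) haV hbV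
    (fun x hx => hx.2) (holo.mk _ hFan) (fun x hx => holo.mk_apply hFan hx)
    ((heatSymbol (toC M)).det ^ r)
  refine ⟨a', fun x => b x ^ (N + 1), ha' p hpW, hb.pow _, fun h0 => hb0 ?_, ?_⟩
  · filter_upwards [h0] with x hx using pow_eq_zero_iff (Nat.succ_ne_zero N) |>.1 hx
  · filter_upwards [hWo.mem_nhds hpW] with x hx hbx y hy
    subst hy
    have hxU : 0 + ι y ∈ U := ⟨hx, fun h => hbx (by rw [h, zero_pow (Nat.succ_ne_zero N)])⟩
    rw [heatOp_iterate_eq_diffRep (f := holo.mk _ hFan) M (fun z hz => ?_) r y hxU, e _ hxU]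
    rw [hf, holo.mk_apply hFan hz]
    exact (hW _ hz.1).2 hz.2

theorem IsMeromorphicFunOn.heatOp_iterate (M : Matrix (Fin j) (Fin j) ℝ) (r : ℕ)
    {f : JacSpace n j → ℂ} {U : Set (JacSpace n j)} (hf : IsMeromorphicFunOn f U) :
    IsMeromorphicFunOn ((heatOp M)^[r] f) U := by
  intro p hp
  obtain ⟨a, b, ha, hb, hb0, hab⟩ := hf p hp
  obtain ⟨a', b', ha', hb', hb0', h'⟩ := heatOp_iterate_meromorphicAt
    (ι := ContinuousLinearMap.id ℂ (JacSpace n j)) M r (f := f)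
    (fun x => congrArg f (zero_add x).symm) ha hb hb0 hab
  refine ⟨a', b', ha', hb', hb0', ?_⟩
  filter_upwards [h'] with x hx hbx using hx hbx x (zero_add x)

/-- A meromorphic function is analytic on a dense set. -/
theorem IsMeromorphicFunOn.frequently_analyticAt {f : E → ℂ} {U : Set E}
    (hf : IsMeromorphicFunOn f U) {p : E} (hp : p ∈ U) : ∃ᶠ x in 𝓝 p, AnalyticAt ℂ f x := by
  obtain ⟨a, b, ha, hb, hb0, hab⟩ := hf p hp
  have h := (ha.eventually_analyticAt.and hb.eventually_analyticAt).and
    (eventually_eventually_nhds.2 hab)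
  refine (Filter.Frequently.and_eventually (Filter.not_eventually.1 hb0) h).mono ?_
  rintro x ⟨hbx, ⟨hax, hbx'⟩, hx⟩
  refine (hax.div hbx' hbx).congr ?_
  filter_upwards [hx, hbx'.continuousAt.eventually_ne hbx] with y hy hby using (hy hby).symm

end Meromorphic

section Modular

variable {n j : ℕ}

theorem jacAct_inv_jacAct (γ : jacobiGroup n j) {x : JacSpace n j} (hx : x ∈ jacDomain n j) :
    jacAct γ⁻¹ (jacAct γ x) = x := by
  rw [← jacAct_mul _ _ hx, inv_mul_cancel, jacAct_one]

theorem jacAct_jacAct_inv (γ : jacobiGroup n j) {x : JacSpace n j} (hx : x ∈ jacDomain n j) :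
    jacAct γ (jacAct γ⁻¹ x) = x := by
  rw [← jacAct_mul _ _ hx, mul_inv_cancel, jacAct_one]

/-- The points at which both `f` and `f ∘ γ` are analytic are dense. -/
theorem frequently_analyticAt_and_jacAct {f : JacSpace n j → ℂ}
    (hf : IsMeromorphicFunOn f (jacDomain n j)) (γ : jacobiGroup n j) {x₀ : JacSpace n j}
    (hx₀ : x₀ ∈ jacDomain n j) :
    ∃ᶠ x in 𝓝 x₀, x ∈ jacDomain n j ∧ AnalyticAt ℂ f x ∧ AnalyticAt ℂ f (jacAct γ x) := by
  have hopen : ∀ {x}, x ∈ jacDomain n j → ∀ᶠ y in 𝓝 x, y ∈ jacDomain n j :=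
    fun hx => (jacDomain_isOpen n j).mem_nhds hx
  rw [Filter.frequently_iff]
  intro V hV
  obtain ⟨W, hWV, hWo, hxW⟩ := mem_nhds_iff.1 hV
  have h1 : ∃ᶠ x in 𝓝 x₀, AnalyticAt ℂ f x := hf.frequently_analyticAt hx₀
  obtain ⟨x₁, h₁, hW₁, hd₁⟩ := (h1.and_eventually
    ((hWo.eventually_mem hxW).and (hopen hx₀))).exists
  have hy : jacAct γ x₁ ∈ jacDomain n j := jacAct_mem γ hd₁
  have h2 : ∃ᶠ y in 𝓝 (jacAct γ x₁), AnalyticAt ℂ f y := hf.frequently_analyticAt hy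
  have h3 : ∀ᶠ x in 𝓝 (jacAct γ⁻¹ (jacAct γ x₁)), x ∈ W ∧ AnalyticAt ℂ f x := by
    rw [jacAct_inv_jacAct γ hd₁]
    exact (hWo.eventually_mem hW₁).and h₁.eventually_analyticAt
  have h4 := (continuousAt_jacAct γ⁻¹ hy).eventually h3
  obtain ⟨y, hy1, ⟨hy2, hy3⟩, hy4⟩ := (h2.and_eventually (h4.and (hopen hy))).exists
  refine ⟨jacAct γ⁻¹ y, hWV hy2, jacAct_mem _ hy4, hy3, ?_⟩
  rwa [jacAct_jacAct_inv γ hy4]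

end Modular

theorem mainTheorem2 (n j : ℕ) (J : SqrtBranch n)
    (M : Matrix (Fin j) (Fin j) ℝ) (hM : M.PosDef)
    (r : ℕ) (k k' : ℤ)
    (hk : (k : ℚ) / 2 = -(r : ℚ) + ((n : ℚ) + j + 1) / 2)
    (hk' : (k' : ℚ) / 2 = (r : ℚ) + ((n : ℚ) + j + 1) / 2)
    (Γ : Subgroup (jacobiGroup n j)) (χ : Γ → ℂ) (f : JacSpace n j → ℂ)
    (hf : IsMeromorphicJacobiForm J k M Γ χ f) :
    IsMeromorphicJacobiForm J k' M Γ χ ((heatOp M)^[r] f) := by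
  have hkC : (k : ℂ) = n + j + 1 - 2 * r := by
    have : (k : ℚ) = n + j + 1 - 2 * r := by linarith
    exact_mod_cast congrArg (Rat.cast : ℚ → ℂ) this
  have hkk' : k' = k + 4 * r := by
    have : (k' : ℚ) = k + 4 * r := by linarith
    exact_mod_cast this
  refine ⟨hf.discrete, fun γ₁ γ₂ x hx => ?_, hf.meromorphic.heatOp_iterate M r,
    fun γ x₀ hx₀ h₁ h₂ => ?_⟩
  · have h := hf.cocycle γ₁ γ₂ x hx
    rw [hkk', jacFactor_add J k r M _ hx, jacFactor_add J k r M _ hx,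
      jacFactor_add J k r M _ (jacAct_mem _ hx)]
    have hd : (autDenom (spPart (γ₁ * γ₂ : Γ).1) x.1).det
        = (autDenom (spPart γ₁.1) (jacAct γ₂.1 x).1).det * (autDenom (spPart γ₂.1) x.1).det := by
      rw [← det_mul]
      exact congrArg det (autDenom_mul γ₁.1 γ₂.1 hx)
    rw [hd, mul_inv, mul_pow]
    linear_combination ((autDenom (spPart γ₁.1) (jacAct γ₂.1 x).1).det⁻¹ ^ (2 * r)
      * (autDenom (spPart γ₂.1) x.1).det⁻¹ ^ (2 * r)) * h
  · -- The law holds on a dense set by the local law, hence at `x₀` by continuity.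
    have hfreq : ∃ᶠ x in 𝓝 x₀, (heatOp M)^[r] f x
        = jacFactor J k' M γ.1 x * χ γ * (heatOp M)^[r] f (jacAct γ.1 x) := by
      refine (frequently_analyticAt_and_jacAct hf.meromorphic γ.1 hx₀).mono ?_
      rintro x ⟨hx, hfx, hfγx⟩
      have he : ∀ᶠ y in 𝓝 x, f y = χ γ * (jacFactor J k M γ.1 y * f (jacAct γ.1 y)) := by
        filter_upwards [(jacDomain_isOpen n j).mem_nhds hx, hfx.eventually_analyticAt,
          (continuousAt_jacAct γ.1 hx).eventually hfγx.eventually_analyticAt] with y h1 h2 h3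
        rw [← hf.modular γ y h1 h2 h3]
        ring
      rw [heatOp_iterate_congr M r hfx he, heatOp_iterate_jacFactor J hM r hkC hkk' γ.1 hx hfγx]
      ring
    have hc : ContinuousAt (fun x => (heatOp M)^[r] f x
        - jacFactor J k' M γ.1 x * χ γ * (heatOp M)^[r] f (jacAct γ.1 x)) x₀ :=
      ContinuousAt.sub h₁.continuousAt (((continuousAt_jacFactor J k' M γ.1 hx₀).mul
        continuousAt_const).mul (ContinuousAt.comp (f := jacAct γ.1) h₂.continuousAt
          (continuousAt_jacAct γ.1 hx₀)))
    by_contra hne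
    refine hfreq ((hc.eventually_ne (sub_ne_zero.2 (Ne.symm hne))).mono fun x hx h => hx ?_)
    exact sub_eq_zero.2 h
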